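/- **Model.** Let $n\ge 1$, $\alpha,\beta,\sigma>0$. A symmetric matrix $F\in[0,1]^{n\times n}$ belongs to $\mathcal{BL}(\alpha,\beta)$ (bi-Lipschitz) if for all $i<j$: $|F_{ik}-F_{jk}|\le\beta|i-j|/n$ for all $k$; $F_{ik}-F_{jk}\ge\alpha|i-j|/n$ for all $k\le i$; and $F_{jk}-F_{ik}\ge\alpha|i-j|/n$ for all $k\ge j$. One observes $A=F_\pi+\sigma E$, where $\pi$ is an unknown permutation of $[n]$, $(F_\pi)_{ij}=F_{\pi_i\pi_j}$, and $E$ is a symmetric random matrix whose entries $E_{ij}$, $i\le j$, are independent, centred, with $\mathbb E e^{sE_{ij}}\le e^{s^2/2}$ for all $s\in\mathbb R$. With $\pi^{\mathrm{rev}}_i=n+1-\pi_i$ and $\|\cdot\|$ the Frobenius norm, let $$L_F(\hat\pi,\pi)=\|F_{\hat\pi}-F_\pi\|\wedge\|F_{\hat\pi}-F_{\pi^{\mathrm{rev}}}\|.$$ **The estimator $\hat\pi$ (SABRE).** Put $\delta_1=n^{3/4}\log n$ and $\delta_{k+1}=\delta_k\log n$ for $k=1,2,3$. *Distances.* For $S\subset[n]$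 let $A^S$ be $A$ with all entries outside $S\times S$ replaced by $0$, with rows $A^S_i$. For $i\in S$ let $\hat m_i$ minimize $\max_{k\in S\setminus\{i,j\}}|\langle A^S_k,A^S_i-A^S_j\rangle|$ over $j\in S\setminus\{i\}$. For distinct $i,j\in S$ let $\widehat D_{ij}(S)\ge0$ be the square root of the positive part of $n(\langle A^S_i,A^S_{\hat m_i}\rangle+\langle A^S_j,A^S_{\hat m_j}\rangle-2\langle A^S_i,A^S_j\rangle)$; all other entries of $\widehat D(S)$ are $0$. Write $D=\widehat D([n])$. *First seriation.* For each $i$ join distinct $k,l\in[n]\setminus\{i\}$ by an edge if $D_{kl}\le\delta_1$ and $D_{ik}\vee D_{il}\ge\delta_2$. Let $G_i,G_i'$ be the two largest (possibly empty, if missing) connected components on $[n]\setminus\{i\}$ that contain a $k$ with $D_{ik}\ge\delta_3$. Choose $c$ maximizing $|G_i|\wedge|G'_i|$ and set $(L_c,R_c)=(G_c,G_c')$. For $i\ne c$ with $G_i'=\emptyset$ set $(L_i,R_i)=(\emptyset,G_i)$ if $i\in L_c$, and $(G_i,\emptyset)$ otherwise. For $i\neq c$ with $G'_i\ne\emptyset$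 set $(L_i,R_i)=(G_i',G_i)$ if $G_i\cap L_c=\emptyset$ or $G_i'\cap R_c=\emptyset$, and $(G_i,G_i')$ otherwise. For $i\ne j$ with $(L_i,R_i)\ne(\emptyset,\emptyset)$ let $H_{ij}=-1$ if $i\in L_j$ or $j\in R_i$; otherwise $H_{ij}=1$ if $i\in R_j$ or $j\in L_i$. All other $H_{ij}$ are $0$. *Refinement.* Draw, independently of $E$, a uniformly random ordered partition $[n]=S^1\cup S^2\cup S^3$ with $\lfloor n/3\rfloor\le|S^t|\le\lceil n/3\rceil$. For $i<j$ with $H_{ij}=0$ choose $t$ with $i,j\notin S^t$ and $p$ minimizing $D_{ip}$ over $p\in S^t$. Let $l$ (resp. $r$) be the sum of $A_{ik}-A_{jk}$ over the $k\in S^t$ with $\widehat D(S^t)_{pk}\ge\delta_4$ and $H_{ik}=H_{jk}=1$ (resp. $=-1$). Set $\widetilde H_{ij}=-\mathrm{sign}(l)$ if $|l|\ge5\sigma\sqrt{n\log n}$; otherwise $\widetilde H_{ij}=\mathrm{sign}(r)$ if $|r|\ge5\sigma\sqrt{n\log n}$; otherwise $\widetilde H_{ij}=0$. Put $\widetilde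 H_{ji}=-\widetilde H_{ij}$, let all other $\widetilde H_{ij}$ be $0$, and let $\widehat H=H+\widetilde H$. Finally $\hat\pi_i\in[n]$ is $(\sum_j\widehat H_{ij}+n+1)/2$, rounded to a nearest integer and truncated to $[1,n]$. Ties and free choices above are settled by arbitrary rules fixed in advance: a rule selecting an element from each set of admissible indices (components being represented by one of their elements), a rule for $t$ given the blocks of $i$ and $j$, and a rule for rounding half-integers. **Statement.** (a) For all $\alpha,\beta,\sigma>0$ there is a constant $C_{\alpha\beta\sigma}$, depending only on $(\alpha,\beta,\sigma)$, such that for all $n\ge C_{\alpha\beta\sigma}$, all symmetric $F\in\mathcal{BL}(\alpha,\beta)$, all permutations $\pi$, all noise laws and all rules as above, $$\mathbb P\Big\{L_F(\hat\pi,\pi)\le 320\,\frac{\beta\sigma}{\alpha}\sqrt{n\log n}\Big\}\ge1-\frac1{n^2}.$$ This includes Toeplitz matrices $F$; with $\beta/\alpha$ fixed the bound is then of the order $\sigma\sqrt{n\log n}$. (b) Given $A$, $\sigma$, the partition and the rules, $\hat\pi$ is computed in polynomial time: an explicit implementation of the algorithm uses at most $K n^3$ elementary operations on real numbers, comparisons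 and array accesses, with a universal constant $K$. -/

import Mathlib

open MeasureTheory ProbabilityTheory

noncomputable section

/-! ## Computations with a step count

A real-arithmetic random access machine with unit costs.  A value of `Timed α` is the result of a
computation together with the number of elementary steps it took.  An elementary step is one
arithmetic operation (including `√`, `log`, real powers), one comparison, one logical connective,
or one access to an array. Arrays are functions on `Fin n`; they are stored (and their entries
paid for) by `tab`. -/

/-- A result together with the number of elementary steps spent on it. -/
structure Timed (α : Type) where
  val : α
  cost : ℕ

namespace Timed

instance : Monad Timed where
  pure a := ⟨a, 0⟩
  bind x f := ⟨(f x.val).val, x.cost + (f x.val).cost⟩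

variable {α : Type} {n : ℕ}

/-- The value `a` of an expression with at most `c` elementary operations and array accesses. -/
def op (c : ℕ) (a : α) : Timed α := ⟨a, c⟩

/-- Compute and store the array with entries `f i`. -/
def tab (f : Fin n → Timed α) : Timed (Fin n → α) :=
  ⟨fun i => (f i).val, ∑ i, ((f i).cost + 1)⟩

/-- Compute the sum of the `f i`. -/
def total [AddCommMonoid α] (f : Fin n → Timed α) : Timed α :=
  ⟨∑ i, (f i).val, ∑ i, ((f i).cost + 1)⟩

/-- Count the `i` with `f i = true`. -/
def count (f : Fin n → Timed Bool) : Timed ℕ :=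
  ⟨(Finset.univ.filter fun i => (f i).val = true).card, ∑ i, ((f i).cost + 1)⟩

/-- The maximum of `0` and of all the `f i`. -/
def largest (f : Fin n → Timed ℝ) : Timed ℝ :=
  ⟨Finset.univ.fold max 0 fun i => (f i).val, ∑ i, ((f i).cost + 1)⟩

/-- Start from the array with all entries `false` and, for each `i` with `f i = some l`, set its
entry at `l` to `true`. -/
def mark (f : Fin n → Timed (Option (Fin n))) : Timed (Fin n → Bool) :=
  ⟨fun l => decide (∃ i, (f i).val = some l), n + ∑ i, ((f i).cost + 1)⟩

/-- The set of all minimizers of `f` among the candidates. -/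
def minimizers (cand : Fin n → Bool) (f : Fin n → ℝ) : Finset (Fin n) :=
  Finset.univ.filter fun i => cand i = true ∧ ∀ j, cand j = true → f i ≤ f j

/-- A minimizer of `f` among the candidates, the one that the rule `pick` selects from the set of
all minimizers; `none` if there is no candidate. One pass finds the minimum, a second one
collects the minimizers, a third one reads them. -/
def argmin (pick : Finset (Fin n) → Fin n) (cand : Fin n → Timed Bool) (f : Fin n → Timed ℝ) :
    Timed (Option (Fin n)) :=
  let s := minimizers (fun i => (cand i).val) (fun i => (f i).val)
  ⟨if s.Nonempty then some (pick s) else none, ∑ i, ((cand i).cost + (f i).cost + 3)⟩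

/-- In the labelling `lab`, relabel the class of `v` and the classes of all neighbours of `v`
by `v`. -/
def relabel (adj : Fin n → Fin n → Timed Bool) (lab : Fin n → Fin n) (v : Fin n) :
    Timed (Fin n → Fin n) := do
  let hit ← mark fun u => do
    let b ← adj u v
    op 4 (if b = true ∨ u = v then some (lab u) else none)
  tab fun u => op 4 (if hit (lab u) = true then v else lab u)

/-- Connected components of the graph on `Fin n` with adjacency `adj`: the result assigns
to every vertex a label, and two vertices have the same label if and only if they are
connected (`components_spec`). Every vertex starts with itself as label; then `relabel` is applied
to each vertex in turn. -/
def components (adj : Fin n → Fin n → Timed Bool) : Timed (Fin n → Fin n) := do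
  let start ← tab fun u => op 1 u
  (List.finRange n).foldlM (relabel adj) start

theorem val_relabel (adj : Fin n → Fin n → Timed Bool) (lab : Fin n → Fin n) (v x : Fin n) :
    ((relabel adj lab v).val x = v ∧ ∃ y, ((adj y v).val = true ∨ y = v) ∧ lab y = lab x) ∨
    ((relabel adj lab v).val x = lab x ∧
      ¬ ∃ y, ((adj y v).val = true ∨ y = v) ∧ lab y = lab x) := by
  have h : (relabel adj lab v).val x =
      if decide (∃ y, (if (adj y v).val = true ∨ y = v then some (lab y) else none) =
        some (lab x)) = true then v else lab x := rfl
  have h' : (∃ y, (if (adj y v).val = true ∨ y = v then some (lab y) else none) =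
      some (lab x)) ↔ ∃ y, ((adj y v).val = true ∨ y = v) ∧ lab y = lab x := by
    refine exists_congr fun y => ?_
    split_ifs with hy <;> simp [hy]
  rw [h]
  by_cases hx : ∃ y, ((adj y v).val = true ∨ y = v) ∧ lab y = lab x
  · exact Or.inl ⟨if_pos (decide_eq_true (h'.2 hx)), hx⟩
  · exact Or.inr ⟨if_neg fun hd => hx (h'.1 (of_decide_eq_true hd)), hx⟩

theorem components_spec (adj : Fin n → Fin n → Timed Bool) (G : SimpleGraph (Fin n))
    (hG : ∀ u v, (adj u v).val = true ↔ G.Adj u v) (u w : Fin n) :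
    (components adj).val u = (components adj).val w ↔ G.Reachable u w := by
  have key : ∀ (l : List (Fin n)) (s : Fin n → Fin n), (∀ x, G.Reachable x (s x)) →
      (∀ x, G.Reachable x ((l.foldlM (relabel adj) s).val x)) ∧
      (∀ x y, s x = s y →
        (l.foldlM (relabel adj) s).val x = (l.foldlM (relabel adj) s).val y) ∧
      (∀ x v, v ∈ l → G.Adj x v →
        (l.foldlM (relabel adj) s).val x = (l.foldlM (relabel adj) s).val v) := by
    intro l
    induction l with
    | nil => exact fun s h => ⟨h, fun x y h => h, fun x v hv => by simp at hv⟩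
    | cons a l ih =>
      intro s h1
      have e1 : ∀ x y, s x = s y → (relabel adj s a).val x = (relabel adj s a).val y := by
        intro x y h
        rcases val_relabel adj s a x with ⟨hx, h3⟩ | ⟨hx, h3⟩ <;>
        rcases val_relabel adj s a y with ⟨hy, h4⟩ | ⟨hy, h4⟩ <;> rw [h] at h3
        · rw [hx, hy]
        · exact absurd h3 h4
        · exact absurd h4 h3
        · rw [hx, hy, h]
      have e2 : ∀ x, G.Reachable x ((relabel adj s a).val x) := by
        intro x
        rcases val_relabel adj s a x with ⟨hx, y, hy, hy2⟩ | ⟨hx, -⟩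
        · rw [hx]
          have hya : G.Reachable y a := by
            rcases hy with h | rfl
            · exact ((hG _ _).1 h).reachable
            · exact SimpleGraph.Reachable.refl _
          exact ((h1 x).trans (hy2 ▸ (h1 y).symm)).trans hya
        · rw [hx]; exact h1 x
      obtain ⟨i1, i2, i3⟩ := ih (relabel adj s a).val e2
      change (∀ x, G.Reachable x ((l.foldlM (relabel adj) (relabel adj s a).val).val x)) ∧
        (∀ x y, s x = s y → (l.foldlM (relabel adj) (relabel adj s a).val).val x =
          (l.foldlM (relabel adj) (relabel adj s a).val).val y) ∧
        (∀ x v, v ∈ a :: l → G.Adj x v →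
          (l.foldlM (relabel adj) (relabel adj s a).val).val x =
            (l.foldlM (relabel adj) (relabel adj s a).val).val v)
      refine ⟨i1, fun x y h => i2 x y (e1 x y h), fun x v hv hx => ?_⟩
      rcases List.mem_cons.1 hv with rfl | hv
      · apply i2
        rcases val_relabel adj s v x with ⟨hx1, -⟩ | ⟨-, h3⟩
        · rcases val_relabel adj s v v with ⟨hv1, -⟩ | ⟨-, h4⟩
          · rw [hx1, hv1]
          · exact absurd ⟨v, Or.inr rfl, rfl⟩ h4
        · exact absurd ⟨x, Or.inl ((hG _ _).2 hx), rfl⟩ h3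
      · exact i3 x v hv hx
  obtain ⟨k1, -, k3⟩ := key (List.finRange n) (fun u => u) fun x => SimpleGraph.Reachable.refl _
  constructor
  · intro h
    have h2 := k1 w
    change (components adj).val u = (components adj).val w at h
    change G.Reachable w ((components adj).val w) at h2
    rw [← h] at h2
    exact (k1 u).trans h2.symm
  · rintro ⟨p⟩
    induction p with
    | nil => rfl
    | cons h p ih => exact (k3 _ _ (List.mem_finRange _) h).trans ih

end Timed

open Timed

/-! ## The algorithm SABRE -/

/-- The choices which SABRE leaves open, as fixed rules. -/
structure SabreChoices (n : ℕ) where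
  /-- which element of a set of minimizers (or maximizers) is taken -/
  pick : Finset (Fin n) → Fin n
  pick_mem : ∀ s : Finset (Fin n), s.Nonempty → pick s ∈ s
  /-- which block is used for a pair of items that lie in the blocks `a` and `b` -/
  block : Fin 3 → Fin 3 → Fin 3
  block_ne_left : ∀ a b, block a b ≠ a
  block_ne_right : ∀ a b, block a b ≠ b
  /-- how half-integers are rounded: `halve s` is an integer nearest to `s / 2` -/
  halve : ℤ → ℤ
  abs_halve : ∀ s, |2 * halve s - s| ≤ 1

/-- Smallest elements, first admissible blocks, and rounding down are admissible choices. -/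
def SabreChoices.lowest (n : ℕ) [NeZero n] : SabreChoices n where
  pick s := if h : s.Nonempty then s.min' h else 0
  pick_mem s h := by simpa [h] using s.min'_mem h
  block a b := if a ≠ 0 ∧ b ≠ 0 then 0 else if a ≠ 1 ∧ b ≠ 1 then 1 else 2
  block_ne_left := by decide
  block_ne_right := by decide
  halve s := s / 2
  abs_halve s := by rw [abs_le]; constructor <;> omega

/-- The tuning parameters: `δ₁ = n ^ (3/4) * log n` and `δ (k + 1) = δ k * log n`. -/
def sabreDelta (n k : ℕ) : ℝ := (n : ℝ) ^ (3 / 4 : ℝ) * Real.log n ^ k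

section Algorithm

variable {n : ℕ} (ch : SabreChoices n)

/-- Distance estimation from the submatrix of `A` on `S × S`. With the Gram matrix `G` of the
rows of this submatrix, `|⟨A k, A i - A j⟩| = |G k i - G k j|`. The estimate is `0` where the
estimated squared distance is negative. -/
def estimateDistance (A : Matrix (Fin n) (Fin n) ℝ) (S : Fin n → Bool) :
    Timed (Fin n → Fin n → ℝ) := do
  let B ← tab fun i => tab fun j => op 10 (if S i = true ∧ S j = true then A i j else 0)
  let G ← tab fun i => tab fun j => total fun k => op 5 (B i k * B j k)
  let m ← tab fun i => do
    let j ← argmin ch.pick (fun j => op 4 (decide (S j = true ∧ j ≠ i))) fun j =>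
      largest fun k => op 15 (if S k = true ∧ k ≠ i ∧ k ≠ j then |G k i - G k j| else 0)
    op 1 (j.getD i)
  tab fun i => tab fun j => op 20 (if S i = true ∧ S j = true ∧ i ≠ j then
    √((n : ℝ) * (G i (m i) + G j (m j) - 2 * G i j)) else 0)

/-- The pair `(G i, G' i)` of the two largest connected components, of the graph on the vertices
other than `i` in which `k`, `l` are adjacent when `D k l ≤ δ₁` and
`max (D i k) (D i l) ≥ δ₂`, among those with a vertex `k` such that `D i k ≥ δ₃`.
A missing component is the empty set. (In `components` the index `i` is an isolated vertex, which
is not a candidate later on.) -/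
def bisection (δ₁ δ₂ δ₃ : ℝ) (D : Fin n → Fin n → ℝ) (i : Fin n) :
    Timed ((Fin n → Bool) × (Fin n → Bool)) := do
  let lab ← components fun k l => op 20
    (decide (k ≠ l ∧ k ≠ i ∧ l ≠ i ∧ D k l ≤ δ₁ ∧ δ₂ ≤ max (D i k) (D i l)))
  let far ← mark fun k => op 6 (if k ≠ i ∧ δ₃ ≤ D i k then some (lab k) else none)
  let size ← tab fun l => count fun k => op 2 (decide (lab k = l))
  let a ← argmin ch.pick (fun l => op 1 (far l)) fun l => op 2 (-(size l : ℝ))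
  let b ← argmin ch.pick (fun l => op 3 (decide (far l = true ∧ a ≠ some l)))
    fun l => op 2 (-(size l : ℝ))
  let G ← tab fun k => op 2 (decide (a = some (lab k)))
  let G' ← tab fun k => op 2 (decide (b = some (lab k)))
  op 1 (G, G')

/-- The subroutine that orients all pairs `(G i, G' i)` consistently into `(L i, R i)`. -/
def orientation (G : Fin n → (Fin n → Bool) × (Fin n → Bool)) :
    Timed (Fin n → (Fin n → Bool) × (Fin n → Bool)) := do
  let size ← tab fun i => do
    let x ← count fun k => op 3 ((G i).1 k)
    let y ← count fun k => op 3 ((G i).2 k)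
    op 1 (min x y)
  let c ← argmin ch.pick (fun _ => op 1 true) fun i => op 2 (-(size i : ℝ))
  tab fun i => do
    let c ← op 1 (c.getD i)
    let y ← count fun k => op 3 ((G i).2 k)
    let p ← count fun k => op 8 ((G i).1 k && (G c).1 k)
    let q ← count fun k => op 8 ((G i).2 k && (G c).2 k)
    op 20 (
      if i = c then G i
      else if y = 0 then
        if (G c).1 i = true then (fun _ => false, (G i).1) else ((G i).1, fun _ => false)
      else if p = 0 ∨ q = 0 then ((G i).2, (G i).1) else G i)

/-- First seriation: the partial comparison matrix `H`, with entries in `{-1, 0, 1}`. -/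
def aggregateBisections (δ₁ δ₂ δ₃ : ℝ) (D : Fin n → Fin n → ℝ) : Timed (Fin n → Fin n → ℤ) := do
  let G ← tab fun i => bisection ch δ₁ δ₂ δ₃ D i
  let LR ← orientation ch G
  let size ← tab fun i => count fun k => op 8 ((LR i).1 k || (LR i).2 k)
  tab fun i => tab fun j => op 25 (
    if i = j ∨ size i = 0 then 0
    else if (LR j).1 i = true ∨ (LR i).2 j = true then -1
    else if (LR j).2 i = true ∨ (LR i).1 j = true then 1
    else 0)

/-- Refined seriation: the comparison matrix `Ĥ`. The partition of the items into three blocks is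
given by `T : Fin n → Fin 3`. -/
def reevaluateComparisons (H : Fin n → Fin n → ℤ) (D : Fin n → Fin n → ℝ)
    (A : Matrix (Fin n) (Fin n) ℝ) (σ δ₄ : ℝ) (T : Fin n → Fin 3) :
    Timed (Fin n → Fin n → ℤ) := do
  let Dt ← tab fun t : Fin 3 => do
    let S ← tab fun i => op 2 (decide (T i = t))
    estimateDistance ch A S
  let τ ← op 10 (5 * σ * √(n * Real.log n))
  let W ← tab fun i => tab fun j => do
    let t ← op 5 (ch.block (T i) (T j))
    let p ← argmin ch.pick (fun q => op 2 (decide (T q = t))) fun q => op 2 (D i q)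
    let p ← op 1 (p.getD i)
    let l ← total fun k => op 25
      (if H i k = 1 ∧ H j k = 1 ∧ T k = t ∧ δ₄ ≤ Dt t p k then A i k - A j k else 0)
    let r ← total fun k => op 25
      (if H i k = -1 ∧ H j k = -1 ∧ T k = t ∧ δ₄ ≤ Dt t p k then A i k - A j k else 0)
    op 20 (
      if i < j ∧ H i j = 0 then
        if τ ≤ |l| then -(SignType.sign l : ℤ)
        else if τ ≤ |r| then (SignType.sign r : ℤ)
        else 0
      else 0)
  tab fun i => tab fun j => op 10 (H i j + W i j - W j i)

/-- SABRE with the tuning parameters `sabreDelta`. Positions `1, …, n` are represented by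
`0, …, n - 1 : Fin n`; so the score `(∑ j, Ĥ i j + n + 1) / 2` becomes
`(∑ j, Ĥ i j + n - 1) / 2`. The score is rounded to an integer in the range. -/
def sabre (σ : ℝ) (A : Matrix (Fin n) (Fin n) ℝ) (T : Fin n → Fin 3) :
    Timed (Fin n → Fin n) := do
  let δ ← tab fun k : Fin 4 => op 10 (sabreDelta n (k.val + 1))
  let S ← tab fun _ => op 1 true
  let D ← estimateDistance ch A S
  let H ← aggregateBisections ch (δ 0) (δ 1) (δ 2) D
  let K ← reevaluateComparisons ch H D A σ (δ 3) T
  tab fun i => do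
    let s ← total fun j => op 2 (K i j)
    op 12 ⟨(max 0 (min ((n : ℤ) - 1) (ch.halve (s + n - 1)))).toNat, by have := i.pos; omega⟩

end Algorithm

/-! ## The statistical model and the loss -/

/-- Bi-Lipschitz matrices with entries in `[0, 1]`. -/
structure BiLipschitz {n : ℕ} (α β : ℝ) (F : Matrix (Fin n) (Fin n) ℝ) : Prop where
  mem_Icc : ∀ i j, F i j ∈ Set.Icc (0 : ℝ) 1
  upper : ∀ i j k : Fin n, i < j → |F i k - F j k| ≤ β * (((j : ℝ) - i) / n)
  lower_left : ∀ i j k : Fin n, i < j → k ≤ i → α * (((j : ℝ) - i) / n) ≤ F i k - F j k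
  lower_right : ∀ i j k : Fin n, i < j → j ≤ k → α * (((j : ℝ) - i) / n) ≤ F j k - F i k

/-- Symmetric noise matrices whose entries on and above the diagonal are independent, centred
and sub-Gaussian with variance proxy at most `1`. -/
structure IsNoise {n : ℕ} {Ω : Type*} [MeasurableSpace Ω]
    (E : Ω → Matrix (Fin n) (Fin n) ℝ) (P : Measure Ω) : Prop where
  measurable : ∀ i j, Measurable fun ω => E ω i j
  symm : ∀ ω, (E ω).IsSymm
  indep : iIndepFun (fun (p : {p : Fin n × Fin n // p.1 ≤ p.2}) ω => E ω p.1.1 p.1.2) P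
  centred : ∀ i j, ∫ ω, E ω i j ∂P = 0
  subgaussian : ∀ i j, HasSubgaussianMGF (fun ω => E ω i j) 1 P

/-- The ordered partitions of the items into three blocks of sizes between `⌊n / 3⌋` and
`⌈n / 3⌉`, as maps to `Fin 3`. -/
def balancedPartitions (n : ℕ) : Set (Fin n → Fin 3) :=
  {T | ∀ t, ⌊(n : ℝ) / 3⌋₊ ≤ (Finset.univ.filter fun i => T i = t).card ∧
    (Finset.univ.filter fun i => T i = t).card ≤ ⌈(n : ℝ) / 3⌉₊}

/-- The Frobenius norm. -/
def frobeniusNorm {n : ℕ} (M : Matrix (Fin n) (Fin n) ℝ) : ℝ := √(∑ i, ∑ j, M i j ^ 2)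

/-- The Frobenius loss `‖F_p - F_π‖ ∧ ‖F_p - F_(π^rev)‖`, where `F_p` has the entries
`F (p i) (p j)`. -/
def frobeniusLoss {n : ℕ} (F : Matrix (Fin n) (Fin n) ℝ) (p : Fin n → Fin n)
    (π : Equiv.Perm (Fin n)) : ℝ :=
  min (frobeniusNorm (F.submatrix p p - F.submatrix π π))
    (frobeniusNorm (F.submatrix p p -
      F.submatrix (fun i => Fin.rev (π i)) (fun i => Fin.rev (π i))))

end

/-! Distances of rows reveal gaps of positions. By the bi-Lipschitz property, `n` times the squared
distance of two signal rows lies between `(α / 24) ^ 2` and `β ^ 2` times the squared gap, even on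
the columns of one well-spread block (`OrderedBiLipschitz.le_rowDistSq`,
`OrderedBiLipschitz.rowDistSq_le`). Off-diagonal Gram entries concentrate within `O(√n log n)`;
diagonal ones are biased by the squared noise, and the inner product with a proxy row replaces them.
So the estimated distance is equivalent to the gap up to an additive error of order `n ^ (3/4) *
√(log n)`, which is below `δ₁` (`OrderedBiLipschitz.estimateDistance_bounds`). Consecutive
thresholds differ by a factor `log n`, which eventually beats every multiple of `β / α`; hence they
separate scales of gaps (`LargeScales.seriationScales`).

Separated scales make the first seriation deterministic. In the graph around `i` no edge jumps over
`i`, while all sufficiently distant items on one side are connected, so each component with a far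
item represents one side. The item `c` is central and orients all pairs consistently, up to one
global reversal. Thus `H` is never wrong and decides all pairs with gap at least `48 δ₃ / α`
(`SeriationScales.aggregateBisections_spec`).

The refinement improves this precision to order `σ √(n log n) / α`. Its sums run over columns chosen
from the data, but on the good event they are exactly the columns in the block of `p`, on one side
of `p`, whose block distance from `p` is large (`LargeScales.contrastSet_eq`). That set depends on
the noise only through entries inside the block, hence is independent of the entries between the
block and rows outside it (`IsNoise.tail_sideSet`); a union bound over `p` removes the selection
bias. The noise in a contrast is then at most `4 σ √(n log n)`, so the threshold with factor `5`
never gives a wrong sign. One of the two sides has at least `n / 13` columns, each contributing at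
least `α * gap / n`, so an undecided pair has gap at most `117 σ √(n log n) / α`
(`LargeScales.contrast_bounds`). Counting undecided pairs bounds the error of every position, and
the Lipschitz property turns this into the Frobenius bound.

The good event combines sub-Gaussian tails with the density of random blocks, which follows from
exchangeability under swaps and an exponential moment (`card_sparse_le`). For (b), all loops have
fixed lengths, so the cost is an explicit cubic polynomial. -/

noncomputable section

open Timed

/-! ### Values and costs of the elementary programs -/

namespace Timed

variable {α β : Type} {n : ℕ}

@[simp] theorem val_bind (x : Timed α) (f : α → Timed β) : (x >>= f).val = (f x.val).val := rfl

@[simp] theorem cost_bind (x : Timed α) (f : α → Timed β) :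
    (x >>= f).cost = x.cost + (f x.val).cost := rfl

@[simp] theorem val_op (c : ℕ) (a : α) : (op c a).val = a := rfl

@[simp] theorem cost_op (c : ℕ) (a : α) : (op c a).cost = c := rfl

@[simp] theorem val_tab (f : Fin n → Timed α) : (tab f).val = fun i => (f i).val := rfl

@[simp] theorem cost_tab (f : Fin n → Timed α) : (tab f).cost = ∑ i, ((f i).cost + 1) := rfl

@[simp] theorem val_total [AddCommMonoid α] (f : Fin n → Timed α) :
    (total f).val = ∑ i, (f i).val := rfl

@[simp] theorem cost_total [AddCommMonoid α] (f : Fin n → Timed α) :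
    (total f).cost = ∑ i, ((f i).cost + 1) := rfl

@[simp] theorem cost_count (f : Fin n → Timed Bool) :
    (count f).cost = ∑ i, ((f i).cost + 1) := rfl

@[simp] theorem cost_largest (f : Fin n → Timed ℝ) :
    (largest f).cost = ∑ i, ((f i).cost + 1) := rfl

@[simp] theorem cost_mark (f : Fin n → Timed (Option (Fin n))) :
    (mark f).cost = n + ∑ i, ((f i).cost + 1) := rfl

@[simp] theorem cost_argmin (pick : Finset (Fin n) → Fin n) (cand : Fin n → Timed Bool)
    (f : Fin n → Timed ℝ) :
    (argmin pick cand f).cost = ∑ i, ((cand i).cost + (f i).cost + 3) := rfl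

@[simp] theorem val_argmin (pick : Finset (Fin n) → Fin n) (cand : Fin n → Timed Bool)
    (f : Fin n → Timed ℝ) :
    (argmin pick cand f).val =
      if (minimizers (fun i => (cand i).val) fun i => (f i).val).Nonempty then
        some (pick (minimizers (fun i => (cand i).val) fun i => (f i).val)) else none := rfl

theorem minimizers_nonempty {cand : Fin n → Bool} {f : Fin n → ℝ} {j : Fin n}
    (hj : cand j = true) : (minimizers cand f).Nonempty := by
  obtain ⟨a, ha, hmin⟩ := Finset.exists_min_image (Finset.univ.filter fun i => cand i = true) f
    ⟨j, by simpa using hj⟩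
  refine ⟨a, ?_⟩
  simp only [Finset.mem_filter, Finset.mem_univ, true_and] at ha hmin
  simpa [minimizers] using ⟨ha, hmin⟩

theorem argmin_some {pick : Finset (Fin n) → Fin n} (hpick : ∀ s : Finset (Fin n), s.Nonempty →
    pick s ∈ s) {cand : Fin n → Timed Bool} {f : Fin n → Timed ℝ} {a : Fin n}
    (h : (argmin pick cand f).val = some a) :
    (cand a).val = true ∧ ∀ j, (cand j).val = true → (f a).val ≤ (f j).val := by
  rw [val_argmin] at h
  split_ifs at h with hs
  have := hpick _ hs
  rw [Option.some.inj h] at this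
  simpa [minimizers] using this

theorem argmin_eq_some {pick : Finset (Fin n) → Fin n} {cand : Fin n → Timed Bool}
    {f : Fin n → Timed ℝ} {j : Fin n} (hj : (cand j).val = true) :
    ∃ a, (argmin pick cand f).val = some a := by
  rw [val_argmin, if_pos (minimizers_nonempty hj)]
  exact ⟨_, rfl⟩

theorem le_largest (f : Fin n → Timed ℝ) (i : Fin n) : (f i).val ≤ (largest f).val := by
  change _ ≤ Finset.univ.fold max 0 fun i => (f i).val
  rw [Finset.le_fold_max]
  exact Or.inr ⟨i, Finset.mem_univ _, le_rfl⟩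

theorem largest_le {f : Fin n → Timed ℝ} {c : ℝ} (hc : 0 ≤ c) (h : ∀ i, (f i).val ≤ c) :
    (largest f).val ≤ c := by
  change (Finset.univ.fold max 0 fun i => (f i).val) ≤ c
  rw [Finset.fold_max_le]
  exact ⟨hc, fun i _ => h i⟩

/-- One relabelling costs `n + n * (c + 5)` for marking and `5 * n` for rewriting the labels; it is
performed once per vertex, and the initial labels cost `2 * n`. -/
theorem cost_components (adj : Fin n → Fin n → Timed Bool) (c : ℕ)
    (hadj : ∀ u v, (adj u v).cost = c) :
    (components adj).cost = 2 * n + n * (n * (c + 11)) := by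
  have key : ∀ (l : List (Fin n)) (s : Fin n → Fin n),
      (l.foldlM (relabel adj) s).cost = l.length * (n * (c + 11)) := by
    intro l
    induction l with
    | nil => intro s; simp [pure]
    | cons a l ih =>
      intro s
      rw [List.foldlM_cons, cost_bind, ih]
      have : (relabel adj s a).cost = n * (c + 11) := by
        simp only [relabel, cost_bind, cost_mark, cost_tab, cost_op, hadj, Finset.sum_const,
          Finset.card_univ, Fintype.card_fin, smul_eq_mul]
        ring
      rw [this, List.length_cons]
      ring
  simp only [components, cost_bind, key, cost_tab, cost_op, Finset.sum_const,
    Finset.card_univ, Fintype.card_fin, smul_eq_mul, List.length_finRange]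
  ring

theorem cost_components_op (c : ℕ) (b : Fin n → Fin n → Bool) :
    (components fun u v => op c (b u v)).cost = 2 * n + n * (n * (c + 11)) :=
  cost_components _ c fun _ _ => rfl

end Timed

/-! ### The exact running time -/

section Cost

variable {n : ℕ} (ch : SabreChoices n)

/-- No loop depends on the data, so the cost is a polynomial identity. The cubic term is `6 + 16`:
Gram matrix and proxy search. -/
theorem cost_estimateDistance (A : Matrix (Fin n) (Fin n) ℝ) (S : Fin n → Bool) :
    (estimateDistance ch A S).cost = 22 * n ^ 3 + 40 * n ^ 2 + 5 * n := by
  simp only [estimateDistance, cost_bind, cost_tab, cost_op, cost_total, cost_argmin,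
    cost_largest, Finset.sum_const, Finset.card_univ, Fintype.card_fin, smul_eq_mul]
  ring

theorem cost_bisection (δ₁ δ₂ δ₃ : ℝ) (D : Fin n → Fin n → ℝ) (i : Fin n) :
    (bisection ch δ₁ δ₂ δ₃ D i).cost = 34 * n ^ 2 + 31 * n + 1 := by
  simp only [bisection, cost_bind, cost_tab, cost_op, cost_count, cost_mark, cost_argmin,
    cost_components_op, Finset.sum_const, Finset.card_univ, Fintype.card_fin,
    smul_eq_mul]
  ring

theorem cost_orientation (G : Fin n → (Fin n → Bool) × (Fin n → Bool)) :
    (orientation ch G).cost = 30 * n ^ 2 + 30 * n := by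
  simp only [orientation, cost_bind, cost_tab, cost_op, cost_count, cost_argmin,
    Finset.sum_const, Finset.card_univ, Fintype.card_fin, smul_eq_mul]
  ring

theorem cost_aggregateBisections (δ₁ δ₂ δ₃ : ℝ) (D : Fin n → Fin n → ℝ) :
    (aggregateBisections ch δ₁ δ₂ δ₃ D).cost = 34 * n ^ 3 + 96 * n ^ 2 + 34 * n := by
  simp only [aggregateBisections, cost_bind, cost_tab, cost_op, cost_count, cost_bisection,
    cost_orientation, Finset.sum_const, Finset.card_univ, Fintype.card_fin, smul_eq_mul]
  ring

theorem cost_reevaluateComparisons (H : Fin n → Fin n → ℤ) (D : Fin n → Fin n → ℝ)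
    (A : Matrix (Fin n) (Fin n) ℝ) (σ δ₄ : ℝ) (T : Fin n → Fin 3) :
    (reevaluateComparisons ch H D A σ δ₄ T).cost =
      125 * n ^ 3 + 158 * n ^ 2 + 26 * n + 13 := by
  simp only [reevaluateComparisons, cost_bind, cost_tab, cost_op, cost_total, cost_argmin,
    cost_estimateDistance, Finset.sum_const, Finset.card_univ, Fintype.card_fin, smul_eq_mul]
  ring

theorem cost_sabre (σ : ℝ) (A : Matrix (Fin n) (Fin n) ℝ) (T : Fin n → Fin 3) :
    (sabre ch σ A T).cost = 181 * n ^ 3 + 297 * n ^ 2 + 80 * n + 57 := by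
  simp only [sabre, cost_bind, cost_tab, cost_op, cost_total, cost_estimateDistance,
    cost_aggregateBisections, cost_reevaluateComparisons, Finset.sum_const, Finset.card_univ,
    Fintype.card_fin, smul_eq_mul]
  ring

theorem cost_sabre_le (σ : ℝ) (A : Matrix (Fin n) (Fin n) ℝ) (T : Fin n → Fin 3) :
    (sabre ch σ A T).cost ≤ 615 * n ^ 3 := by
  -- The rules produce an element of `Fin n`, so `n = 0`, where the constant term `57` would break
  -- the bound, is excluded.
  have hn : 1 ≤ n := (ch.pick ∅).pos
  have h0 : 1 ≤ n ^ 3 := Nat.one_le_pow _ _ hn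
  have h1 : n ≤ n ^ 3 := Nat.le_self_pow (by norm_num) n
  have h2 : n ^ 2 ≤ n ^ 3 := Nat.pow_le_pow_right hn (by norm_num)
  rw [cost_sabre]
  linarith

end Cost

/-! ### Scale separation and the bisection around one item -/

section Positions

variable {n : ℕ}

/-- The position of item `i` as a real number. -/
def pos (π : Equiv.Perm (Fin n)) (i : Fin n) : ℝ := ((π i : ℕ) : ℝ)

/-- The reversed ordering. -/
def revOrder (π : Equiv.Perm (Fin n)) : Equiv.Perm (Fin n) := π.trans Fin.revPerm

theorem revOrder_apply (π : Equiv.Perm (Fin n)) (i : Fin n) : revOrder π i = Fin.rev (π i) := rfl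

theorem pos_revOrder (π : Equiv.Perm (Fin n)) (i : Fin n) :
    pos (revOrder π) i = n - 1 - pos π i := by
  have h := (π i).isLt
  have h2 : (revOrder π i : ℕ) + (π i : ℕ) + 1 = n := by
    rw [revOrder_apply, Fin.val_rev]; omega
  have h3 : ((revOrder π i : ℕ) : ℝ) + ((π i : ℕ) : ℝ) + 1 = n := by exact_mod_cast h2
  simp only [pos]
  linarith

theorem revOrder_revOrder (π : Equiv.Perm (Fin n)) : revOrder (revOrder π) = π := by
  ext i
  simp [revOrder_apply]

theorem pos_injective (π : Equiv.Perm (Fin n)) : Function.Injective (pos π) := by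
  intro i j h
  simp only [pos, Nat.cast_inj] at h
  exact π.injective (Fin.ext h)

theorem pos_nonneg (π : Equiv.Perm (Fin n)) (i : Fin n) : 0 ≤ pos π i := Nat.cast_nonneg _

theorem pos_le (π : Equiv.Perm (Fin n)) (i : Fin n) : pos π i ≤ n - 1 := by
  have := pos_nonneg (revOrder π) i
  rw [pos_revOrder] at this
  linarith

theorem exists_pos_eq (π : Equiv.Perm (Fin n)) {z : ℕ} (hz : z < n) : ∃ k, pos π k = z :=
  ⟨π.symm ⟨z, hz⟩, by simp [pos]⟩

theorem exists_pos_eq_succ (π : Equiv.Perm (Fin n)) {k l : Fin n} (h : pos π k < pos π l) :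
    ∃ k', pos π k' = pos π k + 1 := by
  have h1 : (π k : ℕ) < π l := by simpa [pos] using h
  obtain ⟨k', hk'⟩ := exists_pos_eq π (z := (π k : ℕ) + 1) (by have := (π l).isLt; omega)
  exact ⟨k', by rw [hk']; simp [pos]⟩

theorem abs_pos_revOrder_sub (π : Equiv.Perm (Fin n)) (i j : Fin n) :
    |pos (revOrder π) i - pos (revOrder π) j| = |pos π i - pos π j| := by
  rw [pos_revOrder, pos_revOrder, abs_sub_comm]
  congr 1
  ring

/-- The estimated distances `D` separate, at the thresholds `δ₁ ≤ δ₂ ≤ δ₃`, the gaps between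
positions at the scales `u ≤ v ≤ w`. -/
structure SeriationScales (π : Equiv.Perm (Fin n)) (D : Fin n → Fin n → ℝ)
    (δ₁ δ₂ δ₃ u v w : ℝ) : Prop where
  symm : ∀ i j, D i j = D j i
  v_pos : 0 < v
  v_le_w : v ≤ w
  le_of_consecutive : ∀ k l, |pos π k - pos π l| = 1 → D k l ≤ δ₁
  lt_of_le : ∀ k l, D k l ≤ δ₁ → |pos π k - pos π l| < u
  le_of_ge : ∀ i k, δ₂ ≤ D i k → u ≤ |pos π i - pos π k|
  ge_of_le : ∀ i k, v ≤ |pos π i - pos π k| → δ₂ ≤ D i k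
  le_of_far : ∀ i k, δ₃ ≤ D i k → v ≤ |pos π i - pos π k|
  far_of_le : ∀ i k, w ≤ |pos π i - pos π k| → δ₃ ≤ D i k

/-- `S` lies to the left of `i` and contains all items at distance at least `v` to the left. -/
structure IsLeftSide (π : Equiv.Perm (Fin n)) (v : ℝ) (i : Fin n) (S : Fin n → Bool) : Prop where
  lt : ∀ k, S k = true → pos π k < pos π i
  mem : ∀ k, pos π k ≤ pos π i - v → S k = true
  exists_mem : ∃ k, pos π k ≤ pos π i - v

theorem SeriationScales.reverse {π : Equiv.Perm (Fin n)} {D : Fin n → Fin n → ℝ}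
    {δ₁ δ₂ δ₃ u v w : ℝ} (h : SeriationScales π D δ₁ δ₂ δ₃ u v w) :
    SeriationScales (revOrder π) D δ₁ δ₂ δ₃ u v w where
  symm := h.symm
  v_pos := h.v_pos
  v_le_w := h.v_le_w
  le_of_consecutive := by simpa only [abs_pos_revOrder_sub] using h.le_of_consecutive
  lt_of_le := by simpa only [abs_pos_revOrder_sub] using h.lt_of_le
  le_of_ge := by simpa only [abs_pos_revOrder_sub] using h.le_of_ge
  ge_of_le := by simpa only [abs_pos_revOrder_sub] using h.ge_of_le
  le_of_far := by simpa only [abs_pos_revOrder_sub] using h.le_of_far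
  far_of_le := by simpa only [abs_pos_revOrder_sub] using h.far_of_le

/-- The graph used to split the items other than `i` into those left and right of `i`. -/
def splitGraph (δ₁ δ₂ : ℝ) (D : Fin n → Fin n → ℝ) (hD : ∀ i j, D i j = D j i) (i : Fin n) :
    SimpleGraph (Fin n) where
  Adj k l := k ≠ l ∧ k ≠ i ∧ l ≠ i ∧ D k l ≤ δ₁ ∧ δ₂ ≤ max (D i k) (D i l)
  symm := ⟨fun _ _ h => ⟨h.1.symm, h.2.2.1, h.2.1, hD _ _ ▸ h.2.2.2.1,
    max_comm (D i _) (D i _) ▸ h.2.2.2.2⟩⟩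
  loopless := ⟨fun _ h => h.1 rfl⟩

/-- The labelling of the items by connected components computed in `bisection`. -/
def splitLabel (δ₁ δ₂ : ℝ) (D : Fin n → Fin n → ℝ) (i : Fin n) : Fin n → Fin n :=
  (components fun k l => op 20
    (decide (k ≠ l ∧ k ≠ i ∧ l ≠ i ∧ D k l ≤ δ₁ ∧ δ₂ ≤ max (D i k) (D i l)))).val

variable {π : Equiv.Perm (Fin n)} {D : Fin n → Fin n → ℝ} {δ₁ δ₂ δ₃ u v w : ℝ}

theorem splitLabel_eq_iff (hD : ∀ i j, D i j = D j i) (i k l : Fin n) :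
    splitLabel δ₁ δ₂ D i k = splitLabel δ₁ δ₂ D i l ↔
      (splitGraph δ₁ δ₂ D hD i).Reachable k l :=
  components_spec _ _ (fun u v => by simp [splitGraph]) k l

/-- An edge spans a gap below `u`, and one of its ends is at least `u` away from `i`. If the ends
lay on opposite sides of `i`, the edge would be at least as long as that. -/
theorem SeriationScales.side_of_adj (h : SeriationScales π D δ₁ δ₂ δ₃ u v w) {i k l : Fin n}
    (hkl : (splitGraph δ₁ δ₂ D h.symm i).Adj k l) (hk : pos π k < pos π i) :
    pos π l < pos π i := by
  obtain ⟨-, h2, h3, h4, h5⟩ := hkl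
  have hlt := h.lt_of_le k l h4
  by_contra hl
  rw [not_lt] at hl
  rcases le_max_iff.1 h5 with h6 | h6 <;> have h7 := h.le_of_ge _ _ h6
  · rw [abs_of_pos (by linarith)] at h7
    rw [abs_of_neg (by linarith)] at hlt
    linarith
  · rw [abs_of_nonpos (by linarith)] at h7
    rw [abs_of_neg (by linarith)] at hlt
    linarith

theorem SeriationScales.side_of_label (h : SeriationScales π D δ₁ δ₂ δ₃ u v w) {i k l : Fin n}
    (hkl : splitLabel δ₁ δ₂ D i k = splitLabel δ₁ δ₂ D i l) (hk : pos π k < pos π i) :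
    pos π l < pos π i := by
  rw [splitLabel_eq_iff h.symm] at hkl
  obtain ⟨p⟩ := hkl
  induction p with
  | nil => exact hk
  | cons hadj p ih => exact ih (h.side_of_adj hadj hk)

/-- Beyond distance `v` from `i`, successive positions are joined: their estimated distance is at
most `δ₁` and their distance from `i` at least `δ₂`. The induction walks along this chain. -/
theorem SeriationScales.reachable_add (h : SeriationScales π D δ₁ δ₂ δ₃ u v w) {i : Fin n}
    (m : ℕ) : ∀ k l, pos π l = pos π k + m → pos π i + v ≤ pos π k →
      splitLabel δ₁ δ₂ D i k = splitLabel δ₁ δ₂ D i l := by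
  induction m with
  | zero =>
    intro k l hkl _
    rw [pos_injective π (show pos π l = pos π k by simpa using hkl)]
  | succ m ih =>
    intro k l hkl hk
    push_cast at hkl
    have hm : (0 : ℝ) ≤ m := Nat.cast_nonneg m
    have hv := h.v_pos
    obtain ⟨k', hk'⟩ := exists_pos_eq_succ π (show pos π k < pos π l by linarith)
    rw [← ih k' l (by linarith) (by linarith), splitLabel_eq_iff h.symm]
    refine SimpleGraph.Adj.reachable ⟨?_, ?_, ?_, ?_, ?_⟩
    · rintro rfl; linarith
    · rintro rfl; linarith
    · rintro rfl; linarith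
    · exact h.le_of_consecutive k k' (by rw [hk', abs_sub_comm]; simp)
    · exact le_max_of_le_left (h.ge_of_le _ _ (by rw [abs_of_neg (by linarith)]; linarith))

theorem SeriationScales.label_eq_right (h : SeriationScales π D δ₁ δ₂ δ₃ u v w) {i k l : Fin n}
    (hk : pos π i + v ≤ pos π k) (hl : pos π i + v ≤ pos π l) :
    splitLabel δ₁ δ₂ D i k = splitLabel δ₁ δ₂ D i l := by
  rcases le_total (π k : ℕ) (π l : ℕ) with hkl | hkl <;> obtain ⟨m, hm⟩ := Nat.exists_eq_add_of_le hkl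
  · exact h.reachable_add m k l (by simp [pos, hm]) hk
  · exact (h.reachable_add m l k (by simp [pos, hm]) hl).symm

theorem SeriationScales.label_eq_left (h : SeriationScales π D δ₁ δ₂ δ₃ u v w) {i k l : Fin n}
    (hk : pos π k ≤ pos π i - v) (hl : pos π l ≤ pos π i - v) :
    splitLabel δ₁ δ₂ D i k = splitLabel δ₁ δ₂ D i l :=
  h.reverse.label_eq_right (by rw [pos_revOrder, pos_revOrder]; linarith)
    (by rw [pos_revOrder, pos_revOrder]; linarith)

/-- The component with label `a`. -/
def splitClass (δ₁ δ₂ : ℝ) (D : Fin n → Fin n → ℝ) (i a : Fin n) : Fin n → Bool :=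
  fun k => decide (a = splitLabel δ₁ δ₂ D i k)

/-- The threshold `δ₃` guarantees a gap of at least `v`, which puts the item on the chain connecting
all distant items to the left of `i`. -/
theorem SeriationScales.isLeftSide_class (h : SeriationScales π D δ₁ δ₂ δ₃ u v w) {i k : Fin n}
    (hk : pos π k < pos π i) (hfar : δ₃ ≤ D i k) :
    IsLeftSide π v i (splitClass δ₁ δ₂ D i (splitLabel δ₁ δ₂ D i k)) := by
  have h1 := h.le_of_far i k hfar
  rw [abs_of_pos (by linarith)] at h1
  refine ⟨fun l hl => ?_, fun l hl => ?_, k, by linarith⟩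
  · exact h.side_of_label (of_decide_eq_true hl) hk
  · exact decide_eq_true (h.label_eq_left (by linarith) hl)

theorem IsLeftSide.false_of_reverse {i : Fin n} {S : Fin n → Bool} (h1 : IsLeftSide π v i S)
    (h2 : IsLeftSide (revOrder π) v i S) : False := by
  obtain ⟨k, hk⟩ := h1.exists_mem
  have h3 := h1.mem k hk
  have h4 := h2.lt k h3
  have h5 := h1.lt k h3
  rw [pos_revOrder, pos_revOrder] at h4
  linarith

/-- Two such components share a distant item, so there is at most one per side. Hence at most two
components contain a far item, and the preference for the largest ones never matters. -/
theorem IsLeftSide.class_unique {i a b : Fin n} (h1 : IsLeftSide π v i (splitClass δ₁ δ₂ D i a))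
    (h2 : IsLeftSide π v i (splitClass δ₁ δ₂ D i b)) : a = b := by
  obtain ⟨k, hk⟩ := h1.exists_mem
  exact (of_decide_eq_true (h1.mem k hk)).trans (of_decide_eq_true (h2.mem k hk)).symm

/-- Labels of components containing a far item. -/
def splitFar (δ₁ δ₂ δ₃ : ℝ) (D : Fin n → Fin n → ℝ) (i l : Fin n) : Prop :=
  ∃ k, k ≠ i ∧ δ₃ ≤ D i k ∧ splitLabel δ₁ δ₂ D i k = l

theorem SeriationScales.side_of_far (h : SeriationScales π D δ₁ δ₂ δ₃ u v w) {i l : Fin n}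
    (hl : splitFar δ₁ δ₂ δ₃ D i l) :
    IsLeftSide π v i (splitClass δ₁ δ₂ D i l) ∨
      IsLeftSide (revOrder π) v i (splitClass δ₁ δ₂ D i l) := by
  obtain ⟨k, hki, hk, rfl⟩ := hl
  rcases lt_or_gt_of_ne (fun e => hki (pos_injective π e)) with h1 | h1
  · exact Or.inl (h.isLeftSide_class h1 hk)
  · refine Or.inr (h.reverse.isLeftSide_class ?_ hk)
    rw [pos_revOrder, pos_revOrder]; linarith

theorem SeriationScales.exists_far_left (h : SeriationScales π D δ₁ δ₂ δ₃ u v w) {i k : Fin n}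
    (hk : pos π k ≤ pos π i - w) :
    ∃ l, splitFar δ₁ δ₂ δ₃ D i l ∧ IsLeftSide π v i (splitClass δ₁ δ₂ D i l) := by
  have hv := h.v_pos
  have hw := h.v_le_w
  have h1 := h.far_of_le i k (by rw [abs_of_pos (by linarith)]; linarith)
  refine ⟨_, ⟨k, ?_, h1, rfl⟩, h.isLeftSide_class (by linarith) h1⟩
  rintro rfl
  linarith

variable (ch : SabreChoices n)

/-- Records only what is needed later: the chosen labels are far and distinct, and a missing label
means that no candidate was left. The sizes can be forgotten because of `IsLeftSide.class_unique`.
-/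
theorem bisection_val (δ₁ δ₂ δ₃ : ℝ) (D : Fin n → Fin n → ℝ) (i : Fin n) :
    ∃ a b : Option (Fin n),
      (bisection ch δ₁ δ₂ δ₃ D i).val = (fun k => decide (a = some (splitLabel δ₁ δ₂ D i k)),
        fun k => decide (b = some (splitLabel δ₁ δ₂ D i k))) ∧
      (∀ l, a = some l → splitFar δ₁ δ₂ δ₃ D i l) ∧
      (a = none → ∀ l, ¬ splitFar δ₁ δ₂ δ₃ D i l) ∧
      (∀ l, b = some l → splitFar δ₁ δ₂ δ₃ D i l ∧ a ≠ some l) ∧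
      (b = none → ∀ l, splitFar δ₁ δ₂ δ₃ D i l → a = some l) := by
  let far : Fin n → Bool := (mark fun k => op 6
    (if k ≠ i ∧ δ₃ ≤ D i k then some (splitLabel δ₁ δ₂ D i k) else none)).val
  have hfar : ∀ l, far l = true ↔ splitFar δ₁ δ₂ δ₃ D i l := by
    intro l
    refine decide_eq_true_iff.trans (exists_congr fun k => ?_)
    rw [val_op]
    split_ifs with hk
    · simp [hk]
    · exact ⟨fun h => by simp at h, fun h => absurd ⟨h.1, h.2.1⟩ hk⟩
  let size : Fin n → ℕ := fun l => (count fun k => op 2 (decide (splitLabel δ₁ δ₂ D i k = l))).val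
  let am := argmin ch.pick (fun l => op 1 (far l)) fun l => op 2 (-(size l : ℝ))
  let bm := argmin ch.pick (fun l => op 3 (decide (far l = true ∧ am.val ≠ some l)))
    fun l => op 2 (-(size l : ℝ))
  refine ⟨am.val, bm.val, rfl, fun l hl => ?_, fun hn l hl => ?_, fun l hl => ?_, fun hn l hl => ?_⟩
  · exact (hfar l).1 (argmin_some ch.pick_mem hl).1
  · obtain ⟨a, ha⟩ := argmin_eq_some (pick := ch.pick) (cand := fun l => op 1 (far l))
      (f := fun l => op 2 (-(size l : ℝ))) (j := l) ((hfar l).2 hl)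
    exact absurd (hn.symm.trans ha) (by simp)
  · have := of_decide_eq_true (argmin_some ch.pick_mem hl).1
    exact ⟨(hfar l).1 this.1, this.2⟩
  · by_contra hne
    obtain ⟨a, ha⟩ := argmin_eq_some (pick := ch.pick)
      (cand := fun l => op 3 (decide (far l = true ∧ am.val ≠ some l)))
      (f := fun l => op 2 (-(size l : ℝ))) (j := l) (decide_eq_true ⟨(hfar l).2 hl, hne⟩)
    exact absurd (hn.symm.trans ha) (by simp)

/-- The pair of sets `G` splits the items around `i`, up to the order of the pair and up to a side
on which all items are closer than `w`. -/
inductive Splits (π : Equiv.Perm (Fin n)) (v w : ℝ) (i : Fin n) :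
    (Fin n → Bool) × (Fin n → Bool) → Prop
  | both {G G' : Fin n → Bool} : IsLeftSide π v i G → IsLeftSide (revOrder π) v i G' →
      Splits π v w i (G, G')
  | bothRev {G G' : Fin n → Bool} : IsLeftSide (revOrder π) v i G → IsLeftSide π v i G' →
      Splits π v w i (G, G')
  | left {G : Fin n → Bool} : IsLeftSide π v i G → (∀ k, pos π k < pos π i + w) →
      Splits π v w i (G, fun _ => false)
  | right {G : Fin n → Bool} : IsLeftSide (revOrder π) v i G → (∀ k, pos π i - w < pos π k) →
      Splits π v w i (G, fun _ => false)
  | none {G : (Fin n → Bool) × (Fin n → Bool)} : (∀ k, pos π k < pos π i + w) →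
      (∀ k, pos π i - w < pos π k) → Splits π v w i G

theorem Splits.reverse {i : Fin n} {G : (Fin n → Bool) × (Fin n → Bool)} (h : Splits π v w i G) :
    Splits (revOrder π) v w i G := by
  cases h with
  | both h1 h2 => exact .bothRev (by rwa [revOrder_revOrder]) h2
  | bothRev h1 h2 => exact .both h1 (by rwa [revOrder_revOrder])
  | left h1 h2 =>
    refine .right (by rwa [revOrder_revOrder]) fun k => ?_
    have := h2 k
    rw [pos_revOrder, pos_revOrder]; linarith
  | right h1 h2 =>
    refine .left h1 fun k => ?_
    have := h2 k
    rw [pos_revOrder, pos_revOrder]; linarith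
  | none h1 h2 =>
    refine .none (fun k => ?_) fun k => ?_
    · have := h2 k
      rw [pos_revOrder, pos_revOrder]; linarith
    · have := h1 k
      rw [pos_revOrder, pos_revOrder]; linarith

/-- An item at distance `w` on some side supplies a far component there. Two distinct far components
must lie on opposite sides, and if only one is chosen, the other side cannot extend to distance `w`.
-/
theorem SeriationScales.splits_bisection (h : SeriationScales π D δ₁ δ₂ δ₃ u v w) (i : Fin n) :
    Splits π v w i (bisection ch δ₁ δ₂ δ₃ D i).val := by
  obtain ⟨a, b, hab, ha, han, hb, hbn⟩ := bisection_val ch δ₁ δ₂ δ₃ D i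
  have hL : ∀ k, pos π k ≤ pos π i - w →
      ∃ l, splitFar δ₁ δ₂ δ₃ D i l ∧ IsLeftSide π v i (splitClass δ₁ δ₂ D i l) :=
    fun k hk => h.exists_far_left hk
  have hR : ∀ k, pos π i + w ≤ pos π k → ∃ l, splitFar δ₁ δ₂ δ₃ D i l ∧
      IsLeftSide (revOrder π) v i (splitClass δ₁ δ₂ D i l) :=
    fun k hk => h.reverse.exists_far_left (k := k)
      (by rw [pos_revOrder, pos_revOrder]; linarith)
  have hcls : ∀ l, (fun k => decide (some l = some (splitLabel δ₁ δ₂ D i k))) =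
      splitClass δ₁ δ₂ D i l := by
    intro l; ext k; simp [splitClass]
  rw [hab]
  cases a with
  | none =>
    refine .none (fun k => ?_) fun k => ?_ <;> by_contra! hk
    · obtain ⟨l, hl, -⟩ := hR k hk
      exact han rfl l hl
    · obtain ⟨l, hl, -⟩ := hL k hk
      exact han rfl l hl
  | some a =>
    rw [hcls]
    cases b with
    | none =>
      have he : (fun k => decide (none = some (splitLabel δ₁ δ₂ D i k))) = fun _ => false := by
        ext k; simp
      rw [he]
      rcases h.side_of_far (ha a rfl) with h1 | h1
      · refine .left h1 fun k => ?_
        by_contra! hk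
        obtain ⟨l, hl, h2⟩ := hR k hk
        obtain rfl := Option.some.inj (hbn rfl l hl)
        exact h1.false_of_reverse h2
      · refine .right h1 fun k => ?_
        by_contra! hk
        obtain ⟨l, hl, h2⟩ := hL k hk
        obtain rfl := Option.some.inj (hbn rfl l hl)
        exact h2.false_of_reverse h1
    | some b =>
      rw [hcls]
      obtain ⟨hb1, hb2⟩ := hb b rfl
      rcases h.side_of_far (ha a rfl) with h1 | h1 <;> rcases h.side_of_far hb1 with h2 | h2
      · exact absurd (congrArg some (h1.class_unique h2)) hb2
      · exact .both h1 h2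
      · exact .bothRev h1 h2
      · exact absurd (congrArg some (h1.class_unique h2)) hb2

end Positions

/-! ### Consistent orientation and the partial comparison matrix -/

section Orientation

variable {n : ℕ}

theorem card_filter_interval (π : Equiv.Perm (Fin n)) {a b : ℕ} (hb : b ≤ n) :
    (Finset.univ.filter fun k => a ≤ (π k : ℕ) ∧ (π k : ℕ) < b).card = b - a := by
  rw [← Nat.card_Ico a b]
  refine Finset.card_bij (fun k _ => (π k : ℕ)) (fun k hk => ?_) (fun k _ l _ h => ?_) fun z hz => ?_
  · simpa using hk
  · exact π.injective (Fin.ext h)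
  · rw [Finset.mem_Ico] at hz
    exact ⟨π.symm ⟨z, by omega⟩, by simpa using hz, by simp⟩

/-- The cardinality of a Boolean-valued set. -/
def size (S : Fin n → Bool) : ℕ := (Finset.univ.filter fun k => S k = true).card

theorem size_eq_zero {S : Fin n → Bool} : size S = 0 ↔ ∀ k, S k = false := by
  simp [size, Finset.filter_eq_empty_iff]

variable {π : Equiv.Perm (Fin n)} {D : Fin n → Fin n → ℝ} {δ₁ δ₂ δ₃ u v w : ℝ}

theorem IsLeftSide.size_le {i : Fin n} {S : Fin n → Bool} (h : IsLeftSide π v i S) :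
    (size S : ℝ) ≤ pos π i := by
  rw [pos, Nat.cast_le]
  have := card_filter_interval π (a := 0) (b := π i) (π i).isLt.le
  rw [Nat.sub_zero] at this
  rw [← this]
  refine Finset.card_le_card fun k hk => ?_
  simp only [Finset.mem_filter, Finset.mem_univ, true_and] at hk ⊢
  have := h.lt k hk
  simp only [pos, Nat.cast_lt] at this
  exact ⟨Nat.zero_le _, this⟩

theorem IsLeftSide.le_size {i : Fin n} {S : Fin n → Bool} (hv : 0 ≤ v) (h : IsLeftSide π v i S) :
    pos π i - v ≤ size S := by
  obtain ⟨k, hk⟩ := h.exists_mem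
  have h0 : 0 ≤ pos π i - v := (pos_nonneg π k).trans hk
  have hle : ⌊pos π i - v⌋₊ ≤ (π i : ℕ) := by
    rw [← Nat.cast_le (α := ℝ)]
    have := Nat.floor_le h0
    simp only [pos] at this ⊢
    linarith
  have := card_filter_interval π (a := 0) (b := ⌊pos π i - v⌋₊ + 1) (by have := (π i).isLt; omega)
  rw [Nat.sub_zero] at this
  -- The positions `0, …, ⌊pos π i - v⌋₊` are one more than the floor, which makes up for the
  -- rounding.
  have h2 : ⌊pos π i - v⌋₊ + 1 ≤ size S := by
    rw [← this]
    refine Finset.card_le_card fun k hk => ?_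
    simp only [Finset.mem_filter, Finset.mem_univ, true_and] at hk ⊢
    exact h.mem k ((Nat.cast_le.2 (Nat.lt_succ_iff.1 hk.2)).trans (Nat.floor_le h0))
  have h3 := Nat.lt_floor_add_one (pos π i - v)
  have h4 : ((⌊pos π i - v⌋₊ : ℝ) + 1) ≤ size S := by exact_mod_cast h2
  linarith

theorem IsLeftSide.mem_of_pos_eq_zero {i k : Fin n} {S : Fin n → Bool} (h : IsLeftSide π v i S)
    (hk : pos π k = 0) : S k = true := by
  obtain ⟨l, hl⟩ := h.exists_mem
  refine h.mem k ?_
  rw [hk]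
  exact (pos_nonneg π l).trans hl

theorem IsLeftSide.gt_of_reverse {i k : Fin n} {S : Fin n → Bool}
    (h : IsLeftSide (revOrder π) v i S) (hk : S k = true) : pos π i < pos π k := by
  have := h.lt k hk
  rw [pos_revOrder, pos_revOrder] at this
  linarith

theorem IsLeftSide.mem_of_reverse {i k : Fin n} {S : Fin n → Bool}
    (h : IsLeftSide (revOrder π) v i S) (hk : pos π i + v ≤ pos π k) : S k = true := by
  refine h.mem k ?_
  rw [pos_revOrder, pos_revOrder]
  linarith

theorem IsLeftSide.size_ne_zero {i : Fin n} {S : Fin n → Bool} (h : IsLeftSide π v i S) :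
    size S ≠ 0 := by
  obtain ⟨k, hk⟩ := h.exists_mem
  intro h0
  have := h.mem k hk
  rw [size_eq_zero.1 h0 k] at this
  exact absurd this (by simp)

variable (ch : SabreChoices n)

theorem orientation_val (G : Fin n → (Fin n → Bool) × (Fin n → Bool)) :
    ∃ c, (∀ i, min (size (G i).1) (size (G i).2) ≤ min (size (G c).1) (size (G c).2)) ∧
      ∀ i, (orientation ch G).val i =
        if i = c then G i
        else if size (G i).2 = 0 then
          if (G c).1 i = true then (fun _ => false, (G i).1) else ((G i).1, fun _ => false)
        else if size (fun k => (G i).1 k && (G c).1 k) = 0 ∨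
          size (fun k => (G i).2 k && (G c).2 k) = 0 then ((G i).2, (G i).1) else G i := by
  -- Here `ch.pick ∅` is only a witness that there is a candidate.
  obtain ⟨c, hc⟩ := argmin_eq_some (pick := ch.pick) (cand := fun _ : Fin n => op 1 true)
    (f := fun i => op 2 (-((min (size (G i).1) (size (G i).2) : ℕ) : ℝ))) (j := ch.pick ∅) rfl
  refine ⟨c, fun i => ?_, fun i => ?_⟩
  · have := (argmin_some ch.pick_mem hc).2 i rfl
    rw [val_op, val_op, neg_le_neg_iff, Nat.cast_le] at this
    exact this
  · have hval : ∀ i, (orientation ch G).val i =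
        let c := ((argmin ch.pick (fun _ : Fin n => op 1 true) fun i =>
          op 2 (-((min (size (G i).1) (size (G i).2) : ℕ) : ℝ))).val).getD i
        if i = c then G i
        else if size (G i).2 = 0 then
          if (G c).1 i = true then (fun _ => false, (G i).1) else ((G i).1, fun _ => false)
        else if size (fun k => (G i).1 k && (G c).1 k) = 0 ∨
          size (fun k => (G i).2 k && (G c).2 k) = 0 then ((G i).2, (G i).1) else G i :=
      fun _ => rfl
    rw [hval, hc]
    rfl

/-- `P.1` and `P.2` lie to the left and to the right of `i` and contain all items at distance at
least `w`. -/
structure Oriented (π : Equiv.Perm (Fin n)) (w : ℝ) (i : Fin n)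
    (P : (Fin n → Bool) × (Fin n → Bool)) : Prop where
  left_lt : ∀ k, P.1 k = true → pos π k < pos π i
  mem_left : ∀ k, pos π k ≤ pos π i - w → P.1 k = true
  right_gt : ∀ k, P.2 k = true → pos π i < pos π k
  mem_right : ∀ k, pos π i + w ≤ pos π k → P.2 k = true
  nonempty : ∃ k, P.1 k = true ∨ P.2 k = true

theorem Oriented.of_sides {i : Fin n} {L R : Fin n → Bool} (hvw : v ≤ w)
    (hL : IsLeftSide π v i L) (hR : IsLeftSide (revOrder π) v i R) : Oriented π w i (L, R) where
  left_lt := hL.lt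
  mem_left k hk := hL.mem k (by linarith)
  right_gt k hk := hR.gt_of_reverse hk
  mem_right k hk := hR.mem_of_reverse (by linarith)
  nonempty := hL.exists_mem.imp fun k hk => Or.inl (hL.mem k hk)

theorem exists_pos_zero (π : Equiv.Perm (Fin n)) (i : Fin n) : ∃ k, pos π k = 0 := by
  simpa using exists_pos_eq π (z := 0) i.pos

theorem exists_pos_last (π : Equiv.Perm (Fin n)) (i : Fin n) : ∃ k, pos π k = n - 1 := by
  obtain ⟨k, hk⟩ := exists_pos_zero (revOrder π) i
  rw [pos_revOrder] at hk
  exact ⟨k, by linarith⟩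

/-- For a two-sided split, correctly ordered pairs both meet the reference sets, because the first
item lies in every left side and the last one in every right side. If a swapped pair met both, some
item would give `i < c` and another `c < i` in position. A one-sided split forces `i` within `w` of
an end, whereas `c` is far enough from both ends that membership in its left set tells which end it
is. -/
theorem oriented_of_splits {G : Fin n → (Fin n → Bool) × (Fin n → Bool)} {c : Fin n}
    (hv : 0 < v) (hvw : v ≤ w) (hG : ∀ i, Splits π v w i (G i))
    (hcL : IsLeftSide π v c (G c).1) (hcR : IsLeftSide (revOrder π) v c (G c).2)
    (h1 : w + v ≤ pos π c) (h2 : pos π c + w ≤ n - 1) (i : Fin n) :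
    Oriented π w i (
      if i = c then G i
      else if size (G i).2 = 0 then
        if (G c).1 i = true then (fun _ => false, (G i).1) else ((G i).1, fun _ => false)
      else if size (fun k => (G i).1 k && (G c).1 k) = 0 ∨
        size (fun k => (G i).2 k && (G c).2 k) = 0 then ((G i).2, (G i).1) else G i) := by
  obtain ⟨k₀, hk₀⟩ := exists_pos_zero π i
  obtain ⟨k₁, hk₁⟩ := exists_pos_last π i
  have hk₁' : pos (revOrder π) k₁ = 0 := by rw [pos_revOrder, hk₁]; ring
  have hsz : size (fun _ : Fin n => false) = 0 := size_eq_zero.2 fun _ => rfl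
  by_cases hic : i = c
  · subst hic
    rw [if_pos rfl]
    exact Oriented.of_sides hvw hcL hcR
  rw [if_neg hic]
  have hGi := hG i
  revert hGi
  generalize G i = Gi
  intro hGi
  cases hGi with
  | both hL hR =>
    rw [if_neg hR.size_ne_zero, if_neg]
    · exact Oriented.of_sides hvw hL hR
    · rw [size_eq_zero, size_eq_zero]
      rintro (h | h)
      · have := h k₀
        simp [hL.mem_of_pos_eq_zero hk₀, hcL.mem_of_pos_eq_zero hk₀] at this
      · have := h k₁
        simp [hR.mem_of_pos_eq_zero hk₁', hcR.mem_of_pos_eq_zero hk₁'] at this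
  | bothRev hR hL =>
    rw [if_neg hL.size_ne_zero, if_pos]
    · exact Oriented.of_sides hvw hL hR
    · rw [size_eq_zero, size_eq_zero]
      by_contra! hcon
      obtain ⟨⟨k, hk⟩, l, hl⟩ := hcon
      simp only [ne_eq, Bool.not_eq_false, Bool.and_eq_true] at hk hl
      have := hR.gt_of_reverse hk.1
      have := hcL.lt k hk.2
      have := hL.lt l hl.1
      have := hcR.gt_of_reverse hl.2
      linarith
  | left hL hnone =>
    have hlast := hnone k₁
    rw [if_pos hsz, if_neg]
    · refine ⟨hL.lt, fun k hk => hL.mem k (by linarith), fun k hk => by simp at hk,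
        fun k hk => ?_, hL.exists_mem.imp fun k hk => Or.inl (hL.mem k hk)⟩
      have := hnone k
      linarith
    · intro h
      have := hcL.lt i h
      linarith
  | right hR hnone =>
    have hfirst := hnone k₀
    rw [if_pos hsz, if_pos (hcL.mem i (by linarith))]
    refine ⟨fun k hk => by simp at hk, fun k hk => ?_, fun k hk => hR.gt_of_reverse hk,
      fun k hk => hR.mem_of_reverse (by linarith),
      hR.exists_mem.imp fun k hk => Or.inr (hR.mem k hk)⟩
    have := hnone k
    linarith
  | none hn1 hn2 =>
    have := hn1 k₁
    have := hn2 k₀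
    linarith

theorem Splits.le_min_size {i : Fin n} {G : (Fin n → Bool) × (Fin n → Bool)} (hv : 0 ≤ v)
    (h : Splits π v w i G) (h1 : w ≤ pos π i) (h2 : pos π i + w ≤ n - 1) {m : ℝ}
    (hm1 : m ≤ pos π i - v) (hm2 : m ≤ n - 1 - pos π i - v) :
    m ≤ (min (size G.1) (size G.2) : ℕ) := by
  obtain ⟨k₀, hk₀⟩ := exists_pos_zero π i
  obtain ⟨k₁, hk₁⟩ := exists_pos_last π i
  rw [Nat.cast_min, le_min_iff]
  cases h with
  | both hL hR =>
    have h3 := hL.le_size hv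
    have h4 := hR.le_size hv
    rw [pos_revOrder] at h4
    exact ⟨by linarith, by linarith⟩
  | bothRev hR hL =>
    have h3 := hL.le_size hv
    have h4 := hR.le_size hv
    rw [pos_revOrder] at h4
    exact ⟨by linarith, by linarith⟩
  | left _ h3 => have := h3 k₁; exact absurd this (by linarith)
  | right _ h3 => have := h3 k₀; exact absurd this (by linarith)
  | none h3 h4 => have := h3 k₁; exact absurd this (by linarith)

/-- If `G` splits the items around each `i`, the orientation is correct for the true order or for
its reversal. -/
theorem exists_oriented {G : Fin n → (Fin n → Bool) × (Fin n → Bool)} (hv : 0 < v) (hvw : v ≤ w)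
    (hn : 2 * v + w + 1 ≤ (n : ℝ) / 2) (hG : ∀ i, Splits π v w i (G i)) :
    ∃ ρ, (ρ = π ∨ ρ = revOrder π) ∧ ∀ i, Oriented ρ w i ((orientation ch G).val i) := by
  obtain ⟨c, hmax, hval⟩ := orientation_val ch G
  have hn0 : 0 < n := c.pos
  -- The middle item has two sides of size at least `n / 2 - 1 - v`. The maximizer `c` does at least
  -- as well, which keeps it `w + v` away from both ends.
  obtain ⟨i₀, hi₀⟩ := exists_pos_eq π (z := n / 2) (Nat.div_lt_self hn0 one_lt_two)
  have hhalf1 : (n : ℝ) / 2 - 1 / 2 ≤ pos π i₀ := by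
    have : n ≤ 2 * (n / 2) + 1 := by omega
    have h : (n : ℝ) ≤ 2 * ((n / 2 : ℕ) : ℝ) + 1 := by exact_mod_cast this
    rw [hi₀]; linarith
  have hhalf2 : pos π i₀ ≤ (n : ℝ) / 2 := by
    have : 2 * (n / 2) ≤ n := by omega
    have h : 2 * ((n / 2 : ℕ) : ℝ) ≤ n := by exact_mod_cast this
    rw [hi₀]; linarith
  have hsize := (hG i₀).le_min_size hv.le (by linarith) (by linarith)
    (m := (n : ℝ) / 2 - 1 - v) (by linarith) (by linarith)
  have hc : (n : ℝ) / 2 - 1 - v ≤ (min (size (G c).1) (size (G c).2) : ℕ) :=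
    hsize.trans (Nat.cast_le.2 (hmax i₀))
  rw [Nat.cast_min, le_min_iff] at hc
  -- The split at `c` is unordered, so the argument is stated for both orders; whichever makes the
  -- first set of `c` the left one is `ρ`.
  have key : ∀ ρ : Equiv.Perm (Fin n), (∀ i, Splits ρ v w i (G i)) →
      IsLeftSide ρ v c (G c).1 → IsLeftSide (revOrder ρ) v c (G c).2 →
      ∀ i, Oriented ρ w i ((orientation ch G).val i) := by
    intro ρ hρ hL hR i
    have h3 := hL.size_le
    have h4 := hR.size_le
    rw [pos_revOrder] at h4
    rw [hval i]
    exact oriented_of_splits hv hvw hρ hL hR (by linarith) (by linarith) i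
  have hGc := hG c
  have hsz : size (fun _ : Fin n => false) = 0 := size_eq_zero.2 fun _ => rfl
  generalize hg : G c = Gc at hGc
  cases hGc with
  | both hL hR =>
    exact ⟨π, Or.inl rfl, key π hG (by rw [hg]; exact hL) (by rw [hg]; exact hR)⟩
  | bothRev hR hL =>
    exact ⟨revOrder π, Or.inr rfl, key (revOrder π) (fun i => (hG i).reverse)
      (by rw [hg]; exact hR) (by rw [hg, revOrder_revOrder]; exact hL)⟩
  | left _ _ =>
    rw [hg] at hc
    simp only [hsz, Nat.cast_zero] at hc
    exact absurd hc.2 (by linarith)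
  | right _ _ =>
    rw [hg] at hc
    simp only [hsz, Nat.cast_zero] at hc
    exact absurd hc.2 (by linarith)
  | none h3 h4 =>
    obtain ⟨k₀, hk₀⟩ := exists_pos_zero π c
    obtain ⟨k₁, hk₁⟩ := exists_pos_last π c
    have := h3 k₁
    have := h4 k₀
    exact absurd hn (by linarith)

/-- `H` is a partial comparison matrix: its nonzero entries are correct, and all pairs
at distance at least `w` are compared. -/
structure IsPartialComparison (π : Equiv.Perm (Fin n)) (w : ℝ) (H : Fin n → Fin n → ℤ) :
    Prop where
  cases : ∀ i j, H i j = 0 ∨ (H i j = -1 ∧ pos π i < pos π j) ∨ (H i j = 1 ∧ pos π j < pos π i)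
  antisymm : ∀ i j, H j i = -H i j
  ne_zero : ∀ i j, i ≠ j → w ≤ |pos π i - pos π j| → H i j ≠ 0

/-- An entry may be read off from the split at `i` or from the one at `j`. Both record only true
comparisons, so they cannot conflict, and antisymmetry follows. -/
theorem isPartialComparison_of_oriented {P : Fin n → (Fin n → Bool) × (Fin n → Bool)}
    (h : ∀ i, Oriented π w i (P i)) :
    IsPartialComparison π w fun i j =>
      if i = j ∨ size (fun k => (P i).1 k || (P i).2 k) = 0 then 0
      else if (P j).1 i = true ∨ (P i).2 j = true then -1
      else if (P j).2 i = true ∨ (P i).1 j = true then 1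
      else 0 := by
  have hsz : ∀ i, size (fun k => (P i).1 k || (P i).2 k) ≠ 0 := by
    intro i hi
    obtain ⟨k, hk⟩ := (h i).nonempty
    have := size_eq_zero.1 hi k
    simp only [Bool.or_eq_false_iff] at this
    rcases hk with hk | hk
    · rw [this.1] at hk; exact absurd hk (by simp)
    · rw [this.2] at hk; exact absurd hk (by simp)
  have hl : ∀ i j, (P j).1 i = true ∨ (P i).2 j = true → pos π i < pos π j := by
    rintro i j (h1 | h1)
    · exact (h j).left_lt i h1
    · exact (h i).right_gt j h1
  have hr : ∀ i j, (P j).2 i = true ∨ (P i).1 j = true → pos π j < pos π i := by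
    rintro i j (h1 | h1)
    · exact (h j).right_gt i h1
    · exact (h i).left_lt j h1
  simp only [hsz, or_false]
  refine ⟨fun i j => ?_, fun i j => ?_, fun i j hij hw => ?_⟩
  · split_ifs with h1 h2 h3
    · exact Or.inl rfl
    · exact Or.inr (Or.inl ⟨rfl, hl i j h2⟩)
    · exact Or.inr (Or.inr ⟨rfl, hr i j h3⟩)
    · exact Or.inl rfl
  · by_cases hij : i = j
    · simp [hij]
    · rw [if_neg hij, if_neg (Ne.symm hij)]
      by_cases h2 : (P j).1 i = true ∨ (P i).2 j = true
      · have h3 := hl i j h2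
        rw [if_pos h2, if_neg fun h4 => (hl j i h4).not_gt h3, if_pos h2.symm]
        norm_num
      · rw [if_neg h2]
        by_cases h3 : (P j).2 i = true ∨ (P i).1 j = true
        · rw [if_pos h3, if_pos h3.symm]
        · rw [if_neg h3, if_neg fun h4 => h3 h4.symm, if_neg fun h4 => h2 h4.symm]
          norm_num
  · rw [if_neg hij]
    rcases lt_or_gt_of_ne fun e => hij (pos_injective π e) with h1 | h1
    · rw [abs_of_neg (by linarith)] at hw
      rw [if_pos (Or.inl ((h j).mem_left i (by linarith)))]
      norm_num
    · rw [abs_of_pos (by linarith)] at hw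
      rw [if_neg fun h4 => (hl i j h4).not_gt h1,
        if_pos (Or.inl ((h j).mem_right i (by linarith)))]
      norm_num

/-- The first seriation compares correctly all pairs at distance at least `w`, up to a global
reversal. -/
theorem SeriationScales.aggregateBisections_spec (h : SeriationScales π D δ₁ δ₂ δ₃ u v w)
    (hn : 2 * v + w + 1 ≤ (n : ℝ) / 2) :
    ∃ ρ, (ρ = π ∨ ρ = revOrder π) ∧
      IsPartialComparison ρ w (aggregateBisections ch δ₁ δ₂ δ₃ D).val := by
  obtain ⟨ρ, hρ, hor⟩ := exists_oriented ch h.v_pos h.v_le_w hn (h.splits_bisection ch)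
  exact ⟨ρ, hρ, isPartialComparison_of_oriented hor⟩

end Orientation

/-! ### Estimated distances versus gaps of positions -/

section Distance

variable {n : ℕ}

/-- The set of items with `S i = true`. -/
def members (S : Fin n → Bool) : Finset (Fin n) := Finset.univ.filter fun k => S k = true

@[simp] theorem mem_members {S : Fin n → Bool} {k : Fin n} : k ∈ members S ↔ S k = true := by
  simp [members]

/-- Inner product of rows `i`, `j` of `A` restricted to the columns in `S`. -/
def rowInner (S : Fin n → Bool) (A : Matrix (Fin n) (Fin n) ℝ) (i j : Fin n) : ℝ :=
  ∑ k ∈ members S, A i k * A j k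

theorem rowInner_comm (S : Fin n → Bool) (A : Matrix (Fin n) (Fin n) ℝ) (i j : Fin n) :
    rowInner S A i j = rowInner S A j i :=
  Finset.sum_congr rfl fun _ _ => mul_comm _ _

variable (ch : SabreChoices n)

/-- The Gram matrix of the rows of the submatrix of `A` on `S × S`. -/
def gram (A : Matrix (Fin n) (Fin n) ℝ) (S : Fin n → Bool) (i j : Fin n) : ℝ :=
  ∑ k, (if S i = true ∧ S k = true then A i k else 0) *
    (if S j = true ∧ S k = true then A j k else 0)

theorem gram_eq_rowInner {A : Matrix (Fin n) (Fin n) ℝ} {S : Fin n → Bool} {i j : Fin n}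
    (hi : S i = true) (hj : S j = true) : gram A S i j = rowInner S A i j := by
  rw [rowInner, members, Finset.sum_filter, gram]
  refine Finset.sum_congr rfl fun k _ => ?_
  by_cases hk : S k = true <;> simp [hi, hj, hk]

theorem gram_comm (A : Matrix (Fin n) (Fin n) ℝ) (S : Fin n → Bool) (i j : Fin n) :
    gram A S i j = gram A S j i :=
  Finset.sum_congr rfl fun _ _ => mul_comm _ _

/-- The search for the proxy `m i` of a row `i` of the Gram matrix. -/
def proxySearch (S : Fin n → Bool) (G : Fin n → Fin n → ℝ) (i : Fin n) :
    Timed (Option (Fin n)) :=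
  argmin ch.pick (fun j => op 4 (decide (S j = true ∧ j ≠ i))) fun j =>
    largest fun k => op 15 (if S k = true ∧ k ≠ i ∧ k ≠ j then |G k i - G k j| else 0)

/-- The index `m i` found in the distance estimation. -/
def proxy (S : Fin n → Bool) (G : Fin n → Fin n → ℝ) (i : Fin n) : Fin n :=
  (proxySearch ch S G i).val.getD i

theorem estimateDistance_val (A : Matrix (Fin n) (Fin n) ℝ) (S : Fin n → Bool) (i j : Fin n) :
    (estimateDistance ch A S).val i j = if S i = true ∧ S j = true ∧ i ≠ j then
      √((n : ℝ) * (gram A S i (proxy ch S (gram A S) i) +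
        gram A S j (proxy ch S (gram A S) j) - 2 * gram A S i j)) else 0 := rfl

theorem estimateDistance_comm (A : Matrix (Fin n) (Fin n) ℝ) (S : Fin n → Bool) (i j : Fin n) :
    (estimateDistance ch A S).val i j = (estimateDistance ch A S).val j i := by
  simp only [estimateDistance_val, gram_comm A S i j]
  by_cases h : S i = true ∧ S j = true ∧ i ≠ j
  · rw [if_pos h, if_pos ⟨h.2.1, h.1, h.2.2.symm⟩]
    ring_nf
  · rw [if_neg h, if_neg fun h' => h ⟨h'.2.1, h'.1, h'.2.2.symm⟩]

theorem estimateDistance_nonneg (A : Matrix (Fin n) (Fin n) ℝ) (S : Fin n → Bool) (i j : Fin n) :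
    0 ≤ (estimateDistance ch A S).val i j := by
  rw [estimateDistance_val]
  split_ifs
  · exact Real.sqrt_nonneg _
  · exact le_rfl

/-- The minimizer is at least as good as the competitor `j`, whose objective is at most `c`. -/
theorem proxy_spec {S : Fin n → Bool} {G : Fin n → Fin n → ℝ} {i j : Fin n} (hj : S j = true)
    (hji : j ≠ i) {c : ℝ} (hc : 0 ≤ c)
    (h : ∀ k, S k = true → k ≠ i → k ≠ j → |G k i - G k j| ≤ c) :
    S (proxy ch S G i) = true ∧ proxy ch S G i ≠ i ∧
      ∀ k, S k = true → k ≠ i → k ≠ proxy ch S G i → |G k i - G k (proxy ch S G i)| ≤ c := by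
  obtain ⟨m, hm⟩ := argmin_eq_some (pick := ch.pick)
    (cand := fun j => op 4 (decide (S j = true ∧ j ≠ i))) (f := fun j =>
    largest fun k => op 15 (if S k = true ∧ k ≠ i ∧ k ≠ j then |G k i - G k j| else 0))
    (j := j) (decide_eq_true ⟨hj, hji⟩)
  have hp : proxy ch S G i = m := by
    rw [proxy, proxySearch, hm]; rfl
  rw [hp]
  obtain ⟨h1, h2⟩ := argmin_some ch.pick_mem hm
  rw [val_op, decide_eq_true_iff] at h1
  refine ⟨h1.1, h1.2, fun k hk hki hkm => ?_⟩
  have h3 := h2 j (decide_eq_true ⟨hj, hji⟩)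
  have h4 := le_largest
    (fun k => op 15 (if S k = true ∧ k ≠ i ∧ k ≠ m then |G k i - G k m| else 0)) k
  rw [val_op, if_pos ⟨hk, hki, hkm⟩] at h4
  refine h4.trans (h3.trans (largest_le hc fun k => ?_))
  rw [val_op]
  split_ifs with hk'
  · exact h k hk'.1 hk'.2.1 hk'.2.2
  · exact hc

/-- Every interval of at least `√n` positions contains its share of items of `S`. -/
def IsDense (π : Equiv.Perm (Fin n)) (S : Fin n → Bool) : Prop :=
  ∀ a b : ℕ, a ≤ b → b ≤ n → √(n : ℝ) ≤ (b : ℝ) - a →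
    ((b : ℝ) - a) / 6 ≤ (Finset.univ.filter fun k => S k = true ∧ a ≤ (π k : ℕ) ∧ (π k : ℕ) < b).card

theorem IsDense.reverse {π : Equiv.Perm (Fin n)} {S : Fin n → Bool} (h : IsDense π S) :
    IsDense (revOrder π) S := by
  intro a b hab hbn hsq
  have h2 := h (n - b) (n - a) (by omega) (by omega)
    (by rw [Nat.cast_sub hbn, Nat.cast_sub (hab.trans hbn)]; linarith)
  rw [Nat.cast_sub hbn, Nat.cast_sub (hab.trans hbn)] at h2
  have hset : (Finset.univ.filter fun k => S k = true ∧ a ≤ (revOrder π k : ℕ) ∧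
      (revOrder π k : ℕ) < b) = Finset.univ.filter fun k => S k = true ∧
      n - b ≤ (π k : ℕ) ∧ (π k : ℕ) < n - a := by
    refine Finset.filter_congr fun k _ => and_congr_right fun _ => ?_
    have := (π k).isLt
    rw [revOrder_apply, Fin.val_rev]
    omega
  rw [hset]
  linarith

theorem isDense_univ (π : Equiv.Perm (Fin n)) : IsDense π fun _ => true := by
  intro a b hab hbn _
  have h : (0 : ℝ) ≤ (b : ℝ) - a := sub_nonneg.2 (Nat.cast_le.2 hab)
  simp only [true_and, card_filter_interval π hbn, Nat.cast_sub hab]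
  linarith

theorem le_sqrt_of_sq_le {a n : ℕ} (h : a * a ≤ n) : (a : ℝ) ≤ √(n : ℝ) :=
  Real.le_sqrt_of_sq_le (by rw [sq]; exact_mod_cast h)

/-- A window of length at least `√n ≥ 18` contains at least three items of `S`, hence one that
differs from the two excluded items. -/
theorem IsDense.exists_near {π : Equiv.Perm (Fin n)} {S : Fin n → Bool} (h : IsDense π S)
    (hn : 324 ≤ n) (i j₁ j₂ : Fin n) :
    ∃ k, S k = true ∧ k ≠ j₁ ∧ k ≠ j₂ ∧ |pos π i - pos π k| ≤ √(n : ℝ) := by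
  have h18 : (18 : ℝ) ≤ √(n : ℝ) := by exact_mod_cast le_sqrt_of_sq_le (a := 18) (by omega)
  have hsq : √(n : ℝ) * √(n : ℝ) = n := Real.mul_self_sqrt (Nat.cast_nonneg n)
  obtain ⟨L, hL⟩ : ∃ L : ℕ, L = ⌈√(n : ℝ)⌉₊ := ⟨_, rfl⟩
  have hL1 : √(n : ℝ) ≤ L := hL ▸ Nat.le_ceil _
  have hL2 : (L : ℝ) < √(n : ℝ) + 1 := hL ▸ Nat.ceil_lt_add_one (Real.sqrt_nonneg _)
  have hLn : L ≤ n := by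
    rw [← Nat.cast_le (α := ℝ)]
    nlinarith
  -- The window starts at `π i`, shifted left where it would leave the range; it contains the
  -- position of `i` in either case.
  obtain ⟨a, ha⟩ : ∃ a : ℕ, a = min (π i : ℕ) (n - L) := ⟨_, rfl⟩
  have hi := (π i).isLt
  have hLpos : 0 < L := by
    rw [← Nat.cast_pos (α := ℝ)]; linarith
  have hd := h a (a + L) (by omega) (by omega) (by push_cast; linarith)
  push_cast at hd
  have hcard : ({j₁, j₂} : Finset (Fin n)).card < (Finset.univ.filter fun k =>
      S k = true ∧ a ≤ (π k : ℕ) ∧ (π k : ℕ) < a + L).card := by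
    refine lt_of_le_of_lt Finset.card_le_two ?_
    rw [← Nat.cast_lt (α := ℝ)]
    push_cast
    linarith
  obtain ⟨k, hk, hk2⟩ := Finset.exists_mem_notMem_of_card_lt_card hcard
  simp only [Finset.mem_filter, Finset.mem_univ, true_and] at hk
  simp only [Finset.mem_insert, Finset.mem_singleton, not_or] at hk2
  refine ⟨k, hk.1, hk2.1, hk2.2, ?_⟩
  have h1 : (π i : ℕ) + 1 ≤ (π k : ℕ) + L := by omega
  have h2 : (π k : ℕ) + 1 ≤ (π i : ℕ) + L := by omega
  have h1' : ((π i : ℕ) : ℝ) + 1 ≤ ((π k : ℕ) : ℝ) + L := by exact_mod_cast h1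
  have h2' : ((π k : ℕ) : ℝ) + 1 ≤ ((π i : ℕ) : ℝ) + L := by exact_mod_cast h2
  simp only [pos]
  rw [abs_le]
  constructor <;> linarith

/-- The bi-Lipschitz conditions for a matrix whose rows and columns are ordered by `π`. -/
structure OrderedBiLipschitz (π : Equiv.Perm (Fin n)) (α β : ℝ) (M : Matrix (Fin n) (Fin n) ℝ) :
    Prop where
  symm : ∀ i j, M i j = M j i
  nonneg : ∀ i j, 0 ≤ M i j
  le_one : ∀ i j, M i j ≤ 1
  upper : ∀ i j k, |M i k - M j k| ≤ β * |pos π i - pos π j| / n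
  left : ∀ i j k, pos π i ≤ pos π j → pos π k ≤ pos π i →
    α * (pos π j - pos π i) / n ≤ M i k - M j k
  right : ∀ i j k, pos π i ≤ pos π j → pos π j ≤ pos π k →
    α * (pos π j - pos π i) / n ≤ M j k - M i k

theorem BiLipschitz.abs_sub_le {α β : ℝ} {F : Matrix (Fin n) (Fin n) ℝ} (hF : BiLipschitz α β F)
    (i j k : Fin n) : |F i k - F j k| ≤ β * |((i : ℕ) : ℝ) - (j : ℕ)| / n := by
  rcases lt_trichotomy i j with h | rfl | h
  · have h' : ((i : ℕ) : ℝ) < (j : ℕ) := by exact_mod_cast h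
    have := hF.upper i j k h
    rw [abs_of_neg (by linarith : ((i : ℕ) : ℝ) - (j : ℕ) < 0)]
    convert this using 1
    ring
  · simp
  · have h' : ((j : ℕ) : ℝ) < (i : ℕ) := by exact_mod_cast h
    have := hF.upper j i k h
    rw [abs_of_pos (by linarith : 0 < ((i : ℕ) : ℝ) - (j : ℕ)), abs_sub_comm]
    convert this using 1
    ring

/-- The permuted signal is treated as a matrix indexed by items, with an order `π` attached. In this
form the conditions are invariant under reversal of `π`, which exchanges `left` and `right`. -/
theorem BiLipschitz.ordered {α β : ℝ} {F : Matrix (Fin n) (Fin n) ℝ} (hF : BiLipschitz α β F)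
    (hs : F.IsSymm) (π : Equiv.Perm (Fin n)) :
    OrderedBiLipschitz π α β (F.submatrix π π) where
  symm i j := hs.apply _ _
  nonneg i j := (hF.mem_Icc _ _).1
  le_one i j := (hF.mem_Icc _ _).2
  upper i j k := hF.abs_sub_le _ _ _
  left i j k hij hki := by
    rcases hij.lt_or_eq with h | h
    · have := hF.lower_left (π i) (π j) (π k) (by simpa [pos] using h) (by simpa [pos] using hki)
      refine le_of_eq_of_le ?_ this
      simp only [pos]; ring
    · rw [pos_injective π h]; simp
  right i j k hij hjk := by
    rcases hij.lt_or_eq with h | h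
    · have := hF.lower_right (π i) (π j) (π k) (by simpa [pos] using h) (by simpa [pos] using hjk)
      refine le_of_eq_of_le ?_ this
      simp only [pos]; ring
    · rw [pos_injective π h]; simp

variable {π : Equiv.Perm (Fin n)} {α β : ℝ} {M : Matrix (Fin n) (Fin n) ℝ}

theorem OrderedBiLipschitz.reverse (h : OrderedBiLipschitz π α β M) :
    OrderedBiLipschitz (revOrder π) α β M where
  symm := h.symm
  nonneg := h.nonneg
  le_one := h.le_one
  upper i j k := by rw [abs_pos_revOrder_sub]; exact h.upper i j k
  left i j k hij hki := by
    simp only [pos_revOrder] at hij hki ⊢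
    convert h.right j i k (by linarith) (by linarith) using 1
    ring
  right i j k hij hki := by
    simp only [pos_revOrder] at hij hki ⊢
    convert h.left j i k (by linarith) (by linarith) using 1
    ring

theorem OrderedBiLipschitz.abs_sub_le_one (h : OrderedBiLipschitz π α β M) (i j k : Fin n) :
    |M i k - M j k| ≤ 1 := by
  rw [abs_le]
  constructor <;> linarith [h.nonneg i k, h.nonneg j k, h.le_one i k, h.le_one j k]

theorem OrderedBiLipschitz.abs_sum_le (h : OrderedBiLipschitz π α β M) (hβ : 0 ≤ β)
    (S : Fin n → Bool) {i k : Fin n} (hik : |pos π i - pos π k| ≤ √(n : ℝ)) {x : Fin n → ℝ}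
    (hx : ∀ l, |x l| ≤ 1) : |∑ l ∈ members S, (M i l - M k l) * x l| ≤ β * √(n : ℝ) := by
  have hn : (0 : ℝ) < n := Nat.cast_pos.2 i.pos
  have hterm : ∀ l ∈ members S, |(M i l - M k l) * x l| ≤ β * √(n : ℝ) / n := by
    intro l _
    rw [abs_mul]
    calc |M i l - M k l| * |x l| ≤ |M i l - M k l| * 1 := by gcongr; exact hx l
      _ = |M i l - M k l| := mul_one _
      _ ≤ β * |pos π i - pos π k| / n := h.upper i k l
      _ ≤ β * √(n : ℝ) / n := by gcongr
  calc |∑ l ∈ members S, (M i l - M k l) * x l| ≤ ∑ l ∈ members S, |(M i l - M k l) * x l| :=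
        Finset.abs_sum_le_sum_abs _ _
    _ ≤ (members S).card • (β * √(n : ℝ) / n) := Finset.sum_le_card_nsmul _ _ _ hterm
    _ ≤ (n : ℝ) * (β * √(n : ℝ) / n) := by
        rw [nsmul_eq_mul]
        gcongr
        exact (Finset.card_le_univ _).trans_eq (Fintype.card_fin n)
    _ = β * √(n : ℝ) := by field_simp

theorem rowInner_sub (S : Fin n → Bool) (M : Matrix (Fin n) (Fin n) ℝ) (i k j : Fin n) :
    rowInner S M i j - rowInner S M k j = ∑ l ∈ members S, (M i l - M k l) * M j l := by
  rw [rowInner, rowInner, ← Finset.sum_sub_distrib]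
  exact Finset.sum_congr rfl fun _ _ => by ring

/-- The squared distance between the rows `i`, `j` of `M` on the columns in `S`. -/
def rowDistSq (S : Fin n → Bool) (M : Matrix (Fin n) (Fin n) ℝ) (i j : Fin n) : ℝ :=
  ∑ k ∈ members S, (M i k - M j k) ^ 2

theorem rowDistSq_eq (S : Fin n → Bool) (M : Matrix (Fin n) (Fin n) ℝ) (i j : Fin n) :
    rowDistSq S M i j = rowInner S M i i + rowInner S M j j - 2 * rowInner S M i j := by
  simp only [rowDistSq, rowInner, Finset.mul_sum]
  rw [← Finset.sum_add_distrib, ← Finset.sum_sub_distrib]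
  exact Finset.sum_congr rfl fun _ _ => by ring

/-- The proxy inner product `⟨A i, A (m i)⟩` estimates the squared norm of the row `i`. -/
theorem OrderedBiLipschitz.abs_gram_proxy_sub_le (h : OrderedBiLipschitz π α β M) (hβ : 0 ≤ β)
    {S : Fin n → Bool} (hS : IsDense π S) (hn : 324 ≤ n) {A : Matrix (Fin n) (Fin n) ℝ} {e : ℝ}
    (he : ∀ i j, S i = true → S j = true → i ≠ j → |rowInner S A i j - rowInner S M i j| ≤ e)
    {i : Fin n} (hi : S i = true) :
    |gram A S i (proxy ch S (gram A S) i) - rowInner S M i i| ≤ 2 * β * √(n : ℝ) + 5 * e := by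
  -- An item `j` of `S` within `√n` of `i` is a good competitor: its row differs little from that of
  -- `i`, so the objective at `j` is at most `β √n + 2 e`.
  obtain ⟨j, hj, hji, -, hnear⟩ := hS.exists_near hn i i i
  have he0 : 0 ≤ e := (abs_nonneg _).trans (he i j hi hj hji.symm)
  have hM1 : ∀ k l, |M k l| ≤ 1 := fun k l => by
    rw [abs_of_nonneg (h.nonneg k l)]; exact h.le_one k l
  have hopt : ∀ k, S k = true → k ≠ i → k ≠ j → |gram A S k i - gram A S k j| ≤
      β * √(n : ℝ) + 2 * e := by
    intro k hk hki hkj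
    rw [gram_eq_rowInner hk hi, gram_eq_rowInner hk hj]
    have h1 := he k i hk hi hki
    have h2 := he k j hk hj hkj
    have h3 : |rowInner S M k i - rowInner S M k j| ≤ β * √(n : ℝ) := by
      rw [rowInner_comm S M k i, rowInner_comm S M k j, rowInner_sub]
      exact h.abs_sum_le hβ S hnear (hM1 k)
    rw [abs_le] at h1 h2 h3 ⊢
    constructor <;> linarith [h1.1, h1.2, h2.1, h2.2, h3.1, h3.2]
  obtain ⟨hm, hmi, hmk⟩ := proxy_spec ch hj hji (by positivity) hopt
  generalize proxy ch S (gram A S) i = m at hm hmi hmk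
  -- The criterion never tests against row `i` itself. A row `k` near `i` takes its place at the
  -- price `β √n`. Removing the noise costs `2 e` for the row `k` and `e` for the proxy product, on
  -- top of the `2 e` from the optimum: `5 e` in all.
  obtain ⟨k, hk, hki, hkm, hnear'⟩ := hS.exists_near hn i i m
  have h4 := hmk k hk hki hkm
  rw [gram_eq_rowInner hk hi, gram_eq_rowInner hk hm] at h4
  rw [gram_eq_rowInner hi hm]
  have h1 := he k i hk hi hki
  have h2 := he k m hk hm hkm
  have h3 := he i m hi hm hmi.symm
  have h5 : |(rowInner S M i i - rowInner S M i m) - (rowInner S M k i - rowInner S M k m)| ≤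
      β * √(n : ℝ) := by
    have : (rowInner S M i i - rowInner S M i m) - (rowInner S M k i - rowInner S M k m) =
        ∑ l ∈ members S, (M i l - M k l) * (M i l - M m l) := by
      have e1 := rowInner_sub S M i k i
      have e2 := rowInner_sub S M i k m
      have : ∑ l ∈ members S, (M i l - M k l) * (M i l - M m l) =
          ∑ l ∈ members S, (M i l - M k l) * M i l - ∑ l ∈ members S, (M i l - M k l) * M m l := by
        rw [← Finset.sum_sub_distrib]
        exact Finset.sum_congr rfl fun _ _ => by ring
      rw [this, ← e1, ← e2]
      ring
    rw [this]
    exact h.abs_sum_le hβ S hnear' fun l => h.abs_sub_le_one i m l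
  rw [abs_le] at h1 h2 h3 h4 h5 ⊢
  constructor <;> linarith [h1.1, h1.2, h2.1, h2.2, h3.1, h3.2, h4.1, h4.2, h5.1, h5.2]

/-- Replacing a negative estimate by zero moves it towards the nonnegative target. -/
theorem abs_sqrt_sq_sub_le {x y c : ℝ} (hy : 0 ≤ y) (h : |x - y| ≤ c) : |√x ^ 2 - y| ≤ c := by
  rcases le_total 0 x with hx | hx
  · rwa [Real.sq_sqrt hx]
  · rw [Real.sqrt_eq_zero_of_nonpos hx]
    rw [abs_le] at h ⊢
    constructor <;> linarith [h.1]

theorem rowDistSq_nonneg (S : Fin n → Bool) (M : Matrix (Fin n) (Fin n) ℝ) (i j : Fin n) :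
    0 ≤ rowDistSq S M i j := Finset.sum_nonneg fun _ _ => sq_nonneg _

/-- The estimated squared distances are close to the true ones. -/
theorem OrderedBiLipschitz.abs_estimateDistance_sq_sub_le (h : OrderedBiLipschitz π α β M)
    (hβ : 0 ≤ β) {S : Fin n → Bool} (hS : IsDense π S) (hn : 324 ≤ n)
    {A : Matrix (Fin n) (Fin n) ℝ} {e : ℝ} (he0 : 0 ≤ e)
    (he : ∀ i j, S i = true → S j = true → i ≠ j → |rowInner S A i j - rowInner S M i j| ≤ e)
    {i j : Fin n} (hi : S i = true) (hj : S j = true) :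
    |(estimateDistance ch A S).val i j ^ 2 - n * rowDistSq S M i j| ≤
      n * (4 * β * √(n : ℝ) + 12 * e) := by
  have hn0 : (0 : ℝ) ≤ n := Nat.cast_nonneg n
  rw [estimateDistance_val]
  by_cases hij : i = j
  · subst hij
    rw [if_neg (by simp), rowDistSq]
    simp only [sub_self]
    norm_num
    positivity
  rw [if_pos ⟨hi, hj, hij⟩]
  refine abs_sqrt_sq_sub_le (mul_nonneg hn0 (rowDistSq_nonneg _ _ _ _)) ?_
  rw [← mul_sub, abs_mul, abs_of_nonneg hn0]
  refine mul_le_mul_of_nonneg_left ?_ hn0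
  have h1 := h.abs_gram_proxy_sub_le ch hβ hS hn he hi
  have h2 := h.abs_gram_proxy_sub_le ch hβ hS hn he hj
  have h3 := he i j hi hj hij
  rw [← gram_eq_rowInner (A := A) hi hj] at h3
  rw [rowDistSq_eq]
  rw [abs_le] at h1 h2 h3 ⊢
  constructor <;> linarith [h1.1, h1.2, h2.1, h2.2, h3.1, h3.2]

theorem OrderedBiLipschitz.rowDistSq_le (h : OrderedBiLipschitz π α β M)
    (S : Fin n → Bool) (i j : Fin n) :
    n * rowDistSq S M i j ≤ (β * |pos π i - pos π j|) ^ 2 := by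
  have hn : (0 : ℝ) < n := Nat.cast_pos.2 i.pos
  have hterm : ∀ k ∈ members S, (M i k - M j k) ^ 2 ≤ (β * |pos π i - pos π j| / n) ^ 2 := by
    intro k _
    rw [← sq_abs]
    exact pow_le_pow_left₀ (abs_nonneg _) (h.upper i j k) 2
  calc n * rowDistSq S M i j ≤ n * ((members S).card • (β * |pos π i - pos π j| / n) ^ 2) := by
        gcongr
        exact Finset.sum_le_card_nsmul _ _ _ hterm
    _ ≤ n * ((n : ℝ) * (β * |pos π i - pos π j| / n) ^ 2) := by
        rw [nsmul_eq_mul]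
        gcongr
        exact (Finset.card_le_univ _).trans_eq (Fintype.card_fin n)
    _ = (β * |pos π i - pos π j|) ^ 2 := by field_simp

theorem IsDense.le_rowDistSq {S : Fin n → Bool} (hS : IsDense π S) {i j : Fin n} {a b : ℕ}
    (hab : a ≤ b) (hb : b ≤ n) (hlen : √(n : ℝ) ≤ (b : ℝ) - a) {t : ℝ} (ht : 0 ≤ t)
    (hk : ∀ k, a ≤ (π k : ℕ) → (π k : ℕ) < b → t ≤ |M i k - M j k|) :
    ((b : ℝ) - a) / 6 * t ^ 2 ≤ rowDistSq S M i j := by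
  let I := Finset.univ.filter fun k => S k = true ∧ a ≤ (π k : ℕ) ∧ (π k : ℕ) < b
  calc ((b : ℝ) - a) / 6 * t ^ 2 ≤ (I.card : ℝ) * t ^ 2 := by
        gcongr
        exact hS a b hab hb hlen
    _ = I.card • t ^ 2 := by rw [nsmul_eq_mul]
    _ ≤ ∑ k ∈ I, (M i k - M j k) ^ 2 := by
        refine Finset.card_nsmul_le_sum _ _ _ fun k hk' => ?_
        simp only [I, Finset.mem_filter, Finset.mem_univ, true_and] at hk'
        rw [← sq_abs (M i k - M j k)]
        exact pow_le_pow_left₀ ht (hk k hk'.2.1 hk'.2.2) 2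
    _ ≤ rowDistSq S M i j := by
        refine Finset.sum_le_sum_of_subset_of_nonneg (fun k hk' => ?_) fun _ _ _ => sq_nonneg _
        simp only [I, Finset.mem_filter, Finset.mem_univ, true_and] at hk'
        exact mem_members.2 hk'.1

/-- It suffices to find an interval of columns, of length proportional to `n`, on which the rows
differ by at least `α Δ / (3 n)`. If `Δ ≤ n / 2`, a quarter of all columns lies left of both items
or right of both, where monotonicity gives `α Δ / n`. If `Δ > n / 2`, the columns between the items
must serve; there the signed difference grows along the columns, so it cannot be small both in the
first and in the last third. -/
theorem OrderedBiLipschitz.le_rowDistSq_of_lt (h : OrderedBiLipschitz π α β M) (hα : 0 < α)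
    {S : Fin n → Bool} (hS : IsDense π S) (hn : 324 ≤ n) {i j : Fin n}
    (hij : pos π i < pos π j) :
    (α / 24 * (pos π j - pos π i)) ^ 2 ≤ n * rowDistSq S M i j := by
  have h18 : (18 : ℝ) ≤ √(n : ℝ) := by exact_mod_cast le_sqrt_of_sq_le (a := 18) (by omega)
  have hsq : √(n : ℝ) * √(n : ℝ) = n := Real.mul_self_sqrt (Nat.cast_nonneg n)
  have hn0 : (324 : ℝ) ≤ n := by exact_mod_cast hn
  have hnpos : (0 : ℝ) < n := by linarith
  have hi := (π i).isLt
  have hj := (π j).isLt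
  have hij' : (π i : ℕ) < π j := by simpa [pos] using hij
  have hjn : pos π j ≤ n - 1 := pos_le π j
  set Δ := pos π j - pos π i with hΔ
  have hΔ0 : 0 < Δ := by linarith
  -- The density costs a factor `6`, which turns `n / 8` columns into `n / 48`. The constant `24`
  -- works because `48 * 9 ≤ 24 ^ 2`.
  have main : ∀ (m t : ℝ), (n : ℝ) / 48 ≤ m → α * Δ / (3 * n) ≤ t → m * t ^ 2 ≤ rowDistSq S M i j →
      (α / 24 * Δ) ^ 2 ≤ n * rowDistSq S M i j := by
    intro m t hm ht hle
    have hm0 : 0 ≤ m := le_trans (by positivity) hm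
    calc (α / 24 * Δ) ^ 2 ≤ n * ((n : ℝ) / 48 * (α * Δ / (3 * n)) ^ 2) := by
          field_simp
          norm_num
      _ ≤ n * (m * t ^ 2) := by gcongr
      _ ≤ _ := by gcongr
  by_cases hcase : Δ ≤ n / 2
  · have ht0 : 0 ≤ α * Δ / n := by positivity
    have ht : α * Δ / (3 * n) ≤ α * Δ / n := by
      gcongr; linarith
    by_cases hi4 : (n : ℝ) / 4 ≤ pos π i
    · refine main _ _ ?_ ht (hS.le_rowDistSq (a := 0) (b := π i) (Nat.zero_le _) hi.le ?_ ht0 ?_)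
      · simp only [pos] at hi4; push_cast; linarith
      · simp only [pos] at hi4; push_cast; nlinarith
      · intro k _ hk
        refine (h.left i j k hij.le ?_).trans (le_abs_self _)
        simp only [pos]; exact_mod_cast hk.le
    · refine main _ _ ?_ ht (hS.le_rowDistSq (a := π j) (b := n) hj.le le_rfl ?_ ht0 ?_)
      · change _ ≤ ((n : ℝ) - pos π j) / 6
        linarith
      · change _ ≤ (n : ℝ) - pos π j
        nlinarith
      · intro k hk _
        rw [abs_sub_comm]
        refine (h.right i j k hij.le ?_).trans (le_abs_self _)
        simp only [pos]; exact_mod_cast hk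
  · rw [not_le] at hcase
    obtain ⟨L, hL⟩ : ∃ L : ℕ, L = ((π j : ℕ) - π i) / 3 := ⟨_, rfl⟩
    have hL1 : 3 * L + π i ≤ π j := by omega
    have hL2 : (π j : ℕ) ≤ π i + 3 * L + 2 := by omega
    have hL1' : 3 * (L : ℝ) ≤ Δ := by
      have : 3 * (L : ℝ) + pos π i ≤ pos π j := by simp only [pos]; exact_mod_cast hL1
      linarith
    have hL2' : Δ ≤ 3 * (L : ℝ) + 2 := by
      have : pos π j ≤ pos π i + 3 * L + 2 := by simp only [pos]; exact_mod_cast hL2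
      linarith
    have ht0 : 0 ≤ α * Δ / (3 * n) := by positivity
    -- Moving a column right between `i` and `j` brings it closer to `j` and away from `i`. Both
    -- effects increase the difference, whence the factor `2`.
    have hgap : ∀ k l, pos π i ≤ pos π k → pos π k + Δ / 3 ≤ pos π l → pos π l ≤ pos π j →
        2 * (α * Δ / (3 * n)) ≤ (M j l - M i l) - (M j k - M i k) := by
      intro k l hik hkl hlj
      have h1 := h.right k l j (by linarith) hlj
      have h2 := h.left k l i (by linarith) hik
      rw [h.symm l j, h.symm k j] at h1
      rw [h.symm l i, h.symm k i] at h2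
      have h3 : α * Δ / (3 * n) ≤ α * (pos π l - pos π k) / n := by
        calc α * Δ / (3 * n) = α * (Δ / 3) / n := by field_simp
          _ ≤ _ := by gcongr; linarith
      linarith
    by_cases hleft : ∀ k, (π i : ℕ) ≤ π k → (π k : ℕ) < π i + L → α * Δ / (3 * n) ≤ |M i k - M j k|
    · refine main _ _ ?_ le_rfl
        (hS.le_rowDistSq (a := π i) (b := π i + L) (by omega) (by omega) ?_ ht0 hleft)
      · push_cast; linarith
      · push_cast; nlinarith
    · push Not at hleft
      obtain ⟨k, hk1, hk2, hk3⟩ := hleft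
      refine main _ _ ?_ le_rfl
        (hS.le_rowDistSq (a := π j - L) (b := π j) (by omega) (by omega) ?_ ht0 fun l hl1 hl2 => ?_)
      · rw [Nat.cast_sub (by omega)]; linarith
      · rw [Nat.cast_sub (by omega)]; nlinarith
      · have e1 : pos π i ≤ pos π k := by simp only [pos]; exact_mod_cast hk1
        have e2 : pos π k + 1 ≤ pos π i + L := by
          simp only [pos]; exact_mod_cast (by omega : (π k : ℕ) + 1 ≤ π i + L)
        have e3 : pos π j ≤ pos π l + L := by
          simp only [pos]; exact_mod_cast (by omega : (π j : ℕ) ≤ π l + L)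
        have e4 : pos π l ≤ pos π j := by simp only [pos]; exact_mod_cast hl2.le
        have := hgap k l e1 (by linarith) e4
        rw [abs_lt] at hk3
        rw [abs_sub_comm]
        refine le_trans ?_ (le_abs_self _)
        linarith [hk3.1]

theorem rowDistSq_comm (S : Fin n → Bool) (M : Matrix (Fin n) (Fin n) ℝ) (i j : Fin n) :
    rowDistSq S M i j = rowDistSq S M j i :=
  Finset.sum_congr rfl fun _ _ => by ring

theorem OrderedBiLipschitz.le_rowDistSq (h : OrderedBiLipschitz π α β M) (hα : 0 < α)
    {S : Fin n → Bool} (hS : IsDense π S) (hn : 324 ≤ n) (i j : Fin n) :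
    (α / 24 * |pos π i - pos π j|) ^ 2 ≤ n * rowDistSq S M i j := by
  rcases lt_trichotomy (pos π i) (pos π j) with hij | hij | hij
  · rw [abs_of_neg (by linarith), neg_sub]
    exact h.le_rowDistSq_of_lt hα hS hn hij
  · rw [hij, sub_self, abs_zero, mul_zero]
    norm_num
    exact mul_nonneg (Nat.cast_nonneg _) (rowDistSq_nonneg _ _ _ _)
  · rw [abs_of_pos (by linarith), rowDistSq_comm]
    exact h.le_rowDistSq_of_lt hα hS hn hij

/-- The estimated distances are equivalent to the distances of positions, up to an additive
error. -/
theorem OrderedBiLipschitz.estimateDistance_bounds (h : OrderedBiLipschitz π α β M) (hα : 0 < α)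
    (hβ : 0 ≤ β) {S : Fin n → Bool} (hS : IsDense π S) (hn : 324 ≤ n)
    {A : Matrix (Fin n) (Fin n) ℝ} {e κ : ℝ} (he0 : 0 ≤ e) (hκ0 : 0 ≤ κ)
    (hκ : n * (4 * β * √(n : ℝ) + 12 * e) ≤ κ ^ 2)
    (he : ∀ i j, S i = true → S j = true → i ≠ j → |rowInner S A i j - rowInner S M i j| ≤ e)
    {i j : Fin n} (hi : S i = true) (hj : S j = true) :
    α / 24 * |pos π i - pos π j| - κ ≤ (estimateDistance ch A S).val i j ∧
      (estimateDistance ch A S).val i j ≤ β * |pos π i - pos π j| + κ := by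
  have h1 := (h.abs_estimateDistance_sq_sub_le ch hβ hS hn he0 he hi hj).trans hκ
  have h2 := h.rowDistSq_le S i j
  have h3 := h.le_rowDistSq hα hS hn i j
  have h4 := estimateDistance_nonneg ch A S i j
  have h5 : 0 ≤ |pos π i - pos π j| := abs_nonneg _
  have h6 : 0 ≤ β * |pos π i - pos π j| := mul_nonneg hβ h5
  rw [abs_le] at h1
  constructor
  · rw [sub_le_iff_le_add]
    refine le_of_sq_le_sq ?_ (by positivity)
    nlinarith [h1.1, mul_nonneg h4 hκ0]
  · refine le_of_sq_le_sq ?_ (by positivity)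
    nlinarith [h1.2, mul_nonneg h6 hκ0]

end Distance

/-! ### The refined comparisons and the deterministic loss bound -/

section Refinement

variable {n : ℕ} (ch : SabreChoices n)

/-- The distances estimated from block `t`. -/
def blockDist (A : Matrix (Fin n) (Fin n) ℝ) (T : Fin n → Fin 3) (t : Fin 3) :
    Fin n → Fin n → ℝ :=
  (estimateDistance ch A fun i => decide (T i = t)).val

/-- The items of the block of `p` which precede `p` and are far from `p` according to `D`. -/
def sideSet (π : Equiv.Perm (Fin n)) (T : Fin n → Fin 3) (D : Fin 3 → Fin n → Fin n → ℝ) (δ₄ : ℝ)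
    (p : Fin n) : Finset (Fin n) :=
  Finset.univ.filter fun k => T k = T p ∧ δ₄ ≤ D (T p) p k ∧ pos π k < pos π p

/-- The block partition is balanced at the scale `√n`, and the noise `E` in `A = M + σ E` is under
control. -/
structure GoodSample (π : Equiv.Perm (Fin n)) (M E A : Matrix (Fin n) (Fin n) ℝ)
    (T : Fin n → Fin 3) (δ₄ e : ℝ) : Prop where
  dense : ∀ t, IsDense π fun i => decide (T i = t)
  inner : ∀ S : Fin n → Bool, ((S = fun _ => true) ∨ ∃ t, S = fun i => decide (T i = t)) →
    ∀ i j, i ≠ j → |rowInner S A i j - rowInner S M i j| ≤ e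
  left : ∀ i p, T i ≠ T p →
    |∑ k ∈ sideSet π T (blockDist ch A T) δ₄ p, E i k| ≤ 2 * √(n * Real.log n)
  right : ∀ i p, T i ≠ T p →
    |∑ k ∈ sideSet (revOrder π) T (blockDist ch A T) δ₄ p, E i k| ≤ 2 * √(n * Real.log n)

/-- Conditions which hold for all large `n`. -/
structure LargeScales (n : ℕ) (α β σ κ e : ℝ) : Prop where
  α_pos : 0 < α
  β_pos : 0 < β
  σ_pos : 0 < σ
  κ_nonneg : 0 ≤ κ
  e_nonneg : 0 ≤ e
  le_n : 324 ≤ n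
  le_κ_sq : n * (4 * β * √(n : ℝ) + 12 * e) ≤ κ ^ 2
  κ_le : β * √(n : ℝ) + κ ≤ sabreDelta n 1
  le_log : 1 + 144 * β / α ≤ Real.log n
  δ_le : 48 * sabreDelta n 4 / α + 1 ≤ (n : ℝ) / 26
  α_le : α ≤ σ * √(n * Real.log n)

theorem sabreDelta_succ (n k : ℕ) : sabreDelta n (k + 1) = sabreDelta n k * Real.log n := by
  simp only [sabreDelta, pow_succ, mul_assoc]

variable {ch} {π : Equiv.Perm (Fin n)} {M E A : Matrix (Fin n) (Fin n) ℝ} {T : Fin n → Fin 3}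
  {α β σ κ e : ℝ}

/-- The first seriation finds the order only up to reversal, so the sample has to be good for both
orders. -/
theorem GoodSample.reverse {δ₄ : ℝ} (h : GoodSample ch π M E A T δ₄ e) :
    GoodSample ch (revOrder π) M E A T δ₄ e where
  dense t := (h.dense t).reverse
  inner := h.inner
  left := h.right
  right := by rw [revOrder_revOrder]; exact h.left

theorem LargeScales.one_le_log (h : LargeScales n α β σ κ e) : 1 ≤ Real.log n := by
  have h1 := h.le_log
  have : 0 ≤ 144 * β / α := by have := h.α_pos; have := h.β_pos; positivity
  linarith

theorem LargeScales.delta_one_pos (h : LargeScales n α β σ κ e) : 0 < sabreDelta n 1 := by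
  have h1 := h.κ_le
  have h2 := h.κ_nonneg
  have h3 : 0 < β * √(n : ℝ) := by
    have := h.β_pos
    have hn : (0 : ℝ) < n := by exact_mod_cast (show 0 < n by have := h.le_n; omega)
    positivity
  linarith

/-- `δ (k + 1) ≥ κ + 6 β δ k / c` with `c = α / 24`. -/
theorem LargeScales.delta_succ (h : LargeScales n α β σ κ e) {k : ℕ} (hk : sabreDelta n 1 ≤ sabreDelta n k) :
    sabreDelta n k ≤ sabreDelta n (k + 1) ∧
    κ + β * (144 * sabreDelta n k / α) ≤ sabreDelta n (k + 1) := by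
  have h0 := h.delta_one_pos
  have h1 := h.one_le_log
  have h2 := h.le_log
  have h3 : κ ≤ sabreDelta n 1 := by
    have := h.κ_le
    have : 0 ≤ β * √(n : ℝ) := by have := h.β_pos; positivity
    linarith
  rw [sabreDelta_succ]
  have hk0 : 0 < sabreDelta n k := by linarith
  constructor
  · nlinarith
  · have : sabreDelta n k * (1 + 144 * β / α) ≤ sabreDelta n k * Real.log n := by gcongr
    have e1 : β * (144 * sabreDelta n k / α) = sabreDelta n k * (144 * β / α) := by ring
    rw [e1]
    linarith

theorem LargeScales.delta_mono (h : LargeScales n α β σ κ e) :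
    sabreDelta n 1 ≤ sabreDelta n 2 ∧ sabreDelta n 2 ≤ sabreDelta n 3 ∧
      sabreDelta n 3 ≤ sabreDelta n 4 := by
  have h1 := (h.delta_succ (k := 1) le_rfl).1
  have h2 := (h.delta_succ (k := 2) h1).1
  have h3 := (h.delta_succ (k := 3) (h1.trans h2)).1
  exact ⟨h1, h2, h3⟩

theorem LargeScales.bounds_univ (h : LargeScales n α β σ κ e) (hM : OrderedBiLipschitz π α β M)
    (hg : GoodSample ch π M E A T (sabreDelta n 4) e) (i j : Fin n) :
    α / 24 * |pos π i - pos π j| - κ ≤ (estimateDistance ch A fun _ => true).val i j ∧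
      (estimateDistance ch A fun _ => true).val i j ≤ β * |pos π i - pos π j| + κ :=
  hM.estimateDistance_bounds ch h.α_pos h.β_pos.le (isDense_univ π) h.le_n h.e_nonneg h.κ_nonneg
    h.le_κ_sq (fun i j _ _ hij => hg.inner _ (Or.inl rfl) i j hij) rfl rfl

theorem LargeScales.bounds_block (h : LargeScales n α β σ κ e) (hM : OrderedBiLipschitz π α β M)
    (hg : GoodSample ch π M E A T (sabreDelta n 4) e) {t : Fin 3} {i j : Fin n} (hi : T i = t)
    (hj : T j = t) :
    α / 24 * |pos π i - pos π j| - κ ≤ blockDist ch A T t i j ∧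
      blockDist ch A T t i j ≤ β * |pos π i - pos π j| + κ :=
  hM.estimateDistance_bounds ch h.α_pos h.β_pos.le (hg.dense t) h.le_n h.e_nonneg h.κ_nonneg
    h.le_κ_sq (fun i j _ _ hij => hg.inner _ (Or.inr ⟨t, rfl⟩) i j hij) (decide_eq_true hi)
    (decide_eq_true hj)

theorem le_gap_of_le {x d δ : ℝ} (hβ : 0 < β) (hd : d ≤ β * x + κ) (hδ : δ ≤ d) {y : ℝ}
    (hy : κ + β * y ≤ δ) : y ≤ x :=
  le_of_mul_le_mul_left (by linarith) hβ

theorem le_of_gap_le {x d δ : ℝ} (hα : 0 < α) (hd : α / 24 * x - κ ≤ d) (hκ : κ ≤ δ)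
    (hx : 48 * δ / α ≤ x) : δ ≤ d := by
  have : 2 * δ ≤ α / 24 * x := by
    calc 2 * δ = α / 24 * (48 * δ / α) := by field_simp; ring
      _ ≤ _ := by gcongr
  linarith

theorem gap_le_of_le {x d δ : ℝ} (hα : 0 < α) (hd : α / 24 * x - κ ≤ d) (hκ : κ ≤ δ)
    (hδ : d ≤ δ) : x ≤ 48 * δ / α := by
  rw [le_div_iff₀ hα]
  linarith

/-- For a threshold `δ ≥ κ`, a distance at most `δ` implies a gap at most `48 δ / α`, and such a gap
or more implies a distance at least `δ`. Conversely a distance at least the next threshold implies a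
gap at least `144 δ / α`, by the extra factor `log n`. -/
theorem LargeScales.seriationScales (h : LargeScales n α β σ κ e) (hM : OrderedBiLipschitz π α β M)
    (hg : GoodSample ch π M E A T (sabreDelta n 4) e) :
    SeriationScales π (estimateDistance ch A fun _ => true).val (sabreDelta n 1) (sabreDelta n 2)
      (sabreDelta n 3) (72 * sabreDelta n 1 / α) (48 * sabreDelta n 2 / α)
      (48 * sabreDelta n 3 / α) := by
  have hα := h.α_pos
  have hβ := h.β_pos
  have hδ := h.delta_one_pos
  obtain ⟨h12, h23, h34⟩ := h.delta_mono
  have hs1 : 1 ≤ √(n : ℝ) := Real.one_le_sqrt.2 (by exact_mod_cast (by have := h.le_n; omega : 1 ≤ n))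
  have hκ := h.κ_le
  have hκ1 : κ ≤ sabreDelta n 1 := by nlinarith
  have hb := h.bounds_univ hM hg
  refine ⟨estimateDistance_comm ch _ _, ?_, ?_, fun k l hkl => ?_, fun k l hkl => ?_,
    fun i k hik => ?_, fun i k hik => ?_, fun i k hik => ?_, fun i k hik => ?_⟩
  · have : 0 < sabreDelta n 2 := by linarith
    positivity
  · gcongr
  · have := (hb k l).2
    rw [hkl] at this
    nlinarith
  -- The scale `u` has `72` in place of `48` to make this inequality strict.
  · refine (gap_le_of_le hα (hb k l).1 hκ1 hkl).trans_lt ?_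
    gcongr
    norm_num
  · refine le_gap_of_le hβ (hb i k).2 hik ((h.delta_succ (k := 1) le_rfl).2.trans' ?_)
    gcongr
    norm_num
  · exact le_of_gap_le hα (hb i k).1 (hκ1.trans h12) hik
  · refine le_gap_of_le hβ (hb i k).2 hik ((h.delta_succ (k := 2) h12).2.trans' ?_)
    have : 0 < sabreDelta n 2 := by linarith
    gcongr
    norm_num
  · exact le_of_gap_le hα (hb i k).1 (hκ1.trans (h12.trans h23)) hik

/-- The statistic that compares the rows `i`, `j` on the columns in `R`. -/
def rowContrast (A : Matrix (Fin n) (Fin n) ℝ) (R : Finset (Fin n)) (i j : Fin n) : ℝ :=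
  ∑ k ∈ R, (A i k - A j k)

theorem rowContrast_comm (A : Matrix (Fin n) (Fin n) ℝ) (R : Finset (Fin n)) (i j : Fin n) :
    rowContrast A R j i = -rowContrast A R i j := by
  rw [rowContrast, rowContrast, ← Finset.sum_neg_distrib]
  exact Finset.sum_congr rfl fun _ _ => by ring

theorem le_rowContrast {R : Finset (Fin n)} {i j : Fin n} {s x : ℝ} (hσ : 0 < σ)
    (hA : A = M + σ • E) (hi : |∑ k ∈ R, E i k| ≤ 2 * s) (hj : |∑ k ∈ R, E j k| ≤ 2 * s)
    (hx : ∀ k ∈ R, x ≤ M i k - M j k) :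
    R.card * x - 4 * (σ * s) ≤ rowContrast A R i j := by
  have h1 : rowContrast A R i j = ∑ k ∈ R, (M i k - M j k) + σ * (∑ k ∈ R, E i k - ∑ k ∈ R, E j k) := by
    rw [rowContrast, hA, ← Finset.sum_sub_distrib, Finset.mul_sum, ← Finset.sum_add_distrib]
    refine Finset.sum_congr rfl fun k _ => ?_
    simp only [Matrix.add_apply, Matrix.smul_apply, smul_eq_mul]
    ring
  have h2 := Finset.card_nsmul_le_sum R _ x hx
  rw [nsmul_eq_mul] at h2
  rw [abs_le] at hi hj
  rw [h1]
  nlinarith [hi.1, hj.2]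

/-- If `p` lies in the right half, the items more than `n / 26` before `p` occupy nearly `n / 2`
positions, a sixth of which belong to the block; `(1 / 2 - 1 / 26) / 6 = 1 / 13`. Items that far
away pass the test with `δ₄`. -/
theorem LargeScales.card_sideSet (h : LargeScales n α β σ κ e) (hM : OrderedBiLipschitz π α β M)
    (hg : GoodSample ch π M E A T (sabreDelta n 4) e) {p : Fin n} (hp : ((n : ℝ) - 1) / 2 ≤ pos π p) :
    (n : ℝ) / 13 ≤ (sideSet π T (blockDist ch A T) (sabreDelta n 4) p).card := by
  have hα := h.α_pos
  obtain ⟨h12, h23, h34⟩ := h.delta_mono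
  have hδ := h.delta_one_pos
  have hδ4 : 0 < sabreDelta n 4 := by linarith
  have hκ1 : κ ≤ sabreDelta n 1 := by
    have h1 := h.κ_le
    have : 0 ≤ β * √(n : ℝ) := by have := h.β_pos; positivity
    linarith
  have hle := h.δ_le
  set w := 48 * sabreDelta n 4 / α with hw
  have hw0 : 0 < w := by positivity
  have hn : (324 : ℝ) ≤ n := by exact_mod_cast h.le_n
  have h18 : (18 : ℝ) ≤ √(n : ℝ) := by
    exact_mod_cast le_sqrt_of_sq_le (a := 18) (by have := h.le_n; omega)
  have hsq : √(n : ℝ) * √(n : ℝ) = n := Real.mul_self_sqrt (Nat.cast_nonneg n)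
  have h0 : 0 ≤ pos π p - w := by linarith
  -- The natural numbers below `b` are exactly those at most `pos π p - w`.
  obtain ⟨b, hb⟩ : ∃ b : ℕ, b = ⌊pos π p - w⌋₊ + 1 := ⟨_, rfl⟩
  have hb1 : pos π p - w ≤ b := by
    rw [hb]; push_cast; exact (Nat.lt_floor_add_one _).le
  have hb2 : ∀ z : ℕ, z < b → (z : ℝ) ≤ pos π p - w := fun z hz =>
    (Nat.cast_le.2 (by omega)).trans (Nat.floor_le h0)
  have hbn : b ≤ n := by
    have h1 := hb2 ⌊pos π p - w⌋₊ (by omega)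
    have h2 : (⌊pos π p - w⌋₊ : ℝ) < ((π p : ℕ) : ℝ) := by
      have : pos π p - w < ((π p : ℕ) : ℝ) := by simp only [pos]; linarith
      linarith
    have h3 : ⌊pos π p - w⌋₊ < (π p : ℕ) := by exact_mod_cast h2
    have := (π p).isLt
    omega
  have hd := hg.dense (T p) 0 b (Nat.zero_le _) hbn (by push_cast; nlinarith)
  push_cast at hd
  have hcard : (n : ℝ) / 13 ≤ ((b : ℝ) - 0) / 6 := by linarith
  refine hcard.trans (hd.trans (Nat.cast_le.2 (Finset.card_le_card fun k hk => ?_)))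
  simp only [sideSet, Finset.mem_filter, Finset.mem_univ, true_and, decide_eq_true_eq] at hk ⊢
  have hk2 : pos π k ≤ pos π p - w := hb2 _ hk.2.2
  have hgap := (h.bounds_block hM hg rfl hk.1).1
  refine ⟨hk.1, le_of_gap_le hα hgap (hκ1.trans (h12.trans (h23.trans h34))) ?_, by linarith⟩
  rw [abs_of_pos (by linarith)]
  linarith

/-- Noise level `σ √(n log n)`. -/
def noiseLevel (n : ℕ) (σ : ℝ) : ℝ := σ * √(n * Real.log n)

/-- On each side the signal has a fixed sign, and the noise is at most `4` noise levels. If neither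
side reaches `5` in the correct direction, the signal on each is at most `9`. On the larger side it
is at least `α * gap / 13`, and `9 * 13 = 117`. -/
theorem LargeScales.contrast_bounds (h : LargeScales n α β σ κ e)
    (hM : OrderedBiLipschitz π α β M) (hA : A = M + σ • E)
    (hg : GoodSample ch π M E A T (sabreDelta n 4) e) {i j p : Fin n} (hi : T i ≠ T p)
    (hj : T j ≠ T p) (hij : pos π i < pos π j) {L R : Finset (Fin n)}
    (hLdef : L = sideSet π T (blockDist ch A T) (sabreDelta n 4) p)
    (hRdef : R = sideSet (revOrder π) T (blockDist ch A T) (sabreDelta n 4) p)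
    (hL : ∀ k ∈ L, pos π k ≤ pos π i) (hR : ∀ k ∈ R, pos π j ≤ pos π k) :
    -(4 * noiseLevel n σ) ≤ rowContrast A L i j ∧ rowContrast A R i j ≤ 4 * noiseLevel n σ ∧
      (rowContrast A L i j < 5 * noiseLevel n σ → -(5 * noiseLevel n σ) < rowContrast A R i j →
        pos π j - pos π i ≤ 117 * noiseLevel n σ / α) := by
  have hα := h.α_pos
  have hn : (0 : ℝ) < n := by exact_mod_cast (show 0 < n by have := h.le_n; omega)
  set x := α * (pos π j - pos π i) / n with hx
  have hx0 : 0 ≤ x := by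
    have : 0 ≤ pos π j - pos π i := by linarith
    positivity
  have h1 : L.card * x - 4 * noiseLevel n σ ≤ rowContrast A L i j :=
    le_rowContrast h.σ_pos hA (hLdef ▸ hg.left i p hi) (hLdef ▸ hg.left j p hj)
      fun k hk => hM.left i j k hij.le (hL k hk)
  have h2 : R.card * x - 4 * noiseLevel n σ ≤ -rowContrast A R i j := by
    rw [← rowContrast_comm]
    exact le_rowContrast h.σ_pos hA (hRdef ▸ hg.right j p hj) (hRdef ▸ hg.right i p hi)
      fun k hk => hM.right i j k hij.le (hR k hk)
  have h3 : (0 : ℝ) ≤ L.card * x := by positivity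
  have h4 : (0 : ℝ) ≤ R.card * x := by positivity
  refine ⟨by linarith, by linarith, fun h5 h6 => ?_⟩
  have hcard : (n : ℝ) / 13 ≤ L.card ∨ (n : ℝ) / 13 ≤ R.card := by
    -- The anchor lies in one of the two halves; the side across the middle is the large one.
    rcases le_total (((n : ℝ) - 1) / 2) (pos π p) with hp | hp
    · exact Or.inl (hLdef ▸ h.card_sideSet hM hg hp)
    · refine Or.inr (hRdef ▸ h.card_sideSet hM.reverse hg.reverse ?_)
      rw [pos_revOrder]; linarith
  have h7 : (n : ℝ) / 13 * x ≤ 9 * noiseLevel n σ := by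
    rcases hcard with hc | hc
    · have := mul_le_mul_of_nonneg_right hc hx0
      linarith
    · have := mul_le_mul_of_nonneg_right hc hx0
      linarith
  rw [le_div_iff₀ hα]
  have h8 : (n : ℝ) / 13 * x = α * (pos π j - pos π i) / 13 := by
    rw [hx]; field_simp
  rw [h8] at h7
  linarith

/-- The item `p` nearest to `i` in the block `t`, according to `D`. -/
def anchor (ch : SabreChoices n) (T : Fin n → Fin 3) (D : Fin n → Fin n → ℝ) (t : Fin 3)
    (i : Fin n) : Fin n :=
  ((argmin ch.pick (fun q => op 2 (decide (T q = t))) fun q => op 2 (D i q)).val).getD i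

theorem anchor_spec {D : Fin n → Fin n → ℝ} {t : Fin 3} {i q : Fin n} (hq : T q = t) :
    T (anchor ch T D t i) = t ∧ D i (anchor ch T D t i) ≤ D i q := by
  obtain ⟨p, hp⟩ := argmin_eq_some (pick := ch.pick) (cand := fun q => op 2 (decide (T q = t)))
    (f := fun q => op 2 (D i q)) (j := q) (decide_eq_true hq)
  have he : anchor ch T D t i = p := by rw [anchor, hp]; rfl
  obtain ⟨h1, h2⟩ := argmin_some ch.pick_mem hp
  rw [he]
  exact ⟨of_decide_eq_true h1, h2 q (decide_eq_true hq)⟩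

/-- The items of the block `t` far from `p` with sign `s` in the comparisons with `i` and `j`. -/
def contrastSet (H : Fin n → Fin n → ℤ) (T : Fin n → Fin 3) (D : Fin 3 → Fin n → Fin n → ℝ)
    (δ₄ : ℝ) (t : Fin 3) (p i j : Fin n) (s : ℤ) : Finset (Fin n) :=
  Finset.univ.filter fun k => H i k = s ∧ H j k = s ∧ T k = t ∧ δ₄ ≤ D t p k

/-- The entry of `H̃` computed for the pair `i < j`. -/
def correction (ch : SabreChoices n) (H : Fin n → Fin n → ℤ) (D : Fin n → Fin n → ℝ)
    (A : Matrix (Fin n) (Fin n) ℝ) (σ δ₄ : ℝ) (T : Fin n → Fin 3) (i j : Fin n) : ℤ :=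
  let t := ch.block (T i) (T j)
  let p := anchor ch T D t i
  let l := rowContrast A (contrastSet H T (blockDist ch A T) δ₄ t p i j 1) i j
  let r := rowContrast A (contrastSet H T (blockDist ch A T) δ₄ t p i j (-1)) i j
  if i < j ∧ H i j = 0 then
    if 5 * σ * √(n * Real.log n) ≤ |l| then -(SignType.sign l : ℤ)
    else if 5 * σ * √(n * Real.log n) ≤ |r| then (SignType.sign r : ℤ)
    else 0
  else 0

theorem reevaluateComparisons_val (H : Fin n → Fin n → ℤ) (D : Fin n → Fin n → ℝ)
    (A : Matrix (Fin n) (Fin n) ℝ) (σ δ₄ : ℝ) (T : Fin n → Fin 3) (i j : Fin n) :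
    (reevaluateComparisons ch H D A σ δ₄ T).val i j =
      H i j + correction ch H D A σ δ₄ T i j - correction ch H D A σ δ₄ T j i := by
  simp only [correction, contrastSet, rowContrast, Finset.sum_filter]
  rfl

/-- Density supplies an item of the block within `√n` of `i`. Its estimated distance is at most `β
√n + κ ≤ δ₁`, so that of the anchor is too. -/
theorem LargeScales.anchor_near (h : LargeScales n α β σ κ e) (hM : OrderedBiLipschitz π α β M)
    (hg : GoodSample ch π M E A T (sabreDelta n 4) e) (t : Fin 3) (i : Fin n) :
    T (anchor ch T (estimateDistance ch A fun _ => true).val t i) = t ∧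
      |pos π i - pos π (anchor ch T (estimateDistance ch A fun _ => true).val t i)| ≤
        48 * sabreDelta n 1 / α := by
  obtain ⟨q, hq, -, -, hnear⟩ := (hg.dense t).exists_near h.le_n i i i
  obtain ⟨h1, h2⟩ := anchor_spec (ch := ch) (D := (estimateDistance ch A fun _ => true).val)
    (i := i) (of_decide_eq_true hq)
  refine ⟨h1, ?_⟩
  have hβ := h.β_pos
  have hκ := h.κ_le
  have hκ1 : κ ≤ sabreDelta n 1 := by
    have : 0 ≤ β * √(n : ℝ) := by positivity
    linarith
  refine gap_le_of_le h.α_pos (h.bounds_univ hM hg i _).1 hκ1 (h2.trans ?_)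
  refine ((h.bounds_univ hM hg i q).2).trans (hκ.trans' ?_)
  gcongr

/-- This removes the dependence on `H`, `i` and `j`. With `w = 48 δ₃ / α`, a block item passing the
test with `δ₄` is at least `3 w` from `p`, while `i` is within `w` of `p` and `j` within `w` of `i`.
So both `i` and `j` are at least `w` from it, on the same side as `p`, and `H` already compares them
with it correctly. The signs in `H` merely say on which side of `p` it lies. -/
theorem LargeScales.contrastSet_eq (h : LargeScales n α β σ κ e) (hM : OrderedBiLipschitz π α β M)
    (hg : GoodSample ch π M E A T (sabreDelta n 4) e) {H : Fin n → Fin n → ℤ}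
    (hH : IsPartialComparison π (48 * sabreDelta n 3 / α) H) {i j p : Fin n} {t : Fin 3}
    (hp : T p = t) (hip : |pos π i - pos π p| ≤ 48 * sabreDelta n 1 / α)
    (hij : |pos π i - pos π j| ≤ 48 * sabreDelta n 3 / α) :
    contrastSet H T (blockDist ch A T) (sabreDelta n 4) t p i j 1 =
        sideSet π T (blockDist ch A T) (sabreDelta n 4) p ∧
      contrastSet H T (blockDist ch A T) (sabreDelta n 4) t p i j (-1) =
        sideSet (revOrder π) T (blockDist ch A T) (sabreDelta n 4) p ∧
      (∀ k ∈ sideSet π T (blockDist ch A T) (sabreDelta n 4) p,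
        pos π k ≤ pos π i ∧ pos π k ≤ pos π j) ∧
      (∀ k ∈ sideSet (revOrder π) T (blockDist ch A T) (sabreDelta n 4) p,
        pos π i ≤ pos π k ∧ pos π j ≤ pos π k) := by
  subst hp
  have hα := h.α_pos
  obtain ⟨h12, h23, h34⟩ := h.delta_mono
  have hδ := h.delta_one_pos
  have hδ3 : 0 < sabreDelta n 3 := by linarith
  have hw1 : 48 * sabreDelta n 1 / α ≤ 48 * sabreDelta n 3 / α := by gcongr; linarith
  have hw0 : 0 < 48 * sabreDelta n 3 / α := by positivity
  have hw3 : 144 * sabreDelta n 3 / α = 3 * (48 * sabreDelta n 3 / α) := by ring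
  have hgap : ∀ k, T k = T p → sabreDelta n 4 ≤ blockDist ch A T (T p) p k →
      3 * (48 * sabreDelta n 3 / α) ≤ |pos π p - pos π k| := by
    intro k hk hfar
    rw [← hw3]
    exact le_gap_of_le h.β_pos (h.bounds_block hM hg rfl hk).2 hfar
      (h.delta_succ (k := 3) (h12.trans h23)).2
  have hip' := abs_le.1 (hip.trans hw1)
  have hij' := abs_le.1 hij
  generalize 48 * sabreDelta n 3 / α = w at *
  have hleft : ∀ k, T k = T p → sabreDelta n 4 ≤ blockDist ch A T (T p) p k →
      pos π k < pos π p → pos π k + w ≤ pos π i ∧ pos π k + w ≤ pos π j := by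
    intro k hk hfar hlt
    have := hgap k hk hfar
    rw [abs_of_pos (by linarith)] at this
    constructor <;> linarith [hip'.1, hip'.2, hij'.1, hij'.2]
  have hright : ∀ k, T k = T p → sabreDelta n 4 ≤ blockDist ch A T (T p) p k →
      pos π p < pos π k → pos π i + w ≤ pos π k ∧ pos π j + w ≤ pos π k := by
    intro k hk hfar hlt
    have := hgap k hk hfar
    rw [abs_of_neg (by linarith)] at this
    constructor <;> linarith [hip'.1, hip'.2, hij'.1, hij'.2]
  have hrev : ∀ k, pos (revOrder π) k < pos (revOrder π) p ↔ pos π p < pos π k := by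
    intro k
    rw [pos_revOrder, pos_revOrder]
    constructor <;> intro h' <;> linarith
  have hne : ∀ k, T k = T p → sabreDelta n 4 ≤ blockDist ch A T (T p) p k →
      pos π k < pos π p ∨ pos π p < pos π k := by
    intro k hk hfar
    refine lt_or_gt_of_ne fun he => ?_
    have := hgap k hk hfar
    rw [he, sub_self, abs_zero] at this
    linarith
  have hone : ∀ a k, pos π k + w ≤ pos π a → H a k = 1 := by
    intro a k hak
    rcases hH.cases a k with h0 | ⟨-, h0⟩ | ⟨h0, -⟩
    · refine absurd h0 (hH.ne_zero a k ?_ ?_)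
      · rintro rfl; linarith
      · rw [abs_of_pos (by linarith)]; linarith
    · linarith
    · exact h0
  have hneg : ∀ a k, pos π a + w ≤ pos π k → H a k = -1 := by
    intro a k hak
    rw [hH.antisymm k a, hone k a hak]
  refine ⟨?_, ?_, fun k hk => ?_, fun k hk => ?_⟩
  · ext k
    simp only [contrastSet, sideSet, Finset.mem_filter, Finset.mem_univ, true_and]
    constructor
    · rintro ⟨h1, h2, h3, h4⟩
      refine ⟨h3, h4, (hne k h3 h4).resolve_right fun h5 => ?_⟩
      rw [hneg i k (hright k h3 h4 h5).1] at h1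
      exact absurd h1 (by norm_num)
    · rintro ⟨h1, h2, h3⟩
      exact ⟨hone i k (hleft k h1 h2 h3).1, hone j k (hleft k h1 h2 h3).2, h1, h2⟩
  · ext k
    simp only [contrastSet, sideSet, Finset.mem_filter, Finset.mem_univ, true_and, hrev]
    constructor
    · rintro ⟨h1, h2, h3, h4⟩
      refine ⟨h3, h4, (hne k h3 h4).resolve_left fun h5 => ?_⟩
      rw [hone i k (hleft k h3 h4 h5).1] at h1
      exact absurd h1 (by norm_num)
    · rintro ⟨h1, h2, h3⟩
      exact ⟨hneg i k (hright k h1 h2 h3).1, hneg j k (hright k h1 h2 h3).2, h1, h2⟩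
  · simp only [sideSet, Finset.mem_filter, Finset.mem_univ, true_and] at hk
    have := hleft k hk.1 hk.2.1 hk.2.2
    constructor <;> linarith [this.1, this.2]
  · simp only [sideSet, Finset.mem_filter, Finset.mem_univ, true_and, hrev] at hk
    have := hright k hk.1 hk.2.1 hk.2.2
    constructor <;> linarith [this.1, this.2]

/-- The sign of the comparison of `i` and `j` in the order `π`. -/
def orderSign (π : Equiv.Perm (Fin n)) (i j : Fin n) : ℤ :=
  if pos π i < pos π j then -1 else if pos π j < pos π i then 1 else 0

theorem orderSign_comm (π : Equiv.Perm (Fin n)) (i j : Fin n) :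
    orderSign π j i = -orderSign π i j := by
  simp only [orderSign]
  split_ifs <;> linarith

/-- A contrast that may be wrong by at most `4 s` can pass the threshold `5 s` only with the correct
sign. -/
theorem test_eq_neg_one {l r s τ : ℝ} (hs : 0 < s) (hτ : τ = 5 * s) (hl : -(4 * s) ≤ l)
    (hr : r ≤ 4 * s) :
    ((if τ ≤ |l| then -(SignType.sign l : ℤ) else if τ ≤ |r| then (SignType.sign r : ℤ) else 0) =
      -1) ∨
    ((if τ ≤ |l| then -(SignType.sign l : ℤ) else if τ ≤ |r| then (SignType.sign r : ℤ) else 0) =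
      0 ∧ l < 5 * s ∧ -(5 * s) < r) := by
  subst hτ
  split_ifs with h1 h2
  · left
    have : 0 < l := by
      by_contra! h0
      rw [abs_of_nonpos h0] at h1
      linarith
    rw [sign_pos this]; rfl
  · left
    have : r < 0 := by
      by_contra! h0
      rw [abs_of_nonneg h0] at h2
      linarith
    rw [sign_neg this]; rfl
  · right
    rw [not_le, abs_lt] at h1 h2
    exact ⟨rfl, h1.2, h2.1⟩

/-- The correction is computed for `i < j` as indices, whatever the order of their positions; this
symmetry handles pairs whose positions are reversed. -/
theorem test_neg {l r τ : ℝ} :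
    (if τ ≤ |-l| then -(SignType.sign (-l) : ℤ) else if τ ≤ |-r| then (SignType.sign (-r) : ℤ)
      else 0) =
    -(if τ ≤ |l| then -(SignType.sign l : ℤ) else if τ ≤ |r| then (SignType.sign r : ℤ) else 0) := by
  simp only [abs_neg, Left.sign_neg, SignType.coe_neg]
  split_ifs <;> simp

theorem LargeScales.noiseLevel_pos (h : LargeScales n α β σ κ e) : 0 < noiseLevel n σ :=
  h.α_pos.trans_le h.α_le

theorem LargeScales.correction_spec (h : LargeScales n α β σ κ e)
    (hM : OrderedBiLipschitz π α β M) (hA : A = M + σ • E)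
    (hg : GoodSample ch π M E A T (sabreDelta n 4) e) {H : Fin n → Fin n → ℤ}
    (hH : IsPartialComparison π (48 * sabreDelta n 3 / α) H) {i j : Fin n} (hij : i < j)
    (h0 : H i j = 0) {c : ℤ}
    (hc : c = correction ch H (estimateDistance ch A fun _ => true).val A σ (sabreDelta n 4) T i j) :
    c = orderSign π i j ∨ c = 0 ∧ |pos π i - pos π j| ≤ 117 * noiseLevel n σ / α := by
  obtain ⟨t, ht⟩ : ∃ t, t = ch.block (T i) (T j) := ⟨_, rfl⟩
  have hti : t ≠ T i := ht ▸ ch.block_ne_left _ _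
  have htj : t ≠ T j := ht ▸ ch.block_ne_right _ _
  obtain ⟨hp, hip⟩ := h.anchor_near hM hg t i
  simp only [correction, ← ht, if_pos (And.intro hij h0)] at hc
  generalize anchor ch T (estimateDistance ch A fun _ => true).val t i = p at hp hip hc
  have hnear : |pos π i - pos π j| ≤ 48 * sabreDelta n 3 / α := by
    by_contra! hlt
    exact hH.ne_zero i j hij.ne hlt.le h0
  obtain ⟨e1, e2, hL, hR⟩ := h.contrastSet_eq hM hg hH hp hip hnear
  rw [e1, e2] at hc
  have hTi : T i ≠ T p := by rw [hp]; exact hti.symm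
  have hTj : T j ≠ T p := by rw [hp]; exact htj.symm
  have hs := h.noiseLevel_pos
  have hτ : 5 * σ * √(n * Real.log n) = 5 * noiseLevel n σ := by rw [noiseLevel]; ring
  rcases lt_or_gt_of_ne fun e => hij.ne (pos_injective π e) with hlt | hlt
  · obtain ⟨b1, b2, b3⟩ := h.contrast_bounds hM hA hg hTi hTj hlt rfl rfl
      (fun k hk => (hL k hk).1) fun k hk => (hR k hk).2
    rw [orderSign, if_pos hlt, hc]
    refine (test_eq_neg_one hs hτ b1 b2).imp_right fun h3 => ⟨h3.1, ?_⟩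
    rw [abs_of_neg (by linarith), neg_sub]
    exact b3 h3.2.1 h3.2.2
  · obtain ⟨b1, b2, b3⟩ := h.contrast_bounds hM hA hg hTj hTi hlt rfl rfl
      (fun k hk => (hL k hk).2) fun k hk => (hR k hk).1
    -- Both contrasts change sign when the roles of `i` and `j` are exchanged, which reduces this
    -- case to the previous one.
    rw [rowContrast_comm A _ j i, rowContrast_comm A _ j i, test_neg] at hc
    rw [orderSign, if_neg hlt.not_gt, if_pos hlt, hc, neg_eq_zero, neg_eq_iff_eq_neg]
    refine (test_eq_neg_one hs hτ b1 b2).imp_right fun h3 => ⟨h3.1, ?_⟩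
    rw [abs_of_pos (by linarith)]
    exact b3 h3.2.1 h3.2.2

/-- All entries of the refined comparison matrix are correct, except that close pairs may remain
undecided. -/
theorem LargeScales.reevaluateComparisons_spec (h : LargeScales n α β σ κ e)
    (hM : OrderedBiLipschitz π α β M) (hA : A = M + σ • E)
    (hg : GoodSample ch π M E A T (sabreDelta n 4) e) {H : Fin n → Fin n → ℤ}
    (hH : IsPartialComparison π (48 * sabreDelta n 3 / α) H) {i j : Fin n} (hij : i ≠ j) {c : ℤ}
    (hc : c = (reevaluateComparisons ch H (estimateDistance ch A fun _ => true).val A σ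
      (sabreDelta n 4) T).val i j) :
    c = orderSign π i j ∨ c = 0 ∧ |pos π i - pos π j| ≤ 117 * noiseLevel n σ / α := by
  rw [reevaluateComparisons_val] at hc
  have hsign : H i j ≠ 0 → H i j = orderSign π i j := by
    intro h0
    rw [orderSign]
    rcases hH.cases i j with h1 | ⟨h1, h2⟩ | ⟨h1, h2⟩
    · exact absurd h1 h0
    · rw [if_pos h2, h1]
    · rw [if_neg h2.not_gt, if_pos h2, h1]
  have hzero : ∀ i j, ¬(i < j ∧ H i j = 0) → correction ch H
      (estimateDistance ch A fun _ => true).val A σ (sabreDelta n 4) T i j = 0 :=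
    fun i j h' => if_neg h'
  by_cases h0 : H i j = 0
  · rcases lt_or_gt_of_ne hij with hlt | hlt
    · rw [hzero j i fun h' => h'.1.not_gt hlt, h0, zero_add, sub_zero] at hc
      exact h.correction_spec hM hA hg hH hlt h0 hc
    · rw [hzero i j fun h' => h'.1.not_gt hlt, h0, zero_add, zero_sub] at hc
      have h1 := h.correction_spec hM hA hg hH hlt (by rw [hH.antisymm, h0, neg_zero]) rfl
      rw [hc, orderSign_comm π j i, neg_inj, neg_eq_zero, abs_sub_comm]
      exact h1
  · left
    rw [hzero i j fun h' => h0 h'.2, hzero j i fun h' => h0 (by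
      have := hH.antisymm i j
      rw [h'.2] at this
      linarith)] at hc
    rw [hc, add_zero, sub_zero, hsign h0]

/-- The sum is the number of items before `i` minus the number after it, `π i - (n - 1 - π i)`. -/
theorem sum_orderSign (π : Equiv.Perm (Fin n)) (i : Fin n) :
    ∑ j, orderSign π i j = 2 * ((π i : ℕ) : ℤ) - (n - 1) := by
  have h1 : ∀ j, orderSign π i j = (if (π j : ℕ) < π i then 1 else 0) -
      (if (π i : ℕ) + 1 ≤ π j ∧ (π j : ℕ) < n then 1 else 0) := by
    intro j
    have := (π j).isLt
    simp only [orderSign, pos, Nat.cast_lt]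
    split_ifs <;> omega
  have h2 := card_filter_interval π (a := 0) (b := π i) (π i).isLt.le
  have h3 := card_filter_interval π (a := (π i : ℕ) + 1) (b := n) le_rfl
  simp only [Nat.zero_le, true_and, Nat.sub_zero] at h2
  simp only [h1, Finset.sum_sub_distrib, Finset.sum_boole, h2, h3]
  have := (π i).isLt
  push_cast [Nat.cast_sub (show (π i : ℕ) + 1 ≤ n by omega)]
  ring

theorem card_near_le (π : Equiv.Perm (Fin n)) (i : Fin n) {d : ℝ} (hd : 0 ≤ d) :
    ((Finset.univ.filter fun j => j ≠ i ∧ |pos π i - pos π j| ≤ d).card : ℝ) ≤ 2 * d := by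
  have h1 : (Finset.univ.filter fun j => j ≠ i ∧ |pos π i - pos π j| ≤ d).card ≤
      ((Finset.Icc (((π i : ℕ) : ℤ) - ⌊d⌋₊) ((π i : ℕ) + ⌊d⌋₊)).erase ((π i : ℕ) : ℤ)).card := by
    refine Finset.card_le_card_of_injOn (fun j => ((π j : ℕ) : ℤ)) (fun j hj => ?_) ?_
    · simp only [Finset.coe_filter, Finset.mem_univ, true_and, Set.mem_ofPred_eq] at hj
      have h2 : (((π i : ℕ) : ℤ) - ((π j : ℕ) : ℤ)).natAbs ≤ ⌊d⌋₊ := by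
        refine Nat.le_floor ?_
        rw [Nat.cast_natAbs]
        push_cast
        exact hj.2
      have h3 : (π j : ℕ) ≠ π i := fun h' => hj.1 (π.injective (Fin.ext h'))
      simp only [Finset.coe_erase, Finset.coe_Icc, Set.mem_sdiff, Set.mem_Icc,
        Set.mem_singleton_iff, Nat.cast_inj]
      omega
    · intro j _ j' _ hjj
      exact π.injective (Fin.ext (by simpa using hjj))
  rw [Finset.card_erase_of_mem (by simp), Int.card_Icc] at h1
  have h2 : (Finset.univ.filter fun j => j ≠ i ∧ |pos π i - pos π j| ≤ d).card ≤ 2 * ⌊d⌋₊ := by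
    omega
  have h3 := Nat.floor_le hd
  have h4 : ((Finset.univ.filter fun j => j ≠ i ∧ |pos π i - pos π j| ≤ d).card : ℝ) ≤
      2 * (⌊d⌋₊ : ℝ) := by exact_mod_cast h2
  linarith

/-- Every undecided pair shifts the score by one, and only items within `d` of `i`, at most `2 d` of
them, can be undecided. -/
theorem abs_score_sub_le {K : Fin n → Fin n → ℤ} {d : ℝ} (hd : 0 ≤ d) {i : Fin n}
    (hi : K i i = 0) (hK : ∀ j, i ≠ j → K i j = orderSign π i j ∨
      K i j = 0 ∧ |pos π i - pos π j| ≤ d) :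
    |((∑ j, K i j + n - 1 : ℤ) : ℝ) - 2 * pos π i| ≤ 2 * d := by
  have h1 : ((∑ j, K i j + n - 1 : ℤ) : ℝ) - 2 * pos π i =
      ((∑ j, (K i j - orderSign π i j) : ℤ) : ℝ) := by
    rw [Finset.sum_sub_distrib, sum_orderSign]
    simp only [pos]
    push_cast
    ring
  have h2 : |∑ j, (K i j - orderSign π i j)| ≤
      ((Finset.univ.filter fun j => j ≠ i ∧ |pos π i - pos π j| ≤ d).card : ℤ) := by
    calc |∑ j, (K i j - orderSign π i j)| ≤ ∑ j, |K i j - orderSign π i j| :=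
          Finset.abs_sum_le_sum_abs _ _
      _ ≤ ∑ j, if j ≠ i ∧ |pos π i - pos π j| ≤ d then 1 else 0 := by
          refine Finset.sum_le_sum fun j _ => ?_
          by_cases hij : i = j
          · subst hij
            simp [hi, orderSign]
          · rcases hK j hij with h3 | ⟨h3, h4⟩
            · rw [h3, sub_self, abs_zero]
              split_ifs <;> norm_num
            · rw [if_pos ⟨Ne.symm hij, h4⟩, h3, zero_sub, abs_neg, orderSign]
              split_ifs <;> norm_num
      _ = _ := by rw [Finset.sum_boole]
  rw [h1, ← Int.cast_abs]
  refine le_trans ?_ (card_near_le π i hd)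
  exact_mod_cast h2

/-- Halving the score leaves an error `d`, rounding adds `1 / 2`, and truncation to the range of the
true position cannot increase the error. -/
theorem abs_round_sub_le {s : ℤ} {d : ℝ} {i : Fin n} (hs : |(s : ℝ) - 2 * pos π i| ≤ 2 * d) :
    |(((max 0 (min ((n : ℤ) - 1) (ch.halve s))).toNat : ℕ) : ℝ) - pos π i| ≤ d + 1 / 2 := by
  have hcl : (((max 0 (min ((n : ℤ) - 1) (ch.halve s))).toNat : ℕ) : ℝ) =
      max 0 (min ((n : ℝ) - 1) (ch.halve s)) := by
    have h1 : (((max 0 (min ((n : ℤ) - 1) (ch.halve s))).toNat : ℕ) : ℤ) =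
        max 0 (min ((n : ℤ) - 1) (ch.halve s)) := Int.toNat_of_nonneg (le_max_left _ _)
    have h2 : (((max 0 (min ((n : ℤ) - 1) (ch.halve s))).toNat : ℕ) : ℝ) =
        ((max 0 (min ((n : ℤ) - 1) (ch.halve s)) : ℤ) : ℝ) := by
      rw [← h1]; norm_cast
    rw [h2]
    push_cast
    rfl
  have hh : |2 * (ch.halve s : ℝ) - s| ≤ 1 := by
    have := ch.abs_halve s
    exact_mod_cast this
  have h0 := pos_nonneg π i
  have h1 := pos_le π i
  rw [hcl]
  rw [abs_le] at hs hh ⊢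
  constructor
  · have : pos π i - (d + 1 / 2) ≤ max 0 (min ((n : ℝ) - 1) (ch.halve s)) := by
      by_cases hd : 0 ≤ d + 1 / 2
      · refine le_max_of_le_right (le_min (by linarith) ?_)
        linarith [hs.1, hh.1]
      · exfalso; linarith [hs.1, hs.2, hh.1, hh.2]
    linarith
  · have : max 0 (min ((n : ℝ) - 1) (ch.halve s)) ≤ pos π i + (d + 1 / 2) := by
      refine max_le ?_ ((min_le_right _ _).trans ?_)
      · linarith [hs.1, hs.2, hh.1, hh.2]
      · linarith [hs.2, hh.2]
    linarith

theorem sabre_val (σ : ℝ) (A : Matrix (Fin n) (Fin n) ℝ) (T : Fin n → Fin 3) (i : Fin n) :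
    (((sabre ch σ A T).val i : ℕ) : ℝ) = ((max 0 (min ((n : ℤ) - 1) (ch.halve
      (∑ j, (reevaluateComparisons ch
        (aggregateBisections ch (sabreDelta n 1) (sabreDelta n 2) (sabreDelta n 3)
          (estimateDistance ch A fun _ => true).val).val
        (estimateDistance ch A fun _ => true).val A σ (sabreDelta n 4) T).val i j
        + n - 1)))).toNat : ℕ) := by
  simp only [sabre, val_bind, val_tab, val_op, val_total]
  norm_num

/-- On a good sample, the estimator is close to the true order or to its reversal. -/
theorem LargeScales.sabre_spec (h : LargeScales n α β σ κ e) (hM : OrderedBiLipschitz π α β M)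
    (hA : A = M + σ • E) (hg : GoodSample ch π M E A T (sabreDelta n 4) e) :
    ∃ ρ, (ρ = π ∨ ρ = revOrder π) ∧ ∀ i,
      |(((sabre ch σ A T).val i : ℕ) : ℝ) - pos ρ i| ≤ 117 * noiseLevel n σ / α + 1 / 2 := by
  have hα := h.α_pos
  obtain ⟨h12, h23, h34⟩ := h.delta_mono
  have hδ := h.delta_one_pos
  have hn : 2 * (48 * sabreDelta n 2 / α) + 48 * sabreDelta n 3 / α + 1 ≤ (n : ℝ) / 2 := by
    have h1 := h.δ_le
    have h2 : 48 * sabreDelta n 2 / α ≤ 48 * sabreDelta n 4 / α := by gcongr; linarith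
    have h3 : 48 * sabreDelta n 3 / α ≤ 48 * sabreDelta n 4 / α := by gcongr
    have h4 : (0 : ℝ) ≤ n := Nat.cast_nonneg n
    linarith
  obtain ⟨ρ, hρ, hH⟩ := (h.seriationScales hM hg).aggregateBisections_spec ch hn
  have hMρ : OrderedBiLipschitz ρ α β M := by
    rcases hρ with rfl | rfl
    · exact hM
    · exact hM.reverse
  have hgρ : GoodSample ch ρ M E A T (sabreDelta n 4) e := by
    rcases hρ with rfl | rfl
    · exact hg
    · exact hg.reverse
  refine ⟨ρ, hρ, fun i => ?_⟩
  rw [sabre_val]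
  have hd : 0 ≤ 117 * noiseLevel n σ / α := by
    have := h.noiseLevel_pos
    positivity
  refine abs_round_sub_le (abs_score_sub_le hd ?_ fun j hij =>
    h.reevaluateComparisons_spec hMρ hA hgρ hH hij rfl)
  rw [reevaluateComparisons_val]
  have := hH.antisymm i i
  have h0 : (aggregateBisections ch (sabreDelta n 1) (sabreDelta n 2) (sabreDelta n 3)
    (estimateDistance ch A fun _ => true).val).val i i = 0 := by linarith
  rw [h0]
  ring

/-- Moving the row and then the column index changes an entry by at most `β d / n` each, and there
are `n ^ 2` entries. -/
theorem frobeniusNorm_le {F : Matrix (Fin n) (Fin n) ℝ} (hF : BiLipschitz α β F) (hs : F.IsSymm)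
    (hβ : 0 ≤ β) {p q : Fin n → Fin n} {d : ℝ} (hd : 0 ≤ d)
    (hpq : ∀ i, |((p i : ℕ) : ℝ) - (q i : ℕ)| ≤ d) :
    frobeniusNorm (F.submatrix p p - F.submatrix q q) ≤ 2 * β * d := by
  refine Real.sqrt_le_iff.2 ⟨by positivity, ?_⟩
  have hentry : ∀ i j, (F.submatrix p p - F.submatrix q q) i j ^ 2 ≤ (2 * β * d / n) ^ 2 := by
    intro i j
    rw [← sq_abs]
    refine pow_le_pow_left₀ (abs_nonneg _) ?_ 2
    rw [Matrix.sub_apply, Matrix.submatrix_apply, Matrix.submatrix_apply]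
    have h1 : |F (p i) (p j) - F (q i) (p j)| ≤ β * d / n :=
      (hF.abs_sub_le _ _ _).trans (by gcongr; exact hpq i)
    have h2 : |F (q i) (p j) - F (q i) (q j)| ≤ β * d / n := by
      rw [← hs.apply (q i) (p j), ← hs.apply (q i) (q j)]
      exact (hF.abs_sub_le _ _ _).trans (by gcongr; exact hpq j)
    calc |F (p i) (p j) - F (q i) (q j)|
        ≤ |F (p i) (p j) - F (q i) (p j)| + |F (q i) (p j) - F (q i) (q j)| := abs_sub_le _ _ _
      _ ≤ 2 * β * d / n := by
        rw [mul_assoc, mul_div_assoc]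
        linarith
  calc ∑ i, ∑ j, (F.submatrix p p - F.submatrix q q) i j ^ 2
      ≤ ∑ _i : Fin n, ∑ _j : Fin n, (2 * β * d / n) ^ 2 :=
        Finset.sum_le_sum fun i _ => Finset.sum_le_sum fun j _ => hentry i j
    _ ≤ (2 * β * d) ^ 2 := by
        simp only [Finset.sum_const, Finset.card_univ, Fintype.card_fin, nsmul_eq_mul]
        rcases Nat.eq_zero_or_pos n with hn | hn
        · subst hn
          norm_num
          positivity
        · have : (0 : ℝ) < n := Nat.cast_pos.2 hn
          apply le_of_eq
          field_simp

/-- On a good sample the loss is of the order `σ √(n log n)`. -/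
theorem LargeScales.frobeniusLoss_le {F : Matrix (Fin n) (Fin n) ℝ} (h : LargeScales n α β σ κ e)
    (hF : BiLipschitz α β F) (hs : F.IsSymm) (hA : A = F.submatrix π π + σ • E)
    (hg : GoodSample ch π (F.submatrix π π) E A T (sabreDelta n 4) e) :
    frobeniusLoss F (sabre ch σ A T).val π ≤ 320 * (β * σ / α) * √(n * Real.log n) := by
  have hα := h.α_pos
  have hβ := h.β_pos
  obtain ⟨ρ, hρ, hclose⟩ := h.sabre_spec (hF.ordered hs π) hA hg
  have hd : 0 ≤ 117 * noiseLevel n σ / α + 1 / 2 := by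
    have := h.noiseLevel_pos
    positivity
  have h1 : frobeniusNorm (F.submatrix (sabre ch σ A T).val (sabre ch σ A T).val -
      F.submatrix ρ ρ) ≤ 2 * β * (117 * noiseLevel n σ / α + 1 / 2) :=
    frobeniusNorm_le hF hs hβ.le hd hclose
  have h2 : 2 * β * (117 * noiseLevel n σ / α + 1 / 2) ≤
      320 * (β * σ / α) * √(n * Real.log n) := by
    -- For large `n` the rounding error is at most a multiple of the noise level, so the constant is
    -- at most `2 * 117 + 1 = 235`.
    have h3 : 1 ≤ noiseLevel n σ / α := (one_le_div hα).2 h.α_le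
    calc 2 * β * (117 * noiseLevel n σ / α + 1 / 2)
        = β * (234 * (noiseLevel n σ / α) + 1) := by ring
      _ ≤ β * (320 * (noiseLevel n σ / α)) := by
          gcongr
          linarith
      _ = 320 * (β * σ / α) * √(n * Real.log n) := by rw [noiseLevel]; ring
  refine le_trans ?_ (h1.trans h2)
  rcases hρ with rfl | rfl
  · exact min_le_left _ _
  · exact min_le_right _ _

end Refinement

/-! ### Measurability of the estimated distances -/

section Measurability

variable {n : ℕ} {Ω : Type*} [MeasurableSpace Ω]

theorem measurable_fold_max (s : Finset (Fin n)) {f : Ω → Fin n → ℝ}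
    (hf : ∀ k, Measurable fun x => f x k) : Measurable fun x => s.fold max 0 (f x) := by
  classical
  induction s using Finset.induction_on with
  | empty => simp
  | insert a s ha ih =>
    simp only [Finset.fold_insert ha]
    exact (hf a).max ih

/-- The rule `pick` is arbitrary, but it only sees the set of minimizers. That set takes finitely
many values, each on a set given by finitely many inequalities. -/
theorem measurable_argmin (pick : Finset (Fin n) → Fin n) (cand : Fin n → Bool) (d : Fin n)
    (c₁ c₂ : ℕ) {f : Ω → Fin n → ℝ} (hf : ∀ k, Measurable fun x => f x k) :
    Measurable fun x =>
      ((argmin pick (fun j => op c₁ (cand j)) fun j => op c₂ (f x j)).val).getD d := by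
  have hmem : ∀ j, MeasurableSet {x | j ∈ minimizers cand (f x)} := by
    intro j
    have : {x | j ∈ minimizers cand (f x)} =
        {_x | cand j = true} ∩ ⋂ k, ⋂ (_ : cand k = true), {x | f x j ≤ f x k} := by
      ext x
      simp [minimizers]
    rw [this]
    exact (MeasurableSet.const _).inter (MeasurableSet.iInter fun k =>
      MeasurableSet.iInter fun _ => measurableSet_le (hf j) (hf k))
  have heq : ∀ s : Finset (Fin n), MeasurableSet {x | minimizers cand (f x) = s} := by
    intro s
    have : {x | minimizers cand (f x) = s} = ⋂ j, {x | j ∈ minimizers cand (f x) ↔ j ∈ s} := by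
      ext x
      simp [Finset.ext_iff]
    rw [this]
    refine MeasurableSet.iInter fun j => ?_
    by_cases hj : j ∈ s
    · simpa [hj] using hmem j
    · have : {x | j ∈ minimizers cand (f x) ↔ j ∈ s} = {x | j ∈ minimizers cand (f x)}ᶜ := by
        ext x
        simp [hj]
      rw [this]
      exact (hmem j).compl
  let φ : Finset (Fin n) → Fin n := fun s => (if s.Nonempty then some (pick s) else none).getD d
  have : (fun x => ((argmin pick (fun j => op c₁ (cand j)) fun j => op c₂ (f x j)).val).getD d) =
      fun x => φ (minimizers cand (f x)) := rfl
  rw [this]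
  refine measurable_to_countable' fun m => ?_
  have : (fun x => φ (minimizers cand (f x))) ⁻¹' {m} =
      ⋃ s ∈ {s : Finset (Fin n) | φ s = m}, {x | minimizers cand (f x) = s} := by
    ext x
    simp
  rw [this]
  exact MeasurableSet.biUnion (Set.to_countable _) fun s _ => heq s

theorem measurable_apply_index {g : Ω → Fin n} (hg : Measurable g) {f : Ω → Fin n → ℝ}
    (hf : ∀ k, Measurable fun x => f x k) : Measurable fun x => f x (g x) := by
  have : (fun x => f x (g x)) = fun x => ∑ k, if g x = k then f x k else 0 := by
    ext x; simp
  rw [this]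
  exact Finset.measurable_sum _ fun k _ =>
    Measurable.ite (hg (measurableSet_singleton k)) (hf k) measurable_const

theorem measurable_estimateDistance (ch : SabreChoices n) (S : Fin n → Bool)
    {A : Ω → Matrix (Fin n) (Fin n) ℝ} (hA : ∀ i j, Measurable fun x => A x i j) (i j : Fin n) :
    Measurable fun x => (estimateDistance ch (A x) S).val i j := by
  have hmask : ∀ i k, Measurable fun x => if S i = true ∧ S k = true then A x i k else 0 := by
    intro i k
    split_ifs
    · exact hA i k
    · exact measurable_const
  have hgram : ∀ i j, Measurable fun x => gram (A x) S i j := fun i j =>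
    Finset.measurable_sum _ fun k _ => (hmask i k).mul (hmask j k)
  have hproxy : ∀ i, Measurable fun x => proxy ch S (gram (A x) S) i := by
    intro i
    -- The cost of `largest` is `15 + 1` for each entry; with it the search agrees definitionally
    -- with `proxySearch`.
    refine measurable_argmin ch.pick (fun j => decide (S j = true ∧ j ≠ i)) i 4 (∑ _k : Fin n, 16)
      (f := fun x j => (Finset.univ.fold max 0 fun k =>
        if S k = true ∧ k ≠ i ∧ k ≠ j then |gram (A x) S k i - gram (A x) S k j| else 0))
      fun j => measurable_fold_max _ fun k => ?_
    split_ifs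
    · exact ((hgram k i).sub (hgram k j)).abs
    · exact measurable_const
  simp only [estimateDistance_val]
  split_ifs
  · refine Real.continuous_sqrt.measurable.comp ?_
    exact measurable_const.mul (((measurable_apply_index (hproxy i) (hgram i)).add
      (measurable_apply_index (hproxy j) (hgram j))).sub (measurable_const.mul (hgram i j)))
  · exact measurable_const

/-- Distances on a block use only the entries inside the block; this is what makes them independent
of the other noise entries. -/
theorem estimateDistance_congr (ch : SabreChoices n) {S : Fin n → Bool}
    {A B : Matrix (Fin n) (Fin n) ℝ} (h : ∀ i j, S i = true → S j = true → A i j = B i j) :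
    (estimateDistance ch A S).val = (estimateDistance ch B S).val := by
  have hg : gram A S = gram B S := by
    ext i j
    refine Finset.sum_congr rfl fun k _ => ?_
    have e : ∀ i, (if S i = true ∧ S k = true then A i k else 0) =
        if S i = true ∧ S k = true then B i k else 0 := by
      intro i
      split_ifs with h'
      · exact h i k h'.1 h'.2
      · rfl
    rw [e, e]
  ext i j
  rw [estimateDistance_val, estimateDistance_val, hg]

end Measurability

/-! ### Sub-Gaussian tails and decoupling of the noise -/

section Noise

variable {n : ℕ} {Ω : Type*} [MeasurableSpace Ω] {P : Measure Ω}

/-- A bound for the probability of an event depending on two independent variables, from a bound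
for each value of the first one. -/
theorem measureReal_le_of_indepFun [IsProbabilityMeasure P] {𝒳 𝒴 : Type*} [MeasurableSpace 𝒳]
    [MeasurableSpace 𝒴] {X : Ω → 𝒳} {Y : Ω → 𝒴} (hX : Measurable X) (hY : Measurable Y)
    (hXY : IndepFun X Y P) {B : Set (𝒳 × 𝒴)} (hB : MeasurableSet B) {ε : ℝ} (hε : 0 ≤ ε)
    (h : ∀ x, P.real {ω | (x, Y ω) ∈ B} ≤ ε) : P.real {ω | (X ω, Y ω) ∈ B} ≤ ε := by
  have hPX : IsProbabilityMeasure (P.map X) := Measure.isProbabilityMeasure_map hX.aemeasurable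
  have hPY : IsProbabilityMeasure (P.map Y) := Measure.isProbabilityMeasure_map hY.aemeasurable
  rw [measureReal_def]
  refine ENNReal.toReal_le_of_le_ofReal hε ?_
  have h1 : P {ω | (X ω, Y ω) ∈ B} = P.map (fun ω => (X ω, Y ω)) B :=
    (Measure.map_apply (hX.prodMk hY) hB).symm
  rw [h1, (indepFun_iff_map_prod_eq_prod_map_map hX.aemeasurable hY.aemeasurable).1 hXY,
    Measure.prod_apply hB]
  calc ∫⁻ x, P.map Y (Prod.mk x ⁻¹' B) ∂P.map X ≤ ∫⁻ _, ENNReal.ofReal ε ∂P.map X := by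
        refine lintegral_mono fun x => ?_
        rw [Measure.map_apply hY (measurable_prodMk_left hB)]
        have := h x
        rw [measureReal_def] at this
        exact (ENNReal.le_ofReal_iff_toReal_le (measure_ne_top _ _) hε).2 this
    _ = ENNReal.ofReal ε := by simp

/-- The unordered pair `{i, j}` as an ordered pair. -/
def upperPair (i j : Fin n) : {p : Fin n × Fin n // p.1 ≤ p.2} := ⟨(min i j, max i j), min_le_max⟩

theorem upperPair_eq {i j k l : Fin n} (h : upperPair i j = upperPair k l) :
    (i = k ∧ j = l) ∨ (i = l ∧ j = k) := by
  simp only [upperPair, Subtype.mk.injEq, Prod.mk.injEq] at h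
  grind

theorem upperPair_injective (i : Fin n) : Function.Injective (upperPair i) := by
  intro k l h
  rcases upperPair_eq h with ⟨-, h⟩ | ⟨h1, h2⟩
  · exact h
  · exact h2.trans h1

variable {E : Ω → Matrix (Fin n) (Fin n) ℝ}

theorem IsNoise.apply_upperPair (h : IsNoise E P) (ω : Ω) (i j : Fin n) :
    E ω (upperPair i j).1.1 (upperPair i j).1.2 = E ω i j := by
  rcases le_total i j with hij | hij
  · simp [upperPair, hij]
  · simp only [upperPair, min_eq_right hij, max_eq_left hij]
    exact (h.symm ω).apply i j

/-- The entries of one row sit at distinct places of the upper triangle, so they are independent and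
their variance proxies add up. -/
theorem IsNoise.hasSubgaussianMGF_sum (h : IsNoise E P) (i : Fin n) (R : Finset (Fin n))
    (a : Fin n → ℝ) {V : NNReal} (hV : ∑ k ∈ R, a k ^ 2 ≤ V) :
    HasSubgaussianMGF (fun ω => ∑ k ∈ R, a k * E ω i k) V P := by
  have hind : iIndepFun (fun k ω => a k * E ω i k) P := by
    have h1 := (h.indep.precomp (upperPair_injective i)).comp (fun k x => a k * x)
      fun k => measurable_const.mul measurable_id
    convert h1 using 3 with k ω
    simp only [Function.comp]
    rw [h.apply_upperPair]
  have h2 := HasSubgaussianMGF.sum_of_iIndepFun hind (s := R)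
    (c := fun k => (a k ^ 2).toNNReal) fun k _ => by
      have := (h.subgaussian i k).const_mul (a k)
      convert this using 1
      refine NNReal.eq ?_
      rw [Real.coe_toNNReal _ (sq_nonneg _)]
      exact (mul_one _).symm
  refine ⟨h2.integrable_exp_mul, fun t => (h2.mgf_le t).trans ?_⟩
  have hle : ((∑ k ∈ R, (a k ^ 2).toNNReal : NNReal) : ℝ) ≤ V := ?_
  · gcongr
  refine le_of_eq_of_le ?_ hV
  rw [NNReal.coe_sum]
  exact Finset.sum_congr rfl fun k _ => Real.coe_toNNReal _ (sq_nonneg _)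

theorem IsNoise.tail (h : IsNoise E P) [IsProbabilityMeasure P] (i : Fin n) (R : Finset (Fin n))
    (a : Fin n → ℝ) {V : ℝ} (hV : ∑ k ∈ R, a k ^ 2 ≤ V) {t : ℝ} (ht : 0 ≤ t) :
    P.real {ω | t < |∑ k ∈ R, a k * E ω i k|} ≤ 2 * Real.exp (-t ^ 2 / (2 * V)) := by
  have hV0 : 0 ≤ V := (Finset.sum_nonneg fun k _ => sq_nonneg (a k)).trans hV
  have h1 := h.hasSubgaussianMGF_sum i R a (V := ⟨V, hV0⟩) hV
  have h2 := h1.measure_ge_le ht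
  have h3 := h1.neg.measure_ge_le ht
  calc P.real {ω | t < |∑ k ∈ R, a k * E ω i k|}
      ≤ P.real ({ω | t ≤ ∑ k ∈ R, a k * E ω i k} ∪
          {ω | t ≤ (-fun ω => ∑ k ∈ R, a k * E ω i k) ω}) := by
        refine measureReal_mono fun ω hω => ?_
        rcases lt_abs.1 (show t < |∑ k ∈ R, a k * E ω i k| from hω) with h' | h'
        · exact Or.inl h'.le
        · exact Or.inr h'.le
    _ ≤ _ := measureReal_union_le _ _
    _ ≤ 2 * Real.exp (-t ^ 2 / (2 * V)) := by
        rw [two_mul]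
        exact add_le_add h2 h3

/-- The noise entries indexed by `I`, as a function on all pairs. -/
def noiseOn (E : Ω → Matrix (Fin n) (Fin n) ℝ) (I : Finset {p : Fin n × Fin n // p.1 ≤ p.2})
    (ω : Ω) (p : {p : Fin n × Fin n // p.1 ≤ p.2}) : ℝ := if p ∈ I then E ω p.1.1 p.1.2 else 0

theorem IsNoise.measurable_noiseOn (h : IsNoise E P)
    (I : Finset {p : Fin n × Fin n // p.1 ≤ p.2}) : Measurable (noiseOn E I) := by
  refine measurable_pi_lambda _ fun p => ?_
  unfold noiseOn
  split_ifs
  · exact h.measurable _ _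
  · exact measurable_const

/-- Extending by zero gives the two independent families a common index set, so that the same
formulas apply to both. -/
theorem IsNoise.indepFun_noiseOn (h : IsNoise E P)
    {I J : Finset {p : Fin n × Fin n // p.1 ≤ p.2}} (hIJ : Disjoint I J) :
    IndepFun (noiseOn E I) (noiseOn E J) P := by
  have h1 := h.indep.indepFun_finset I J hIJ fun p => h.measurable _ _
  have hext : ∀ K : Finset {p : Fin n × Fin n // p.1 ≤ p.2},
      Measurable fun (g : K → ℝ) (p : {p : Fin n × Fin n // p.1 ≤ p.2}) =>
        if hp : p ∈ K then g ⟨p, hp⟩ else 0 := by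
    intro K
    refine measurable_pi_lambda _ fun p => ?_
    split_ifs
    · exact measurable_pi_apply _
    · exact measurable_const
  have h2 := h1.comp (hext I) (hext J)
  convert h2 using 1 <;> ext ω p <;> simp [noiseOn]

/-- Concentration of the inner product of two rows of the noise. -/
theorem IsNoise.tail_inner (h : IsNoise E P) [IsProbabilityMeasure P] {i j : Fin n} (hij : i ≠ j)
    {S : Finset (Fin n)} (hS : ∀ k ∈ S, k ≠ i ∧ k ≠ j) {b t : ℝ} (ht : 0 ≤ t) :
    P.real {ω | (∀ k, |E ω i k| ≤ b) ∧ t < |∑ k ∈ S, E ω i k * E ω j k|} ≤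
      2 * Real.exp (-t ^ 2 / (2 * (n * b ^ 2))) := by
  -- The only entry shared by the rows `i` and `j` is the one at `(i, j)`; since `S` avoids both
  -- indices, the two families are disjoint.
  let I := S.image (upperPair i)
  let J := S.image (upperPair j)
  have hI : ∀ ω, ∀ k ∈ S, noiseOn E I ω (upperPair i k) = E ω i k := fun ω k hk => by
    rw [noiseOn, if_pos (Finset.mem_image_of_mem _ hk), h.apply_upperPair]
  have hJ : ∀ ω, ∀ k ∈ S, noiseOn E J ω (upperPair j k) = E ω j k := fun ω k hk => by
    rw [noiseOn, if_pos (Finset.mem_image_of_mem _ hk), h.apply_upperPair]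
  have hdisj : Disjoint I J := by
    rw [Finset.disjoint_left]
    intro p hp hp'
    obtain ⟨k, hk, rfl⟩ := Finset.mem_image.1 hp
    obtain ⟨l, hl, hlk⟩ := Finset.mem_image.1 hp'
    rcases upperPair_eq hlk with ⟨h1, -⟩ | ⟨h1, -⟩
    · exact hij h1.symm
    · exact (hS k hk).2 h1.symm
  let B : Set (({p : Fin n × Fin n // p.1 ≤ p.2} → ℝ) × ({p : Fin n × Fin n // p.1 ≤ p.2} → ℝ)) :=
    (⋂ k ∈ S, {z | |z.1 (upperPair i k)| ≤ b}) ∩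
      {z | t < |∑ k ∈ S, z.1 (upperPair i k) * z.2 (upperPair j k)|}
  have hB : MeasurableSet B := by
    refine (Finset.measurableSet_biInter S fun k _ => ?_).inter ?_
    · exact measurableSet_le (by fun_prop) measurable_const
    · refine measurableSet_lt measurable_const ?_
      have : Measurable fun z : ({p : Fin n × Fin n // p.1 ≤ p.2} → ℝ) ×
          ({p : Fin n × Fin n // p.1 ≤ p.2} → ℝ) =>
          ∑ k ∈ S, z.1 (upperPair i k) * z.2 (upperPair j k) := by fun_prop
      exact this.abs
  refine (measureReal_mono ?_).trans (measureReal_le_of_indepFun (h.measurable_noiseOn I)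
    (h.measurable_noiseOn J) (h.indepFun_noiseOn hdisj) hB (by positivity) fun x => ?_)
  · rintro ω ⟨h1, h2⟩
    refine ⟨?_, ?_⟩
    · simp only [Set.mem_iInter]
      intro k hk
      change |noiseOn E I ω (upperPair i k)| ≤ b
      rw [hI ω k hk]
      exact h1 k
    · change t < |∑ k ∈ S, noiseOn E I ω (upperPair i k) * noiseOn E J ω (upperPair j k)|
      rw [Finset.sum_congr rfl fun k hk => by rw [hI ω k hk, hJ ω k hk]]
      exact h2
  -- With row `i` frozen, the sum is linear in row `j` with squared coefficients adding up to at
  -- most `n b ^ 2`. A frozen row that violates the bound contributes nothing.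
  · by_cases hx : ∀ k ∈ S, |x (upperPair i k)| ≤ b
    · refine (measureReal_mono ?_).trans (h.tail j S (fun k => x (upperPair i k)) ?_ ht)
      · rintro ω ⟨-, h2⟩
        change t < |∑ k ∈ S, x (upperPair i k) * noiseOn E J ω (upperPair j k)| at h2
        rw [Finset.sum_congr rfl fun k hk => by rw [hJ ω k hk]] at h2
        exact h2
      · calc ∑ k ∈ S, x (upperPair i k) ^ 2 ≤ S.card • b ^ 2 := by
              refine Finset.sum_le_card_nsmul _ _ _ fun k hk => ?_
              rw [← sq_abs]
              exact pow_le_pow_left₀ (abs_nonneg _) (hx k hk) 2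
          _ ≤ n * b ^ 2 := by
              rw [nsmul_eq_mul]
              gcongr
              exact (Finset.card_le_univ _).trans_eq (Fintype.card_fin n)
    · have : {ω | (x, noiseOn E J ω) ∈ B} = ∅ := by
        ext ω
        simp only [Set.mem_empty_iff_false, iff_false]
        rintro ⟨h1, -⟩
        simp only [Set.mem_iInter] at h1
        exact hx h1
      rw [this, measureReal_empty]
      positivity

/-- Concentration of the sum of the noise over a set of columns which is selected by the entries
between these columns. -/
theorem IsNoise.tail_sideSet (h : IsNoise E P) [IsProbabilityMeasure P] (ch : SabreChoices n)
    (π : Equiv.Perm (Fin n)) (M : Matrix (Fin n) (Fin n) ℝ) (σ δ₄ : ℝ) (T : Fin n → Fin 3)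
    {i p : Fin n} (hip : T i ≠ T p) {V : ℝ}
    (hV : ((Finset.univ.filter fun k => T k = T p).card : ℝ) ≤ V) {t : ℝ} (ht : 0 ≤ t) :
    P.real {ω | t < |∑ k ∈ sideSet π T (blockDist ch (M + σ • E ω) T) δ₄ p, E ω i k|} ≤
      2 * Real.exp (-t ^ 2 / (2 * V)) := by
  -- The entries in `I`, inside the block of `p`, select the columns; the entries in `J`, between
  -- `i` and that block, are summed. They are disjoint because `i` is outside the block.
  let I : Finset {p : Fin n × Fin n // p.1 ≤ p.2} :=
    Finset.univ.filter fun q => T q.1.1 = T p ∧ T q.1.2 = T p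
  let S := Finset.univ.filter fun k => T k = T p
  let J := S.image (upperPair i)
  let A : ({p : Fin n × Fin n // p.1 ≤ p.2} → ℝ) → Matrix (Fin n) (Fin n) ℝ := fun x =>
    M + σ • Matrix.of fun a b => x (upperPair a b)
  let R : ({p : Fin n × Fin n // p.1 ≤ p.2} → ℝ) → Finset (Fin n) := fun x =>
    sideSet π T (blockDist ch (A x) T) δ₄ p
  have hRS : ∀ x, R x ⊆ S := by
    intro x k hk
    simp only [R, S, sideSet, Finset.mem_filter] at hk ⊢
    exact ⟨hk.1, hk.2.1⟩
  have hR : ∀ ω, R (noiseOn E I ω) = sideSet π T (blockDist ch (M + σ • E ω) T) δ₄ p := by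
    intro ω
    have : blockDist ch (A (noiseOn E I ω)) T (T p) = blockDist ch (M + σ • E ω) T (T p) := by
      refine estimateDistance_congr ch fun a b ha hb => ?_
      have ha' := of_decide_eq_true ha
      have hb' := of_decide_eq_true hb
      have hmem : upperPair a b ∈ I := by
        simp only [I, Finset.mem_filter, Finset.mem_univ, true_and, upperPair]
        rcases le_total a b with hab | hab <;> simp [hab, ha', hb']
      have : noiseOn E I ω (upperPair a b) = E ω a b := by
        rw [noiseOn, if_pos hmem, h.apply_upperPair]
      simp [A, this]
    simp only [R, sideSet, this]
  have hJ : ∀ ω, ∀ k ∈ S, noiseOn E J ω (upperPair i k) = E ω i k := fun ω k hk => by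
    rw [noiseOn, if_pos (Finset.mem_image_of_mem _ hk), h.apply_upperPair]
  have hdisj : Disjoint I J := by
    rw [Finset.disjoint_left]
    intro q hq hq'
    obtain ⟨k, hk, rfl⟩ := Finset.mem_image.1 hq'
    simp only [I, Finset.mem_filter, Finset.mem_univ, true_and, upperPair] at hq
    rcases le_total i k with hik | hik <;> simp [hik] at hq <;> exact hip (by tauto)
  let B : Set (({p : Fin n × Fin n // p.1 ≤ p.2} → ℝ) × ({p : Fin n × Fin n // p.1 ≤ p.2} → ℝ)) :=
    {z | t < |∑ k ∈ R z.1, z.2 (upperPair i k)|}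
  have hB : MeasurableSet B := by
    refine measurableSet_lt measurable_const (Measurable.abs ?_)
    -- A sum over a random set becomes measurable as a fixed sum with indicators.
    have : (fun z : ({p : Fin n × Fin n // p.1 ≤ p.2} → ℝ) ×
        ({p : Fin n × Fin n // p.1 ≤ p.2} → ℝ) => ∑ k ∈ R z.1, z.2 (upperPair i k)) =
        fun z => ∑ k, if T k = T p ∧ δ₄ ≤ blockDist ch (A z.1) T (T p) p k ∧ pos π k < pos π p then
          z.2 (upperPair i k) else 0 := by
      ext z
      rw [← Finset.sum_filter]
      rfl
    rw [this]
    refine Finset.measurable_sum _ fun k _ => Measurable.ite ?_ (by fun_prop) measurable_const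
    refine (MeasurableSet.const _).inter (MeasurableSet.inter ?_ (MeasurableSet.const _))
    have hD : Measurable fun z : ({p : Fin n × Fin n // p.1 ≤ p.2} → ℝ) ×
        ({p : Fin n × Fin n // p.1 ≤ p.2} → ℝ) => blockDist ch (A z.1) T (T p) p k := by
      refine measurable_estimateDistance ch _ (fun a b => ?_) p k
      simp only [A, Matrix.add_apply, Matrix.smul_apply, Matrix.of_apply, smul_eq_mul]
      fun_prop
    exact measurableSet_le measurable_const hD
  refine (measureReal_mono ?_).trans (measureReal_le_of_indepFun (h.measurable_noiseOn I)
    (h.measurable_noiseOn J) (h.indepFun_noiseOn hdisj) hB (by positivity) fun x => ?_)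
  · intro ω hω
    change t < |∑ k ∈ R (noiseOn E I ω), noiseOn E J ω (upperPair i k)|
    rw [Finset.sum_congr rfl fun k hk => hJ ω k (hRS _ hk), hR]
    exact hω
  · refine (measureReal_mono ?_).trans (h.tail i (R x) (fun _ => 1) (V := V) ?_ ht)
    · intro ω hω
      change t < |∑ k ∈ R x, noiseOn E J ω (upperPair i k)| at hω
      rw [Finset.sum_congr rfl fun k hk => hJ ω k (hRS _ hk)] at hω
      change t < |∑ k ∈ R x, 1 * E ω i k|
      simpa using hω
    · simp only [one_pow, Finset.sum_const, nsmul_eq_mul, mul_one]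
      exact (Nat.cast_le.2 (Finset.card_le_card (hRS x))).trans hV

end Noise

/-! ### Density of the random blocks -/

section Partition

variable {n : ℕ}

/-- The balanced partitions as a finite set. -/
def balanced (n : ℕ) : Finset (Fin n → Fin 3) := Finset.univ.filter fun T =>
  ∀ t, ⌊(n : ℝ) / 3⌋₊ ≤ (Finset.univ.filter fun i => T i = t).card ∧
    (Finset.univ.filter fun i => T i = t).card ≤ ⌈(n : ℝ) / 3⌉₊

theorem coe_balanced : (balanced n : Set (Fin n → Fin 3)) = balancedPartitions n := by
  ext T
  simp [balanced, balancedPartitions]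

/-- The balanced partitions whose block `t` avoids `J`. -/
def avoiding (t : Fin 3) (J : Finset (Fin n)) : Finset (Fin n → Fin 3) :=
  (balanced n).filter fun T => ∀ a ∈ J, T a ≠ t

theorem card_comp_swap (T : Fin n → Fin 3) (a b : Fin n) (t : Fin 3) :
    (Finset.univ.filter fun i => T (Equiv.swap a b i) = t).card =
      (Finset.univ.filter fun i => T i = t).card := by
  refine Finset.card_equiv (Equiv.swap a b) fun i => ?_
  simp

theorem swap_mem_avoiding {t : Fin 3} {J : Finset (Fin n)} {a b : Fin n} (ha : a ∉ J) (hb : b ∉ J)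
    {T : Fin n → Fin 3} (hT : T ∈ avoiding t J) :
    (fun i => T (Equiv.swap a b i)) ∈ avoiding t J := by
  simp only [avoiding, balanced, Finset.mem_filter, Finset.mem_univ, true_and,
    card_comp_swap] at hT ⊢
  refine ⟨hT.1, fun i hi => ?_⟩
  rw [Equiv.swap_apply_of_ne_of_ne]
  · exact hT.2 i hi
  · rintro rfl; exact ha hi
  · rintro rfl; exact hb hi

/-- Swapping `a` and `b` preserves balance and does not touch `J`: items outside `J` are
exchangeable even when the block is required to avoid `J`. -/
theorem card_avoiding_filter_eq {t : Fin 3} {J : Finset (Fin n)} {a b : Fin n} (ha : a ∉ J)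
    (hb : b ∉ J) : ((avoiding t J).filter fun T => T a = t).card =
      ((avoiding t J).filter fun T => T b = t).card := by
  refine Finset.card_nbij' (fun T i => T (Equiv.swap a b i)) (fun T i => T (Equiv.swap a b i))
    (fun T hT => ?_) (fun T hT => ?_) (fun T _ => ?_) fun T _ => ?_
  · simp only [Finset.coe_filter, Set.mem_ofPred_eq] at hT ⊢
    exact ⟨swap_mem_avoiding ha hb hT.1, by rw [Equiv.swap_apply_right]; exact hT.2⟩
  · simp only [Finset.coe_filter, Set.mem_ofPred_eq] at hT ⊢
    exact ⟨swap_mem_avoiding ha hb hT.1, by rw [Equiv.swap_apply_left]; exact hT.2⟩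
  · ext i; simp
  · ext i; simp

/-- The block has at least `⌊n / 3⌋ ≥ 3 n / 10` items, none of them in `J`; by exchangeability each
item outside `J` belongs to it with at least the average frequency. -/
theorem le_card_avoiding_filter (hn : 30 ≤ n) {t : Fin 3} {J : Finset (Fin n)} {a : Fin n}
    (ha : a ∉ J) : (3 / 10 : ℝ) * (avoiding t J).card ≤
      ((avoiding t J).filter fun T => T a = t).card := by
  have h1 : ∑ b, ((avoiding t J).filter fun T => T b = t).card ≤
      n * ((avoiding t J).filter fun T => T a = t).card := by
    refine (Finset.sum_le_card_nsmul Finset.univ _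
      ((avoiding t J).filter fun T => T a = t).card fun b _ => ?_).trans_eq (by simp)
    by_cases hb : b ∈ J
    · rw [Finset.filter_eq_empty_iff.2]
      · simp
      · intro T hT
        simp only [avoiding, Finset.mem_filter] at hT
        exact hT.2 b hb
    · exact (card_avoiding_filter_eq hb ha).le
  have h2 : (avoiding t J).card * ⌊(n : ℝ) / 3⌋₊ ≤
      ∑ b, ((avoiding t J).filter fun T => T b = t).card := by
    simp only [Finset.card_filter]
    rw [Finset.sum_comm, ← smul_eq_mul]
    refine Finset.card_nsmul_le_sum _ _ _ fun T hT => ?_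
    simp only [avoiding, balanced, Finset.mem_filter, Finset.mem_univ, true_and] at hT
    rw [← Finset.card_filter]
    exact (hT.1 t).1
  have h3 : ((avoiding t J).card : ℝ) * ⌊(n : ℝ) / 3⌋₊ ≤
      n * ((avoiding t J).filter fun T => T a = t).card := by exact_mod_cast h2.trans h1
  have h4 := Nat.lt_floor_add_one ((n : ℝ) / 3)
  have hn' : (30 : ℝ) ≤ n := by exact_mod_cast hn
  have h5 : 3 / 10 * (n : ℝ) ≤ ⌊(n : ℝ) / 3⌋₊ := by linarith
  have h6 : ((avoiding t J).card : ℝ) * (3 / 10 * n) ≤ (avoiding t J).card * ⌊(n : ℝ) / 3⌋₊ := by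
    gcongr
  refine le_of_mul_le_mul_left ?_ (show (0 : ℝ) < n by linarith)
  linarith

/-- Adding items to `J` one at a time costs a factor at most `7 / 10` each, as if the memberships
were independent. -/
theorem card_avoiding_le (hn : 30 ≤ n) (t : Fin 3) (J : Finset (Fin n)) :
    ((avoiding t J).card : ℝ) ≤ (7 / 10) ^ J.card * (balanced n).card := by
  induction J using Finset.induction_on with
  | empty => simp [avoiding]
  | insert a J ha ih =>
    have h1 := le_card_avoiding_filter hn (t := t) ha
    have h2 : avoiding t (insert a J) = (avoiding t J).filter fun T => ¬ T a = t := by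
      ext T
      simp only [avoiding, Finset.mem_filter, Finset.mem_insert, forall_eq_or_imp]
      tauto
    have h3 := Finset.card_filter_add_card_filter_not (s := avoiding t J) fun T => T a = t
    have h4 : (((avoiding t J).filter fun T => T a = t).card : ℝ) +
        ((avoiding t J).filter fun T => ¬ T a = t).card = (avoiding t J).card := by
      exact_mod_cast h3
    rw [h2, Finset.card_insert_of_notMem ha, pow_succ]
    linarith

/-- The power of two counts the subsets of `I` avoided by the block. Exchanging the sums and
applying the binomial theorem gives `(1 + 7 / 10) ^ I.card`. -/
theorem sum_two_pow_le (hn : 30 ≤ n) (t : Fin 3) (I : Finset (Fin n)) :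
    ∑ T ∈ balanced n, (2 : ℝ) ^ (I.filter fun a => T a ≠ t).card ≤
      (17 / 10) ^ I.card * (balanced n).card := by
  have h1 : ∀ T : Fin n → Fin 3, (2 : ℝ) ^ (I.filter fun a => T a ≠ t).card =
      ∑ J ∈ I.powerset, if ∀ a ∈ J, T a ≠ t then 1 else 0 := by
    intro T
    rw [Finset.sum_boole]
    have : (I.powerset.filter fun J => ∀ a ∈ J, T a ≠ t) =
        (I.filter fun a => T a ≠ t).powerset := by
      ext J
      simp only [Finset.mem_filter, Finset.mem_powerset, Finset.subset_iff]
      exact ⟨fun h a ha => ⟨h.1 ha, h.2 a ha⟩, fun h => ⟨fun a ha => (h ha).1, fun a ha => (h ha).2⟩⟩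
    rw [this, Finset.card_powerset]
    push_cast
    rfl
  simp only [h1]
  rw [Finset.sum_comm]
  have h2 : ∀ J : Finset (Fin n), (∑ T ∈ balanced n, if ∀ a ∈ J, T a ≠ t then (1 : ℝ) else 0) =
      (avoiding t J).card := fun J => by rw [Finset.sum_boole]; rfl
  simp only [h2]
  calc ∑ J ∈ I.powerset, ((avoiding t J).card : ℝ)
      ≤ ∑ J ∈ I.powerset, (7 / 10) ^ J.card * 1 ^ (I.card - J.card) * ((balanced n).card : ℝ) := by
        refine Finset.sum_le_sum fun J _ => ?_
        rw [one_pow, mul_one]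
        exact card_avoiding_le hn t J
    _ = (17 / 10) ^ I.card * (balanced n).card := by
        rw [← Finset.sum_mul, Finset.sum_pow_mul_eq_add_pow]
        norm_num

/-- Few balanced partitions have an atypically small block on `I`. -/
theorem card_sparse_le (hn : 30 ≤ n) (t : Fin 3) (I : Finset (Fin n)) :
    (((balanced n).filter fun T => 5 * I.card ≤ 6 * (I.filter fun a => T a ≠ t).card).card : ℝ) ≤
      (85 / 89) ^ I.card * (balanced n).card := by
  set B := (balanced n).filter fun T => 5 * I.card ≤ 6 * (I.filter fun a => T a ≠ t).card
  have h1 : ∀ T ∈ B, (89 / 50 : ℝ) ^ I.card ≤ 2 ^ (I.filter fun a => T a ≠ t).card := by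
    intro T hT
    -- Markov's inequality at level `2 ^ (5 / 6)` per item; `89 / 50` is a rational lower bound
    -- because `(89 / 50) ^ 6 ≤ 2 ^ 5`, and it still exceeds `17 / 10`.
    rw [← pow_le_pow_iff_left₀ (by positivity) (by positivity) (show (6 : ℕ) ≠ 0 by norm_num),
      ← pow_mul, ← pow_mul, mul_comm I.card 6, pow_mul]
    calc ((89 / 50 : ℝ) ^ 6) ^ I.card ≤ (2 ^ 5) ^ I.card := by
          gcongr
          norm_num
      _ = 2 ^ (5 * I.card) := by rw [pow_mul]
      _ ≤ _ := by
          refine pow_le_pow_right₀ (by norm_num) ?_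
          rw [mul_comm _ 6]
          exact (Finset.mem_filter.1 hT).2
  have h2 : (B.card : ℝ) * (89 / 50) ^ I.card ≤ (17 / 10) ^ I.card * (balanced n).card := by
    calc (B.card : ℝ) * (89 / 50) ^ I.card = B.card • ((89 / 50 : ℝ) ^ I.card) := by
          rw [nsmul_eq_mul]
      _ ≤ ∑ T ∈ B, (2 : ℝ) ^ (I.filter fun a => T a ≠ t).card :=
          Finset.card_nsmul_le_sum _ _ _ h1
      _ ≤ ∑ T ∈ balanced n, (2 : ℝ) ^ (I.filter fun a => T a ≠ t).card :=
          Finset.sum_le_sum_of_subset_of_nonneg (Finset.filter_subset _ _)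
            fun _ _ _ => by positivity
      _ ≤ _ := sum_two_pow_le hn t I
  have h3 : (85 / 89 : ℝ) ^ I.card * (89 / 50) ^ I.card = (17 / 10) ^ I.card := by
    rw [← mul_pow]; norm_num
  refine le_of_mul_le_mul_right ?_ (show (0 : ℝ) < (89 / 50) ^ I.card by positivity)
  rw [← h3] at h2
  linarith

variable {Ω : Type*} [MeasurableSpace Ω] {P : Measure Ω} {T : Ω → Fin n → Fin 3}

theorem prob_partition_eq (hT : Measurable T) (hmap : P.map T = uniformOn (balancedPartitions n))
    (B : Finset (Fin n → Fin 3)) :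
    P.real {ω | T ω ∈ B} = ((balanced n ∩ B).card : ℝ) / (balanced n).card := by
  classical
  have h1 : P {ω | T ω ∈ B} = P.map T (B : Set (Fin n → Fin 3)) :=
    (Measure.map_apply hT B.measurableSet).symm
  rw [measureReal_def, h1, hmap, ← coe_balanced, uniformOn_apply_finset, ENNReal.toReal_div]
  simp

theorem prob_sparse_le (hn : 30 ≤ n) (hT : Measurable T)
    (hmap : P.map T = uniformOn (balancedPartitions n)) (t : Fin 3) (I : Finset (Fin n)) :
    P.real {ω | 5 * I.card ≤ 6 * (I.filter fun a => T ω a ≠ t).card} ≤ (85 / 89) ^ I.card := by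
  have h1 := prob_partition_eq hT hmap
    (Finset.univ.filter fun T => 5 * I.card ≤ 6 * (I.filter fun a => T a ≠ t).card)
  simp only [Finset.mem_filter, Finset.mem_univ, true_and] at h1
  rw [h1]
  have h2 : balanced n ∩ (Finset.univ.filter fun T : Fin n → Fin 3 =>
      5 * I.card ≤ 6 * (I.filter fun a => T a ≠ t).card) =
      (balanced n).filter fun T => 5 * I.card ≤ 6 * (I.filter fun a => T a ≠ t).card := by
    ext T; simp
  rw [h2]
  exact div_le_of_le_mul₀ (Nat.cast_nonneg _) (by positivity) (card_sparse_le hn t I)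

theorem prob_not_balanced (hT : Measurable T)
    (hmap : P.map T = uniformOn (balancedPartitions n)) : P.real {ω | T ω ∉ balanced n} = 0 := by
  have h1 := prob_partition_eq hT hmap (balanced n)ᶜ
  simp only [Finset.mem_compl] at h1
  rw [h1]
  simp

/-- Union bound over blocks and intervals. A block holding less than a sixth of an interval misses
more than five sixths of it, and the interval has at least `⌈√n⌉` positions. -/
theorem prob_not_dense_le [IsProbabilityMeasure P] (hn : 30 ≤ n) (hT : Measurable T)
    (hmap : P.map T = uniformOn (balancedPartitions n)) (π : Equiv.Perm (Fin n)) :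
    P.real {ω | ¬ ∀ t, IsDense π fun i => decide (T ω i = t)} ≤
      3 * ((n : ℝ) + 1) ^ 2 * (85 / 89) ^ ⌈√(n : ℝ)⌉₊ := by
  let Q : Finset (Fin 3 × ℕ × ℕ) :=
    (Finset.univ ×ˢ Finset.range (n + 1) ×ˢ Finset.range (n + 1)).filter fun q =>
      q.2.1 ≤ q.2.2 ∧ √(n : ℝ) ≤ (q.2.2 : ℝ) - q.2.1
  let I : Fin 3 × ℕ × ℕ → Finset (Fin n) := fun q =>
    Finset.univ.filter fun k => q.2.1 ≤ (π k : ℕ) ∧ (π k : ℕ) < q.2.2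
  have hI : ∀ q ∈ Q, (I q).card = q.2.2 - q.2.1 := fun q hq => by
    simp only [Q, Finset.mem_filter, Finset.mem_product, Finset.mem_range] at hq
    exact card_filter_interval π (by omega)
  have hsub : {ω | ¬ ∀ t, IsDense π fun i => decide (T ω i = t)} ⊆
      ⋃ q ∈ Q, {ω | 5 * (I q).card ≤ 6 * ((I q).filter fun a => T ω a ≠ q.1).card} := by
    intro ω hω
    have hω' : ¬ ∀ t, IsDense π fun i => decide (T ω i = t) := hω
    simp only [IsDense] at hω'
    push Not at hω'
    obtain ⟨t, a, b, hab, hbn, hsq, hlt⟩ := hω'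
    have hq : (t, a, b) ∈ Q := by
      simp only [Q, Finset.mem_filter, Finset.mem_product, Finset.mem_range, Finset.mem_univ,
        true_and]
      exact ⟨⟨by omega, by omega⟩, hab, hsq⟩
    simp only [Set.mem_iUnion]
    refine ⟨(t, a, b), hq, ?_⟩
    change 5 * (I (t, a, b)).card ≤ 6 * ((I (t, a, b)).filter fun a => T ω a ≠ t).card
    have h1 := Finset.card_filter_add_card_filter_not (s := I (t, a, b)) fun k => T ω k = t
    have h2 : ((I (t, a, b)).filter fun k => T ω k = t) = Finset.univ.filter fun k =>
        decide (T ω k = t) = true ∧ a ≤ (π k : ℕ) ∧ (π k : ℕ) < b := by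
      ext k
      simp only [I, Finset.mem_filter, Finset.mem_univ, true_and, decide_eq_true_eq]
      tauto
    rw [← h2] at hlt
    have h3 : (((I (t, a, b)).filter fun k => T ω k = t).card : ℝ) * 6 < (b - a : ℕ) := by
      rw [Nat.cast_sub hab]; linarith
    have h4 : ((I (t, a, b)).filter fun k => T ω k = t).card * 6 < b - a := by exact_mod_cast h3
    have h5 := hI _ hq
    simp only at h5
    simp only [ne_eq]
    omega
  calc P.real {ω | ¬ ∀ t, IsDense π fun i => decide (T ω i = t)}
      ≤ P.real (⋃ q ∈ Q, {ω | 5 * (I q).card ≤ 6 * ((I q).filter fun a => T ω a ≠ q.1).card}) :=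
        measureReal_mono hsub (measure_ne_top _ _)
    _ ≤ ∑ q ∈ Q, P.real {ω | 5 * (I q).card ≤ 6 * ((I q).filter fun a => T ω a ≠ q.1).card} :=
        measureReal_biUnion_finset_le _ _
    _ ≤ Q.card • (85 / 89 : ℝ) ^ ⌈√(n : ℝ)⌉₊ := by
        refine Finset.sum_le_card_nsmul _ _ _ fun q hq => ?_
        refine (prob_sparse_le hn hT hmap q.1 (I q)).trans ?_
        refine pow_le_pow_of_le_one (by norm_num) (by norm_num) ?_
        rw [hI q hq, Nat.ceil_le]
        simp only [Q, Finset.mem_filter] at hq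
        rw [Nat.cast_sub hq.2.1]
        exact hq.2.2
    _ ≤ 3 * ((n : ℝ) + 1) ^ 2 * (85 / 89) ^ ⌈√(n : ℝ)⌉₊ := by
        rw [nsmul_eq_mul]
        refine mul_le_mul_of_nonneg_right ?_ (by positivity)
        have h1 : Q.card ≤ 3 * (n + 1) ^ 2 := by
          refine (Finset.card_filter_le _ _).trans_eq ?_
          simp only [Finset.card_product, Finset.card_univ, Fintype.card_fin, Finset.card_range]
          ring
        exact_mod_cast h1

end Partition

/-! ### The good event and its probability -/

section Concentration

variable {n : ℕ}

/-- The column sets used by the algorithm: all items, or one block. -/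
def columnSet (T : Fin n → Fin 3) : Option (Fin 3) → Fin n → Bool
  | none => fun _ => true
  | some t => fun i => decide (T i = t)

/-- The sum of `E i k` over the far side set of `p` is too large. -/
def SideFailure (ch : SabreChoices n) (π : Equiv.Perm (Fin n)) (M : Matrix (Fin n) (Fin n) ℝ)
    (σ δ₄ : ℝ) (T : Fin n → Fin 3) (E : Matrix (Fin n) (Fin n) ℝ) (q : Fin n × Fin n) : Prop :=
  T q.1 ≠ T q.2 ∧ 2 * √(n * Real.log n) <
    |∑ k ∈ sideSet π T (blockDist ch (M + σ • E) T) δ₄ q.2, E q.1 k|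

/-- Some entry of the noise is too large. -/
def EntryFailure (E : Matrix (Fin n) (Fin n) ℝ) (q : Fin n × Fin n) : Prop :=
  4 * √(Real.log n) < |E q.1 q.2|

/-- The inner product of a row of `M` and a row of the noise is too large. -/
def LinearFailure (M : Matrix (Fin n) (Fin n) ℝ) (T : Fin n → Fin 3)
    (E : Matrix (Fin n) (Fin n) ℝ) (q : Option (Fin 3) × Fin n × Fin n) : Prop :=
  4 * √(n * Real.log n) < |∑ k ∈ members (columnSet T q.1), M q.2.2 k * E q.2.1 k|

/-- The inner product of two rows of the noise is too large. -/
def InnerFailure (T : Fin n → Fin 3) (E : Matrix (Fin n) (Fin n) ℝ)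
    (q : Option (Fin 3) × Fin n × Fin n) : Prop :=
  q.2.1 ≠ q.2.2 ∧ (∀ k, |E q.2.1 k| ≤ 4 * √(Real.log n)) ∧ 16 * (√(n : ℝ) * Real.log n) <
    |∑ k ∈ (members (columnSet T q.1)).filter fun k => k ≠ q.2.1 ∧ k ≠ q.2.2,
      E q.2.1 k * E q.2.2 k|

/-- One of the concentration bounds fails. -/
def Failure (ch : SabreChoices n) (π : Equiv.Perm (Fin n)) (M : Matrix (Fin n) (Fin n) ℝ)
    (σ δ₄ : ℝ) (T : Fin n → Fin 3) (E : Matrix (Fin n) (Fin n) ℝ) : Prop :=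
  (∃ q, EntryFailure E q) ∨ (∃ q, LinearFailure M T E q) ∨ (∃ q, InnerFailure T E q) ∨
    (∃ q, SideFailure ch π M σ δ₄ T E q) ∨ ∃ q, SideFailure ch (revOrder π) M σ δ₄ T E q

/-- The deviation of the inner products of the rows. -/
def innerError (n : ℕ) (σ : ℝ) : ℝ := (8 * σ + 48 * σ ^ 2) * (√(n : ℝ) * Real.log n)

/-- Splits off the two columns where the symmetric noise couples the rows `i` and `j`. -/
theorem sum_eq_add_filter_ne (S : Finset (Fin n)) {i j : Fin n} (hij : i ≠ j) (f : Fin n → ℝ) :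
    ∑ k ∈ S, f k = ∑ k ∈ S.filter (fun k => k ≠ i ∧ k ≠ j), f k +
      ((if i ∈ S then f i else 0) + if j ∈ S then f j else 0) := by
  rw [← Finset.sum_filter_add_sum_filter_not S fun k => k ≠ i ∧ k ≠ j]
  congr 1
  rw [← Finset.sum_ite_eq' S i f, ← Finset.sum_ite_eq' S j f, ← Finset.sum_add_distrib,
    Finset.sum_filter]
  refine Finset.sum_congr rfl fun k _ => ?_
  by_cases hi : k = i
  · subst hi; simp [hij]
  · by_cases hj : k = j
    · subst hj; simp [hi]
    · simp [hi, hj]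

/-- Expanding the noisy inner product leaves two linear terms, `2 * 4 = 8`, and a quadratic one:
`16` for the decoupled sum and `16` for each of the two columns split off, which are controlled by
the entrywise bound. -/
theorem goodSample_of_not_failure {ch : SabreChoices n} {π : Equiv.Perm (Fin n)}
    {M E : Matrix (Fin n) (Fin n) ℝ} {σ δ₄ : ℝ} {T : Fin n → Fin 3} (hσ : 0 < σ)
    (hlog : 1 ≤ Real.log n) (hd : ∀ t, IsDense π fun i => decide (T i = t))
    (h : ¬ Failure ch π M σ δ₄ T E) :
    GoodSample ch π M E (M + σ • E) T δ₄ (innerError n σ) := by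
  simp only [Failure, not_or, not_exists] at h
  obtain ⟨h0, h1, h2, h3, h4⟩ := h
  have hn0 : (0 : ℝ) ≤ n := Nat.cast_nonneg n
  have hn1 : (1 : ℝ) ≤ √(n : ℝ) := by
    refine Real.one_le_sqrt.2 ?_
    have : n ≠ 0 := by
      rintro rfl
      norm_num at hlog
    exact_mod_cast Nat.one_le_iff_ne_zero.2 this
  refine ⟨hd, fun S hS i j hij => ?_, fun i p hip => ?_, fun i p hip => ?_⟩
  · obtain ⟨o, rfl⟩ : ∃ o, S = columnSet T o := by
      rcases hS with rfl | ⟨t, rfl⟩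
      · exact ⟨none, rfl⟩
      · exact ⟨some t, rfl⟩
    have hent : ∀ k l, |E k l| ≤ 4 * √(Real.log n) := fun k l => not_lt.1 (h0 (k, l))
    have hlin : ∀ k l, |∑ m ∈ members (columnSet T o), M l m * E k m| ≤ 4 * √(n * Real.log n) :=
      fun k l => not_lt.1 (h1 (o, k, l))
    have hin : |∑ k ∈ (members (columnSet T o)).filter fun k => k ≠ i ∧ k ≠ j, E i k * E j k| ≤
        16 * (√(n : ℝ) * Real.log n) := by
      by_contra! hlt
      exact h2 (o, i, j) ⟨hij, hent i, hlt⟩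
    have hprod : ∀ k, |if k ∈ members (columnSet T o) then E i k * E j k else 0| ≤
        16 * (√(n : ℝ) * Real.log n) := by
      intro k
      have h5 : |E i k * E j k| ≤ 16 * Real.log n := by
        rw [abs_mul]
        calc |E i k| * |E j k| ≤ (4 * √(Real.log n)) * (4 * √(Real.log n)) := by
              gcongr
              · exact hent i k
              · exact hent j k
          _ = 16 * Real.log n := by
              rw [mul_mul_mul_comm, Real.mul_self_sqrt (by linarith)]
              norm_num
      split_ifs
      · refine h5.trans ?_
        nlinarith
      · rw [abs_zero]; positivity
    have hquad : |∑ k ∈ members (columnSet T o), E i k * E j k| ≤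
        48 * (√(n : ℝ) * Real.log n) := by
      rw [sum_eq_add_filter_ne _ hij fun k => E i k * E j k]
      have h5 := hprod i
      have h6 := hprod j
      rw [abs_le] at hin h5 h6 ⊢
      constructor <;> linarith [hin.1, hin.2, h5.1, h5.2, h6.1, h6.2]
    have hsq : √(n * Real.log n) ≤ √(n : ℝ) * Real.log n := by
      rw [Real.sqrt_mul hn0]
      gcongr
      exact Real.sqrt_le_iff.2 ⟨by linarith, by nlinarith⟩
    have hexp : rowInner (columnSet T o) (M + σ • E) i j - rowInner (columnSet T o) M i j =
        σ * (∑ k ∈ members (columnSet T o), M i k * E j k +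
          ∑ k ∈ members (columnSet T o), M j k * E i k) +
        σ ^ 2 * ∑ k ∈ members (columnSet T o), E i k * E j k := by
      simp only [rowInner, Finset.mul_sum, ← Finset.sum_add_distrib, ← Finset.sum_sub_distrib]
      refine Finset.sum_congr rfl fun k _ => ?_
      simp only [Matrix.add_apply, Matrix.smul_apply, smul_eq_mul]
      ring
    have h5 := hlin j i
    have h6 := hlin i j
    rw [hexp]
    calc |σ * (∑ k ∈ members (columnSet T o), M i k * E j k +
          ∑ k ∈ members (columnSet T o), M j k * E i k) +
        σ ^ 2 * ∑ k ∈ members (columnSet T o), E i k * E j k|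
        ≤ σ * |∑ k ∈ members (columnSet T o), M i k * E j k +
          ∑ k ∈ members (columnSet T o), M j k * E i k| +
        σ ^ 2 * |∑ k ∈ members (columnSet T o), E i k * E j k| := by
          refine (abs_add_le _ _).trans ?_
          rw [abs_mul, abs_mul, abs_of_pos hσ, abs_of_nonneg (sq_nonneg σ)]
      _ ≤ σ * (8 * (√(n : ℝ) * Real.log n)) + σ ^ 2 * (48 * (√(n : ℝ) * Real.log n)) := by
          gcongr
          refine (abs_add_le _ _).trans ?_
          linarith
      _ = innerError n σ := by rw [innerError]; ring
  · by_contra! hlt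
    exact h3 (i, p) ⟨hip, hlt⟩
  · by_contra! hlt
    exact h4 (i, p) ⟨hip, hlt⟩

/-- Needed to integrate over the partition in `measureReal_le_of_indepFun`. -/
theorem measurableSet_failure (ch : SabreChoices n) (π : Equiv.Perm (Fin n))
    (M : Matrix (Fin n) (Fin n) ℝ) (σ δ₄ : ℝ) (T : Fin n → Fin 3) :
    MeasurableSet {x : Fin n → Fin n → ℝ | Failure ch π M σ δ₄ T (Matrix.of x)} := by
  have hent : ∀ i j, Measurable fun x : Fin n → Fin n → ℝ => Matrix.of x i j := fun i j => by
    simp only [Matrix.of_apply]; fun_prop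
  have hlt : ∀ (c : ℝ) {f : (Fin n → Fin n → ℝ) → ℝ}, Measurable f →
      MeasurableSet {x | c < |f x|} := fun c f hf => measurableSet_lt measurable_const hf.abs
  have hside : ∀ (ρ : Equiv.Perm (Fin n)) (q : Fin n × Fin n),
      MeasurableSet {x : Fin n → Fin n → ℝ | SideFailure ch ρ M σ δ₄ T (Matrix.of x) q} := by
    intro ρ q
    refine (MeasurableSet.const _).inter (hlt _ ?_)
    simp only [sideSet, Finset.sum_filter]
    refine Finset.measurable_sum _ fun k _ => Measurable.ite ?_ (hent _ _) measurable_const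
    refine (MeasurableSet.const _).inter (MeasurableSet.inter ?_ (MeasurableSet.const _))
    have hD : Measurable fun x : Fin n → Fin n → ℝ =>
        blockDist ch (M + σ • Matrix.of x) T (T q.2) q.2 k := by
      refine measurable_estimateDistance ch _ (fun a b => ?_) q.2 k
      simp only [Matrix.add_apply, Matrix.smul_apply, Matrix.of_apply, smul_eq_mul]
      fun_prop
    exact measurableSet_le measurable_const hD
  have hlin : ∀ q : Option (Fin 3) × Fin n × Fin n,
      MeasurableSet {x : Fin n → Fin n → ℝ | LinearFailure M T (Matrix.of x) q} := fun q =>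
    hlt _ (Finset.measurable_sum _ fun k _ => measurable_const.mul (hent _ _))
  have hin : ∀ q : Option (Fin 3) × Fin n × Fin n,
      MeasurableSet {x : Fin n → Fin n → ℝ | InnerFailure T (Matrix.of x) q} := by
    intro q
    refine (MeasurableSet.const _).inter (MeasurableSet.inter ?_
      (hlt _ (Finset.measurable_sum _ fun k _ => (hent _ _).mul (hent _ _))))
    exact measurableSet_setOfPred.2 (Measurable.forall fun k => measurableSet_setOfPred.1
      (measurableSet_le (hent _ _).abs measurable_const))
  have hex : ∀ {ι : Type} [Countable ι] {p : ι → (Fin n → Fin n → ℝ) → Prop},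
      (∀ q, MeasurableSet {x | p q x}) → MeasurableSet {x | ∃ q, p q x} := fun h =>
    measurableSet_setOfPred.2 (Measurable.exists fun q => measurableSet_setOfPred.1 (h q))
  exact (hex fun q => hlt _ (hent _ _)).union ((hex hlin).union ((hex hin).union
    ((hex (hside π)).union (hex (hside (revOrder π))))))

variable {Ω : Type*} [MeasurableSpace Ω] {P : Measure Ω}

theorem measureReal_exists_le [IsFiniteMeasure P] {ι : Type*} [Fintype ι] {p : ι → Ω → Prop}
    {ε : ℝ} (h : ∀ i, P.real {ω | p i ω} ≤ ε) :
    P.real {ω | ∃ i, p i ω} ≤ Fintype.card ι * ε := by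
  rw [Set.ofPred_exists]
  refine (measureReal_iUnion_fintype_le _).trans ?_
  refine (Finset.sum_le_card_nsmul Finset.univ _ ε fun i _ => h i).trans_eq ?_
  rw [nsmul_eq_mul, Finset.card_univ]

theorem exp_le_of_le {x y : ℝ} (h : x ≤ y) : 2 * Real.exp x ≤ 2 * Real.exp y := by
  gcongr

variable {E : Ω → Matrix (Fin n) (Fin n) ℝ}

/-- Single events fail with probability at most `2 * n ^ (-5)`: the exponents are `8 log n`, except
for the side sums, where a block of at most `2 n / 5` items gives `5 log n`. With four column sets
there are `(1 + 4 + 4 + 1 + 1) * n ^ 2` events. -/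
theorem IsNoise.prob_failure_le (h : IsNoise E P) [IsProbabilityMeasure P] (ch : SabreChoices n)
    (π : Equiv.Perm (Fin n)) {M : Matrix (Fin n) (Fin n) ℝ} (hM : ∀ i j, M i j ^ 2 ≤ 1)
    (σ δ₄ : ℝ) {T : Fin n → Fin 3} (hT : T ∈ balanced n) (hn : 15 ≤ n) (hlog : 1 ≤ Real.log n) :
    P.real {ω | Failure ch π M σ δ₄ T (E ω)} ≤
      22 * (n : ℝ) ^ 2 * Real.exp (-5 * Real.log n) := by
  have hn0 : (15 : ℝ) ≤ n := by exact_mod_cast hn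
  have hnpos : (0 : ℝ) < n := by linarith
  have hL : 0 < Real.log n := by linarith
  have hsL : √(Real.log n) ^ 2 = Real.log n := Real.sq_sqrt hL.le
  have hsn : √(n : ℝ) ^ 2 = n := Real.sq_sqrt hnpos.le
  have hsnL : √(n * Real.log n) ^ 2 = n * Real.log n := Real.sq_sqrt (by positivity)
  have h8 : -8 * Real.log n ≤ -5 * Real.log n := by linarith
  have hentry : ∀ q : Fin n × Fin n, P.real {ω | EntryFailure (E ω) q} ≤
      2 * Real.exp (-5 * Real.log n) := by
    intro q
    refine le_trans (le_of_eq ?_) ((h.tail q.1 {q.2} (fun _ => 1) (V := 1)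
      (t := 4 * √(Real.log n)) (by simp) (by positivity)).trans (exp_le_of_le ?_))
    · simp [EntryFailure]
    · rw [mul_pow, hsL]
      linarith
  have hlin : ∀ q : Option (Fin 3) × Fin n × Fin n, P.real {ω | LinearFailure M T (E ω) q} ≤
      2 * Real.exp (-5 * Real.log n) := by
    intro q
    refine (h.tail q.2.1 (members (columnSet T q.1)) (fun k => M q.2.2 k) (V := n)
      (t := 4 * √(n * Real.log n)) ?_ (by positivity)).trans (exp_le_of_le ?_)
    · refine (Finset.sum_le_card_nsmul _ _ 1 fun k _ => hM _ _).trans ?_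
      rw [nsmul_eq_mul, mul_one]
      exact_mod_cast (Finset.card_le_univ _).trans_eq (Fintype.card_fin n)
    · refine le_of_eq_of_le ?_ h8
      rw [mul_pow, hsnL]
      field_simp
      norm_num
  have hin : ∀ q : Option (Fin 3) × Fin n × Fin n, P.real {ω | InnerFailure T (E ω) q} ≤
      2 * Real.exp (-5 * Real.log n) := by
    intro q
    by_cases hq : q.2.1 = q.2.2
    · have : {ω | InnerFailure T (E ω) q} = ∅ := by
        ext ω
        simp [InnerFailure, hq]
      rw [this, measureReal_empty]
      positivity
    · refine (measureReal_mono ?_).trans ((h.tail_inner hq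
        (S := (members (columnSet T q.1)).filter fun k => k ≠ q.2.1 ∧ k ≠ q.2.2)
        (fun k hk => (Finset.mem_filter.1 hk).2) (b := 4 * √(Real.log n))
        (t := 16 * (√(n : ℝ) * Real.log n)) (by positivity)).trans (exp_le_of_le ?_))
      · rintro ω ⟨-, h1, h2⟩
        exact ⟨h1, h2⟩
      · refine le_of_eq_of_le ?_ h8
        rw [mul_pow, mul_pow, mul_pow, hsL, hsn]
        field_simp
        norm_num
  have hside : ∀ (ρ : Equiv.Perm (Fin n)) (q : Fin n × Fin n),
      P.real {ω | SideFailure ch ρ M σ δ₄ T (E ω) q} ≤ 2 * Real.exp (-5 * Real.log n) := by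
    intro ρ q
    by_cases hq : T q.1 = T q.2
    · have : {ω | SideFailure ch ρ M σ δ₄ T (E ω) q} = ∅ := by
        ext ω
        simp [SideFailure, hq]
      rw [this, measureReal_empty]
      positivity
    · refine (measureReal_mono ?_).trans ((h.tail_sideSet ch ρ M σ δ₄ T hq (V := 2 / 5 * n)
        (t := 2 * √(n * Real.log n)) ?_ (by positivity)).trans (exp_le_of_le (le_of_eq ?_)))
      · rintro ω ⟨-, h2⟩
        exact h2
      · have h1 := ((Finset.mem_filter.1 hT).2 (T q.2)).2
        have h2 := Nat.ceil_lt_add_one (show 0 ≤ (n : ℝ) / 3 by positivity)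
        have h3 : ((Finset.univ.filter fun k => T k = T q.2).card : ℝ) ≤ ⌈(n : ℝ) / 3⌉₊ := by
          exact_mod_cast h1
        linarith
      · rw [mul_pow, hsnL]
        field_simp
  have e0 := measureReal_exists_le hentry
  have e1 := measureReal_exists_le hlin
  have e2 := measureReal_exists_le hin
  have e3 := measureReal_exists_le (hside π)
  have e4 := measureReal_exists_le (hside (revOrder π))
  simp only [Fintype.card_prod, Fintype.card_option, Fintype.card_fin, Nat.cast_mul] at e0 e1 e2 e3 e4
  have u : P.real {ω | Failure ch π M σ δ₄ T (E ω)} ≤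
      P.real {ω | ∃ q, EntryFailure (E ω) q} + (P.real {ω | ∃ q, LinearFailure M T (E ω) q} +
      (P.real {ω | ∃ q, InnerFailure T (E ω) q} +
      (P.real {ω | ∃ q, SideFailure ch π M σ δ₄ T (E ω) q} +
      P.real {ω | ∃ q, SideFailure ch (revOrder π) M σ δ₄ T (E ω) q}))) :=
    (measureReal_union_le _ _).trans (add_le_add_right ((measureReal_union_le _ _).trans
      (add_le_add_right ((measureReal_union_le _ _).trans (add_le_add_right
        (measureReal_union_le _ _) _)) _)) _)
  refine u.trans ?_
  push_cast at e0 e1 e2 e3 e4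
  nlinarith

/-- With high probability the sample is good. -/
theorem IsNoise.prob_not_goodSample_le (h : IsNoise E P) [IsProbabilityMeasure P]
    (ch : SabreChoices n) (π : Equiv.Perm (Fin n)) {M : Matrix (Fin n) (Fin n) ℝ}
    (hM : ∀ i j, M i j ^ 2 ≤ 1) {σ : ℝ} (hσ : 0 < σ) (δ₄ : ℝ) (hn : 30 ≤ n)
    (hlog : 1 ≤ Real.log n) {T : Ω → Fin n → Fin 3} (hT : Measurable T)
    (hmap : P.map T = uniformOn (balancedPartitions n))
    (hind : IndepFun (fun ω (i j : Fin n) => E ω i j) T P) :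
    P.real {ω | ¬ GoodSample ch π M (E ω) (M + σ • E ω) (T ω) δ₄ (innerError n σ)} ≤
      3 * ((n : ℝ) + 1) ^ 2 * (85 / 89) ^ ⌈√(n : ℝ)⌉₊ +
        22 * (n : ℝ) ^ 2 * Real.exp (-5 * Real.log n) := by
  have hE : Measurable fun ω (i j : Fin n) => E ω i j :=
    measurable_pi_lambda _ fun i => measurable_pi_lambda _ fun j => h.measurable i j
  -- Balance is part of the event because the tail bound uses the block size; unbalanced partitions
  -- have probability zero.
  let B : Set ((Fin n → Fin 3) × (Fin n → Fin n → ℝ)) :=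
    {z | z.1 ∈ balanced n ∧ Failure ch π M σ δ₄ z.1 (Matrix.of z.2)}
  have hB : MeasurableSet B := by
    have : B = ⋃ T₀ ∈ balanced n, {T₀} ×ˢ
        {x : Fin n → Fin n → ℝ | Failure ch π M σ δ₄ T₀ (Matrix.of x)} := by
      ext ⟨T₁, x⟩
      simp [B]
    rw [this]
    exact Finset.measurableSet_biUnion _ fun T₀ _ =>
      (measurableSet_singleton T₀).prod (measurableSet_failure ch π M σ δ₄ T₀)
  have h1 : P.real {ω | (T ω, fun i j => E ω i j) ∈ B} ≤
      22 * (n : ℝ) ^ 2 * Real.exp (-5 * Real.log n) := by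
    refine measureReal_le_of_indepFun hT hE hind.symm hB (by positivity) fun T₀ => ?_
    by_cases hT₀ : T₀ ∈ balanced n
    · refine (measureReal_mono ?_).trans
        (h.prob_failure_le ch π hM σ δ₄ hT₀ (by omega) hlog)
      rintro ω ⟨-, hω⟩
      exact hω
    · have : {ω | (T₀, fun i j => E ω i j) ∈ B} = ∅ := by
        ext ω
        simp [B, hT₀]
      rw [this, measureReal_empty]
      positivity
  have h2 := prob_not_dense_le hn hT hmap π
  have h3 := prob_not_balanced hT hmap
  have hsub : {ω | ¬ GoodSample ch π M (E ω) (M + σ • E ω) (T ω) δ₄ (innerError n σ)} ⊆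
      ({ω | ¬ ∀ t, IsDense π fun i => decide (T ω i = t)} ∪ {ω | T ω ∉ balanced n}) ∪
        {ω | (T ω, fun i j => E ω i j) ∈ B} := by
    intro ω hω
    by_contra hcon
    simp only [Set.mem_union, not_or] at hcon
    obtain ⟨⟨hc1, hc2⟩, hc3⟩ := hcon
    refine hω (goodSample_of_not_failure hσ hlog (not_not.1 hc1) fun hf => ?_)
    exact hc3 ⟨not_not.1 hc2, hf⟩
  have h4 := measureReal_mono (μ := P) hsub (measure_ne_top _ _)
  have h5 := measureReal_union_le (μ := P)
    ({ω | ¬ ∀ t, IsDense π fun i => decide (T ω i = t)} ∪ {ω | T ω ∉ balanced n})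
    {ω | (T ω, fun i j => E ω i j) ∈ B}
  have h6 := measureReal_union_le (μ := P)
    {ω | ¬ ∀ t, IsDense π fun i => decide (T ω i = t)} {ω | T ω ∉ balanced n}
  linarith

end Concentration

/-! ### The conditions for large `n` -/

section Asymptotics

open Filter

/-- The additive error of the estimated distances. -/
def distanceError (n : ℕ) (β σ : ℝ) : ℝ :=
  √(n * (4 * β * √(n : ℝ) + 12 * innerError n σ))

theorem tendsto_log_natCast : Tendsto (fun n : ℕ => Real.log n) atTop atTop :=
  Real.tendsto_log_atTop.comp tendsto_natCast_atTop_atTop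

/-- With `q = n ^ (3/4)`, the additive error is of order `q √(log n)` and `β √n` is at most `β q`.
Each is eventually at most half of `δ₁ = q log n`. -/
theorem distanceError_le {n : ℕ} {β σ : ℝ} (hβ : 0 < β) (hn : 1 ≤ n)
    (h1 : 1 ≤ Real.log n) (h2 : 2 * β ≤ Real.log n)
    (h3 : 4 * (4 * β + 96 * σ + 576 * σ ^ 2) ≤ Real.log n) :
    β * √(n : ℝ) + distanceError n β σ ≤ sabreDelta n 1 := by
  have hn1 : (1 : ℝ) ≤ n := by exact_mod_cast hn
  have hn0 : (0 : ℝ) ≤ n := by linarith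
  set q := (n : ℝ) ^ (3 / 4 : ℝ) with hq
  have hq0 : 0 ≤ q := Real.rpow_nonneg hn0 _
  have hsq : √(n : ℝ) ≤ q := by
    rw [Real.sqrt_eq_rpow]
    exact Real.rpow_le_rpow_of_exponent_le hn1 (by norm_num)
  have hqq : q ^ 2 = n * √(n : ℝ) := by
    rw [hq, Real.sqrt_eq_rpow, ← Real.rpow_natCast, ← Real.rpow_mul hn0,
      ← Real.rpow_one_add' hn0 (by norm_num)]
    norm_num
  have hL : 0 ≤ Real.log n := by linarith
  have hκ : distanceError n β σ ≤ q * (Real.log n / 2) := by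
    refine Real.sqrt_le_iff.2 ⟨by positivity, ?_⟩
    have e1 : n * (4 * β * √(n : ℝ) + 12 * innerError n σ) =
        q ^ 2 * (4 * β + (96 * σ + 576 * σ ^ 2) * Real.log n) := by
      rw [hqq, innerError]; ring
    rw [e1, mul_pow]
    refine mul_le_mul_of_nonneg_left ?_ (sq_nonneg q)
    nlinarith
  have hβs : β * √(n : ℝ) ≤ q * (Real.log n / 2) := by
    calc β * √(n : ℝ) ≤ (Real.log n / 2) * q := by
          gcongr
          linarith
      _ = _ := mul_comm _ _
  have : sabreDelta n 1 = q * (Real.log n / 2) + q * (Real.log n / 2) := by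
    rw [sabreDelta, pow_one]; ring
  linarith

/-- A fourth power of the logarithm is negligible against `n ^ (1/4)`. The constant is `2496 = 48 *
52`, so both summands are at most `n / 52`. -/
theorem eventually_delta_le {α : ℝ} (hα : 0 < α) :
    ∀ᶠ n : ℕ in atTop, 48 * sabreDelta n 4 / α + 1 ≤ (n : ℝ) / 26 := by
  have h1 := ((isLittleO_log_rpow_rpow_atTop 4 (show (0 : ℝ) < 1 / 4 by norm_num)).bound
    (show 0 < α / 2496 by positivity)).filter_mono (tendsto_natCast_atTop_atTop (R := ℝ))
  rw [eventually_map] at h1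
  filter_upwards [h1, eventually_ge_atTop 52] with n h2 h3
  have hn : (52 : ℝ) ≤ n := by exact_mod_cast h3
  have hnpos : (0 : ℝ) < n := by linarith
  have hlog : 0 ≤ Real.log n := Real.log_nonneg (by linarith)
  have h4 : Real.log n ^ 4 ≤ α / 2496 * (n : ℝ) ^ (1 / 4 : ℝ) := by
    rw [Real.norm_of_nonneg (Real.rpow_nonneg hlog _),
      Real.norm_of_nonneg (Real.rpow_nonneg hnpos.le _)] at h2
    rw [← Real.rpow_natCast]
    exact_mod_cast h2
  have h5 : (n : ℝ) ^ (3 / 4 : ℝ) * (n : ℝ) ^ (1 / 4 : ℝ) = n := by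
    rw [← Real.rpow_add hnpos]; norm_num
  have h6 : sabreDelta n 4 ≤ α / 2496 * n := by
    calc sabreDelta n 4 ≤ (n : ℝ) ^ (3 / 4 : ℝ) * (α / 2496 * (n : ℝ) ^ (1 / 4 : ℝ)) := by
          rw [sabreDelta]; gcongr
      _ = α / 2496 * ((n : ℝ) ^ (3 / 4 : ℝ) * (n : ℝ) ^ (1 / 4 : ℝ)) := by ring
      _ = α / 2496 * n := by rw [h5]
  have h7 : 48 * sabreDelta n 4 / α ≤ n / 52 := by
    rw [div_le_iff₀ hα]
    linarith
  linarith

theorem eventually_largeScales {α β σ : ℝ} (hα : 0 < α) (hβ : 0 < β) (hσ : 0 < σ) :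
    ∀ᶠ n : ℕ in atTop, LargeScales n α β σ (distanceError n β σ) (innerError n σ) := by
  filter_upwards [eventually_delta_le hα, eventually_ge_atTop 324,
    tendsto_log_natCast.eventually_ge_atTop 1, tendsto_log_natCast.eventually_ge_atTop (2 * β),
    tendsto_log_natCast.eventually_ge_atTop (4 * (4 * β + 96 * σ + 576 * σ ^ 2)),
    tendsto_log_natCast.eventually_ge_atTop (1 + 144 * β / α),
    (tendsto_natCast_atTop_atTop (R := ℝ)).eventually_ge_atTop ((α / σ) ^ 2)]
    with n h1 h2 h3 h4 h5 h6 h7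
  have he : 0 ≤ innerError n σ := by
    have : 0 ≤ Real.log n := by linarith
    rw [innerError]; positivity
  refine ⟨hα, hβ, hσ, Real.sqrt_nonneg _, he, h2, ?_,
    distanceError_le hβ (by omega) h3 h4 h5, h6, h1, ?_⟩
  · rw [distanceError, Real.sq_sqrt (by positivity)]
  · rw [← div_le_iff₀' hσ]
    refine Real.le_sqrt_of_sq_le ?_
    have : (0 : ℝ) ≤ n := Nat.cast_nonneg n
    nlinarith

/-- Each term gets half of `1 / n ^ 2`. In the first, `n ≤ m ^ 2` with `m = ⌈√n⌉` turns the
polynomial factors into `m ^ 8`, which the geometric factor defeats. -/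
theorem eventually_prob_le : ∀ᶠ n : ℕ in atTop,
    3 * ((n : ℝ) + 1) ^ 2 * (85 / 89) ^ ⌈√(n : ℝ)⌉₊ +
      22 * (n : ℝ) ^ 2 * Real.exp (-5 * Real.log n) ≤ 1 / (n : ℝ) ^ 2 := by
  have h1 : ∀ᶠ m : ℕ in atTop, (m : ℝ) ^ 8 * (85 / 89 : ℝ) ^ m < 1 / 24 :=
    (tendsto_pow_const_mul_const_pow_of_abs_lt_one 8
      (show |(85 / 89 : ℝ)| < 1 by rw [abs_of_pos] <;> norm_num)).eventually
      (gt_mem_nhds (by norm_num))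
  have h2 : Tendsto (fun n : ℕ => ⌈√(n : ℝ)⌉₊) atTop atTop :=
    tendsto_nat_ceil_atTop.comp (Real.tendsto_sqrt_atTop.comp tendsto_natCast_atTop_atTop)
  filter_upwards [h2.eventually h1, eventually_ge_atTop 44] with n h3 h4
  have hn : (44 : ℝ) ≤ n := by exact_mod_cast h4
  have hnpos : (0 : ℝ) < n := by linarith
  have hm : √(n : ℝ) ≤ (⌈√(n : ℝ)⌉₊ : ℝ) := Nat.le_ceil _
  have hsq : √(n : ℝ) ^ 2 = n := Real.sq_sqrt hnpos.le
  generalize ⌈√(n : ℝ)⌉₊ = m at *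
  have hnm : (n : ℝ) ≤ (m : ℝ) ^ 2 := by
    rw [← hsq]
    exact pow_le_pow_left₀ (Real.sqrt_nonneg _) hm 2
  have hexp : Real.exp (-5 * Real.log n) = 1 / (n : ℝ) ^ 5 := by
    rw [neg_mul, Real.exp_neg, mul_comm, Real.exp_mul, Real.exp_log hnpos, one_div]
    norm_cast
  have e1 : 22 * (n : ℝ) ^ 2 * Real.exp (-5 * Real.log n) ≤ 1 / 2 * (1 / (n : ℝ) ^ 2) := by
    rw [hexp]
    calc 22 * (n : ℝ) ^ 2 * (1 / (n : ℝ) ^ 5) = 22 / n * (1 / (n : ℝ) ^ 2) := by field_simp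
      _ ≤ 1 / 2 * (1 / (n : ℝ) ^ 2) := by
          refine mul_le_mul_of_nonneg_right ?_ (by positivity)
          rw [div_le_iff₀ hnpos]
          linarith
  have e2 : 3 * ((n : ℝ) + 1) ^ 2 * (85 / 89) ^ m ≤ 1 / 2 * (1 / (n : ℝ) ^ 2) := by
    rw [← mul_div_assoc, mul_one, le_div_iff₀ (by positivity)]
    have h5 : ((n : ℝ) + 1) ^ 2 * (n : ℝ) ^ 2 ≤ 4 * (m : ℝ) ^ 8 := by
      calc ((n : ℝ) + 1) ^ 2 * (n : ℝ) ^ 2 ≤ (2 * n) ^ 2 * (n : ℝ) ^ 2 := by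
            gcongr
            linarith
        _ = 4 * (n : ℝ) ^ 4 := by ring
        _ ≤ 4 * ((m : ℝ) ^ 2) ^ 4 := by gcongr
        _ = 4 * (m : ℝ) ^ 8 := by ring
    calc 3 * ((n : ℝ) + 1) ^ 2 * (85 / 89) ^ m * (n : ℝ) ^ 2
        = 3 * (((n : ℝ) + 1) ^ 2 * (n : ℝ) ^ 2) * (85 / 89) ^ m := by ring
      _ ≤ 3 * (4 * (m : ℝ) ^ 8) * (85 / 89) ^ m := by gcongr
      _ = 12 * ((m : ℝ) ^ 8 * (85 / 89) ^ m) := by ring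
      _ ≤ 1 / 2 := by linarith
  linarith

end Asymptotics

end

theorem corollary4p3 :
    (∀ α β σ : ℝ, 0 < α → 0 < β → 0 < σ → ∃ C : ℕ, ∀ n : ℕ, C ≤ n →
      ∀ (ch : SabreChoices n) (F : Matrix (Fin n) (Fin n) ℝ) (π : Equiv.Perm (Fin n)),
        F.IsSymm → BiLipschitz α β F →
      ∀ (Ω : Type*) [MeasurableSpace Ω] (P : Measure Ω) [IsProbabilityMeasure P]
        (E : Ω → Matrix (Fin n) (Fin n) ℝ) (T : Ω → Fin n → Fin 3),
        IsNoise E P →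
        Measurable T →
        P.map T = uniformOn (balancedPartitions n) →
        IndepFun (fun ω (i j : Fin n) => E ω i j) T P →
        1 - 1 / (n : ℝ) ^ 2 ≤ P.real {ω |
          frobeniusLoss F (sabre ch σ (F.submatrix π π + σ • E ω) (T ω)).val π ≤
            320 * (β * σ / α) * √(n * Real.log n)}) ∧
    (∃ K : ℕ, ∀ (n : ℕ) (ch : SabreChoices n) (σ : ℝ) (A : Matrix (Fin n) (Fin n) ℝ)
      (T : Fin n → Fin 3), (sabre ch σ A T).cost ≤ K * n ^ 3) := by
  refine ⟨fun α β σ hα hβ hσ => ?_, 615, fun n ch σ A T => cost_sabre_le ch σ A T⟩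
  obtain ⟨C, hC⟩ := Filter.eventually_atTop.1
    ((eventually_largeScales hα hβ hσ).and eventually_prob_le)
  refine ⟨C, fun n hn ch F π hs hF Ω _ P _ E T hE hT hmap hind => ?_⟩
  obtain ⟨hscale, hprob⟩ := hC n hn
  have hM : ∀ i j, (F.submatrix π π) i j ^ 2 ≤ 1 := fun i j => by
    have := hF.mem_Icc (π i) (π j)
    exact pow_le_one₀ this.1 this.2
  have h1 := hE.prob_not_goodSample_le ch π hM hσ (sabreDelta n 4)
    (by have := hscale.le_n; omega) hscale.one_le_log hT hmap hind
  -- The two sets cover `Ω`, and subadditivity holds for arbitrary sets, so the event of small loss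
  -- need not be measurable.
  have h2 : (Set.univ : Set Ω) ⊆ {ω | frobeniusLoss F
      (sabre ch σ (F.submatrix π π + σ • E ω) (T ω)).val π ≤
        320 * (β * σ / α) * √(n * Real.log n)} ∪
      {ω | ¬ GoodSample ch π (F.submatrix π π) (E ω) (F.submatrix π π + σ • E ω) (T ω)
        (sabreDelta n 4) (innerError n σ)} := by
    intro ω _
    by_cases hg : GoodSample ch π (F.submatrix π π) (E ω) (F.submatrix π π + σ • E ω) (T ω)
        (sabreDelta n 4) (innerError n σ)
    · exact Or.inl (hscale.frobeniusLoss_le hF hs rfl hg)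
    · exact Or.inr hg
  have h3 := (measureReal_mono (μ := P) h2 (measure_ne_top _ _)).trans (measureReal_union_le _ _)
  rw [probReal_univ] at h3
  linarith
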